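/- Let $d\in\{2,3\}$ and let $\Omega\subset\mathbb R^d$ be a nonempty, bounded, connected open set whose boundary is contained in a finite union of affine hyperplanes (for instance a polygonal domain if $d=2$ or a Lipschitz polyhedral domain if $d=3$). Let $H^1_0(\Omega)$ be the closure of $C_c^\infty(\Omega)$ in $H^1(\Omega)$, $\mathbf H^1_0(\Omega)=H^1_0(\Omega)^d$ with $(\mathbf v,\mathbf w)_{\mathbf H^1_0(\Omega)}=\sum_{i,j}(\partial_j v_i,\partial_j w_i)_{L^2(\Omega)}$, $\mathbf H^{-1}(\Omega)$ its dual space, $L^2_{zmv}(\Omega)=\{q\in L^2(\Omega):\int_\Omega q=0\}$, and $\mathcal X=\mathbf H^1_0(\Omega)\times L^2_{zmv}(\Omega)$. Let $\mathbf V=\{\mathbf v\in\mathbf H^1_0(\Omega):\operatorname{div}\mathbf v=0\}$ and let $\mathbf V^\perp$ be its orthogonal complement for $(\cdot,\cdot)_{\mathbf H^1_0(\Omega)}$. Then: (1) for every $q\in L^2_{zmv}(\Omega)$ there is a unique $\tilde{\mathbf v}_q\in\mathbf V^\perp$ with $\operatorname{div}\tilde{\mathbf v}_q=q$; (2) for every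 $\mathbf f\in\mathbf H^{-1}(\Omega)$ there is a unique pair $(z_{\mathbf f},\mathbf w_{\mathbf f})\in L^2_{zmv}(\Omega)\times\mathbf V$ with $\mathbf f=\nabla z_{\mathbf f}-\Delta\mathbf w_{\mathbf f}$ in $\mathbf H^{-1}(\Omega)$; (3) let $\nu>0$, $\lambda\in\mathbb R$ and $\mathbf f\in\mathbf H^{-1}(\Omega)$. Let $\ell(\mathbf v,q)=\langle\mathbf f,\mathbf v\rangle$ be the right-hand side of the incompressible Stokes problem with homogeneous Dirichlet condition, let $T_\lambda(\mathbf v,q)=(\lambda\mathbf v-\nu^{-1}\tilde{\mathbf v}_q,\,-\lambda q)$, and let $\ell_\lambda=\ell\circ T_\lambda$ on $\mathcal X$. Then $$\ell_\lambda(\mathbf v,q)=\lambda\langle\mathbf f,\mathbf v\rangle+\nu^{-1}(z_{\mathbf f},q)_{L^2(\Omega)}\qquad\text{for all }(\mathbf v,q)\in\mathcal X .$$ In particular the nonlocal lifting $q\mapsto\tilde{\mathbf v}_q$ does not appear in this expression of $\ell_\lambda$. -/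

import Mathlib

open MeasureTheory TopologicalSpace
open scoped Distributions RealInnerProductSpace

noncomputable section

namespace StokesTCoercivity

/-- `ℝ^d` with the Euclidean norm. -/
abbrev Space (d : ℕ) : Type := EuclideanSpace ℝ (Fin d)

/-- A bounded domain with polygonal (`d = 2`) or polyhedral (`d = 3`) boundary: a nonempty
connected bounded open set whose boundary lies in a finite union of affine hyperplanes
`{x | ⟪n, x⟫ = c}`, `n ≠ 0` (lines in the plane, planes in three-space). -/
structure IsPolyhedralDomain {d : ℕ} (Ω : Opens (Space d)) : Prop where
  isConnected : IsConnected (Ω : Set (Space d))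
  isBounded : Bornology.IsBounded (Ω : Set (Space d))
  exists_hyperplanes : ∃ H : Finset (Space d × ℝ), (∀ h ∈ H, h.1 ≠ 0) ∧
    ∀ x ∈ frontier (Ω : Set (Space d)), ∃ h ∈ H, ⟪h.1, x⟫ = h.2

variable {d : ℕ} (Ω : Opens (Space d))

/-- `L²(Ω)`. -/
abbrev L2 : Type := Lp ℝ 2 ((volume : Measure (Space d)).restrict (Ω : Set (Space d)))

/-- `L²_zmv(Ω)`: the square integrable functions with zero mean value.  (On a bounded `Ω` the
integrability condition holds for every element of `L²(Ω)`.) -/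
def L2zmv : Submodule ℝ (L2 Ω) where
  carrier := {q | Integrable q (volume.restrict (Ω : Set (Space d))) ∧ ∫ x in Ω, q x = 0}
  zero_mem' := by
    have h : ((0 : L2 Ω) : Space d → ℝ) =ᵐ[volume.restrict (Ω : Set (Space d))] 0 :=
      Lp.coeFn_zero ..
    exact ⟨(integrable_congr h).2 (integrable_zero ..), by rw [integral_congr_ae h]; simp⟩
  add_mem' := by
    rintro p q ⟨hp, hp0⟩ ⟨hq, hq0⟩
    have h := Lp.coeFn_add p q
    refine ⟨(integrable_congr h).2 (hp.add hq), ?_⟩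
    rw [integral_congr_ae h]
    simp only [Pi.add_apply]
    rw [integral_add hp hq, hp0, hq0, add_zero]
  smul_mem' := by
    rintro c q ⟨hq, hq0⟩
    have h := Lp.coeFn_smul c q
    refine ⟨(integrable_congr h).2 (hq.smul c), ?_⟩
    rw [integral_congr_ae h]
    simp only [Pi.smul_apply]
    rw [integral_smul, hq0, smul_zero]

/-- `L²(Ω) × L²(Ω)^d`, with the Hilbert norm `(‖v‖² + ∑ⱼ ‖gⱼ‖²)^{1/2}`.  A Sobolev function `v` is
represented in it by the pair `(v, ∇v)`, so that this norm is the `H¹(Ω)` norm of `v`. -/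
abbrev L2Pair : Type := WithLp 2 (L2 Ω × PiLp 2 (fun _ : Fin d => L2 Ω))

/-- `H¹₀(Ω)`: the closure of the test functions `C_c^∞(Ω)` for the `H¹(Ω)` norm, each element being
represented by the pair of the function and its (weak) gradient. -/
def H10 : Submodule ℝ (L2Pair Ω) :=
  (Submodule.span ℝ {p : L2Pair Ω | ∃ φ : 𝓓(Ω, ℝ),
    p.fst =ᵐ[volume.restrict (Ω : Set (Space d))] (fun x => φ x) ∧
    ∀ j : Fin d, p.snd j =ᵐ[volume.restrict (Ω : Set (Space d))]
      (fun x => fderiv ℝ φ x (EuclideanSpace.single j 1))}).topologicalClosure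

/-- The velocity space `𝐇¹₀(Ω) = H¹₀(Ω)^d`. -/
abbrev Velocity : Type := PiLp 2 (fun _ : Fin d => H10 Ω)

set_option synthInstance.maxHeartbeats 200000 in
instance instVelocityNormedAddCommGroup : NormedAddCommGroup (Velocity Ω) := inferInstance

set_option synthInstance.maxHeartbeats 200000 in
instance instVelocityInnerProductSpace : InnerProductSpace ℝ (Velocity Ω) := inferInstance

set_option synthInstance.maxHeartbeats 200000 in
instance instVelocityNormedSpace : NormedSpace ℝ (Velocity Ω) := inferInstance

set_option synthInstance.maxHeartbeats 200000 in
instance instVelocityModule : Module ℝ (Velocity Ω) := inferInstance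

/-- The dual space `𝐇⁻¹(Ω)` of `𝐇¹₀(Ω)`. -/
abbrev HMinus1 : Type := StrongDual ℝ (Velocity Ω)

/-- The product space `𝒳 = 𝐇¹₀(Ω) × L²_zmv(Ω)`. -/
abbrev X : Type := Velocity Ω × L2zmv Ω

/-- The partial derivative `∂ⱼ vᵢ ∈ L²(Ω)` of a component of `𝐯 ∈ 𝐇¹₀(Ω)`. -/
def partialD (i j : Fin d) : Velocity Ω →L[ℝ] L2 Ω :=
  (PiLp.proj 2 (𝕜 := ℝ) (fun _ : Fin d => L2 Ω) j) ∘L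
    (WithLp.sndL 2 ℝ (L2 Ω) (PiLp 2 (fun _ : Fin d => L2 Ω))) ∘L
    (H10 Ω).subtypeL ∘L
    (PiLp.proj 2 (𝕜 := ℝ) (fun _ : Fin d => H10 Ω) i)

/-- The divergence `div 𝐯 = ∑ᵢ ∂ᵢ vᵢ`. -/
def divL : Velocity Ω →L[ℝ] L2 Ω := ∑ i, partialD Ω i i

/-- The inner product `(𝐯, 𝐰)_{𝐇¹₀(Ω)} = ∑ᵢⱼ (∂ⱼ vᵢ, ∂ⱼ wᵢ)_{L²(Ω)}`. -/
def gradInner (v w : Velocity Ω) : ℝ := ∑ i, ∑ j, ⟪partialD Ω i j v, partialD Ω i j w⟫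

/-- `𝐕`, the divergence-free fields in `𝐇¹₀(Ω)`. -/
def V : Submodule ℝ (Velocity Ω) := LinearMap.ker (divL Ω).toLinearMap

/-- `𝐕^⊥`, the orthogonal complement of `𝐕` for the inner product `(·,·)_{𝐇¹₀(Ω)}`. -/
def Vperp : Submodule ℝ (Velocity Ω) where
  carrier := {v | ∀ w ∈ V Ω, gradInner Ω v w = 0}
  zero_mem' := fun w _ => by simp [gradInner]
  add_mem' := fun {a b} ha hb w hw => by
    have h : gradInner Ω (a + b) w = gradInner Ω a w + gradInner Ω b w := by
      simp [gradInner, inner_add_left, Finset.sum_add_distrib]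
    rw [h, ha w hw, hb w hw, add_zero]
  smul_mem' := fun c a ha w hw => by
    have h : gradInner Ω (c • a) w = c * gradInner Ω a w := by
      simp [gradInner, real_inner_smul_left, Finset.mul_sum]
    rw [h, ha w hw, mul_zero]

/-- `∇z ∈ 𝐇⁻¹(Ω)` for `z ∈ L²(Ω)`: `⟨∇z, 𝐯⟩ = -(z, div 𝐯)`. -/
def gradDist (z : L2 Ω) : HMinus1 Ω := -((innerSL ℝ z) ∘L divL Ω)

/-- `-Δ𝐰 ∈ 𝐇⁻¹(Ω)` for `𝐰 ∈ 𝐇¹₀(Ω)`: `⟨-Δ𝐰, 𝐯⟩ = ∑ᵢⱼ (∂ⱼ wᵢ, ∂ⱼ vᵢ)`. -/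
def negLaplacian (w : Velocity Ω) : HMinus1 Ω :=
  ∑ i, ∑ j, (innerSL ℝ (partialD Ω i j w)) ∘L partialD Ω i j

/-- `ṽ_q`: the element of `𝐕^⊥` with `div ṽ_q = q`. -/
def divLift (q : L2zmv Ω) : Vperp Ω :=
  Classical.epsilon fun v : Vperp Ω => divL Ω v = q

/-- The pair `(z_f, 𝐰_f) ∈ L²_zmv(Ω) × 𝐕` with `f = ∇z_f - Δ𝐰_f`. -/
def stokesSplit (f : HMinus1 Ω) : L2zmv Ω × V Ω :=
  Classical.epsilon fun p : L2zmv Ω × V Ω => f = gradDist Ω p.1 + negLaplacian Ω p.2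

/-- `z_f ∈ L²_zmv(Ω)`. -/
def zPart (f : HMinus1 Ω) : L2zmv Ω := (stokesSplit Ω f).1

/-- The linear form `ℓ(𝐯, q) = ⟨f, 𝐯⟩ - (g, q)` on `𝒳`. -/
def ell (f : HMinus1 Ω) (g : L2zmv Ω) (x : X Ω) : ℝ := f x.1 - ⟪g, x.2⟫

/-- The operator `T_λ(𝐯, q) = (λ𝐯 - ν⁻¹ ṽ_q, -λq)` on `𝒳`. -/
def T (ν lam : ℝ) (x : X Ω) : X Ω :=
  (lam • x.1 - ν⁻¹ • (divLift Ω x.2 : Velocity Ω), -(lam • x.2))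

/-- The transformed right-hand side `ℓ_λ = ℓ ∘ T_λ` of the incompressible problem (`g = 0`). -/
def ellLam (ν lam : ℝ) (f : HMinus1 Ω) (x : X Ω) : ℝ := ell Ω f 0 (T Ω ν lam x)

end StokesTCoercivity

end

noncomputable section

namespace StokesTCoercivity

open scoped ENNReal NNReal ContDiff

/-! ### Bessel families -/

/-! Everything rests on one fact: the divergence maps 𝐇¹₀(Ω) onto the mean zero functions
(`IsPolyhedralDomain.exists_divL_eq`). Granted this, subtracting from a solution its projection onto
𝐕 gives the lifting in 𝐕^⊥, and the Poincaré inequality makes the gradient form definite, hence the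
lifting unique. For the splitting, 𝐰_f is the Lax–Milgram solution on 𝐕. The remainder of f vanishes
on 𝐕, so it factors through the surjective divergence and is represented by a pressure
(`IsPolyhedralDomain.exists_gradDist_eq`). Testing f = ∇z_f - Δ𝐰_f on ṽ_q leaves -(z_f, q), since
ṽ_q is orthogonal to 𝐰_f; this is the formula for ℓ_λ.

Surjectivity is first obtained on the cube (0, 1/2)ⁿ by an explicit Fourier construction. Extend q
by zero to a period box and expand it in exponentials with coefficients c_k. Then apply in each
variable the operator u ↦ ∑ₐ `weight a` · u ∘ `refl a`. It returns q on the cube, because every map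
other than the identity leaves the positive half. It turns exponentials into functions vanishing at
0 and 1/2. It also preserves integrals, so k times a reflected exponential has a primitive vanishing
at both ends. The field with m-th component c_k (k_m / |k|²) · (that primitive in the variable m) ·
(reflected exponentials in the other variables) then vanishes on all faces, and its divergence is
the k-th term of the series of q. The term k = 0 is absent because q has mean zero. Tensorized
Bessel inequalities make the sum converge in H¹ (`summable_potential`), and the Piola transform
carries the solution to parallelepipeds.

Finally, the hyperplanes containing the boundary cut Ω into finitely many convex polytopes. Up to a
null set these are covered by finitely many parallelepipeds inside Ω
(`IsPolyhedralDomain.exists_cover`). Solvability on two overlapping open sets passes to their union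
(`DivSolvable.union`), and connectedness of Ω supplies enough overlaps to reach a set of full
measure. -/

theorem enorm_sum_sq_le {ι E : Type*} [SeminormedAddCommGroup E] (s : Finset ι) (a : ι → E) :
    ‖∑ i ∈ s, a i‖ₑ ^ 2 ≤ (s.card : ℝ≥0∞) * ∑ i ∈ s, ‖a i‖ₑ ^ 2 := by
  have h : ‖∑ i ∈ s, a i‖₊ ^ 2 ≤ (s.card : ℝ≥0) * ∑ i ∈ s, ‖a i‖₊ ^ 2 :=
    (pow_le_pow_left₀ zero_le (nnnorm_sum_le s a) 2).trans sq_sum_le_card_mul_sum_sq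
  simp only [enorm_eq_nnnorm]
  exact_mod_cast h

theorem enorm_add_sq_le {E : Type*} [SeminormedAddCommGroup E] (a b : E) :
    ‖a + b‖ₑ ^ 2 ≤ 2 * (‖a‖ₑ ^ 2 + ‖b‖ₑ ^ 2) := by
  simpa [Fin.sum_univ_two] using enorm_sum_sq_le (Finset.univ : Finset (Fin 2)) ![a, b]

/-- A family of continuous functions for which the synthesis operator `c ↦ ∑ₖ cₖ φₖ` is bounded
from `ℓ²` to `L²(μ)`. -/
def IsBessel {ι : Type*} (μ : Measure ℝ) (φ : ι → ℝ → ℂ) : Prop :=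
  (∀ k, Continuous (φ k)) ∧ ∃ M : ℝ≥0, ∀ (s : Finset ι) (c : ι → ℂ),
    ∫⁻ x, ‖∑ k ∈ s, c k * φ k x‖ₑ ^ 2 ∂μ ≤ M * ∑ k ∈ s, ‖c k‖ₑ ^ 2

namespace IsBessel

variable {ι : Type*} {μ : Measure ℝ} {φ ψ : ι → ℝ → ℂ}

theorem zero : IsBessel μ (fun (_ : ι) (_ : ℝ) => (0 : ℂ)) :=
  ⟨fun _ => continuous_const, 0, fun s c => by simp⟩

theorem add (hφ : IsBessel μ φ) (hψ : IsBessel μ ψ) :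
    IsBessel μ (fun k x => φ k x + ψ k x) := by
  obtain ⟨h1, M, hM⟩ := hφ
  obtain ⟨h2, N, hN⟩ := hψ
  refine ⟨fun k => (h1 k).add (h2 k), 2 * (M + N), fun s c => ?_⟩
  have hm : Measurable fun x => ‖∑ k ∈ s, c k * φ k x‖ₑ ^ 2 := by
    have : Continuous fun x => ∑ k ∈ s, c k * φ k x := by fun_prop
    exact (this.measurable.enorm).pow_const 2
  calc ∫⁻ x, ‖∑ k ∈ s, c k * (φ k x + ψ k x)‖ₑ ^ 2 ∂μ
      ≤ ∫⁻ x, 2 * (‖∑ k ∈ s, c k * φ k x‖ₑ ^ 2 + ‖∑ k ∈ s, c k * ψ k x‖ₑ ^ 2) ∂μ := by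
        refine lintegral_mono fun x => ?_
        simp only [mul_add, Finset.sum_add_distrib]
        rw [← mul_add]
        exact enorm_add_sq_le _ _
    _ = 2 * (∫⁻ x, ‖∑ k ∈ s, c k * φ k x‖ₑ ^ 2 ∂μ
          + ∫⁻ x, ‖∑ k ∈ s, c k * ψ k x‖ₑ ^ 2 ∂μ) := by
        rw [lintegral_const_mul' _ _ (by simp), lintegral_add_left hm]
    _ ≤ 2 * (M * ∑ k ∈ s, ‖c k‖ₑ ^ 2 + N * ∑ k ∈ s, ‖c k‖ₑ ^ 2) := by
        gcongr
        exacts [hM s c, hN s c]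
    _ = _ := by push_cast; ring

theorem sum {α : Type*} (t : Finset α) {φ : α → ι → ℝ → ℂ} (h : ∀ a ∈ t, IsBessel μ (φ a)) :
    IsBessel μ (fun k x => ∑ a ∈ t, φ a k x) := by
  classical
  induction t using Finset.induction_on with
  | empty => simpa using zero
  | insert a t ha ih =>
    simp only [Finset.sum_insert ha]
    exact (h a (by simp)).add (ih fun b hb => h b (by simp [hb]))

theorem mul_scalar (hφ : IsBessel μ φ) (a : ι → ℂ) {K : ℝ≥0} (ha : ∀ k, ‖a k‖₊ ≤ K) :
    IsBessel μ (fun k x => a k * φ k x) := by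
  obtain ⟨h1, M, hM⟩ := hφ
  refine ⟨fun k => continuous_const.mul (h1 k), M * K ^ 2, fun s c => ?_⟩
  have := hM s (fun k => c k * a k)
  simp only [← mul_assoc]
  refine this.trans ?_
  push_cast
  rw [mul_assoc]
  gcongr
  rw [Finset.mul_sum]
  refine Finset.sum_le_sum fun k _ => ?_
  rw [enorm_mul, mul_pow, mul_comm]
  gcongr
  exact_mod_cast ha k

theorem mul_fun (hφ : IsBessel μ φ) {w : ℝ → ℂ} (hw : Continuous w) {K : ℝ≥0}
    (hK : ∀ᵐ x ∂μ, ‖w x‖₊ ≤ K) : IsBessel μ (fun k x => w x * φ k x) := by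
  obtain ⟨h1, M, hM⟩ := hφ
  refine ⟨fun k => hw.mul (h1 k), K ^ 2 * M, fun s c => ?_⟩
  calc ∫⁻ x, ‖∑ k ∈ s, c k * (w x * φ k x)‖ₑ ^ 2 ∂μ
      ≤ ∫⁻ x, (K : ℝ≥0∞) ^ 2 * ‖∑ k ∈ s, c k * φ k x‖ₑ ^ 2 ∂μ := by
        refine lintegral_mono_ae (hK.mono fun x hx => ?_)
        have : ∑ k ∈ s, c k * (w x * φ k x) = w x * ∑ k ∈ s, c k * φ k x := by
          rw [Finset.mul_sum]
          exact Finset.sum_congr rfl fun k _ => by ring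
        rw [this, enorm_mul, mul_pow]
        gcongr
        exact_mod_cast hx
    _ ≤ _ := by
        rw [lintegral_const_mul' _ _ (by simp)]
        push_cast
        rw [mul_assoc]
        gcongr
        exact hM s c

end IsBessel

theorem sq_lintegral_le {α : Type*} [MeasurableSpace α] (μ : Measure α) {f : α → ℝ≥0∞}
    (hf : AEMeasurable f μ) : (∫⁻ x, f x ∂μ) ^ 2 ≤ μ Set.univ * ∫⁻ x, f x ^ 2 ∂μ := by
  have h := ENNReal.lintegral_mul_le_Lp_mul_Lq μ Real.HolderConjugate.two_two
    (f := fun _ => 1) aemeasurable_const hf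
  simp only [Pi.mul_apply, one_mul, ENNReal.one_rpow, lintegral_const] at h
  refine (pow_le_pow_left₀ zero_le h 2).trans ?_
  rw [mul_pow]
  simp only [← ENNReal.rpow_natCast, ← ENNReal.rpow_mul]
  norm_num

/-- The interval `(0, 1/2]` with Lebesgue measure. -/
def halfMeasure : Measure ℝ := volume.restrict (Set.Ioc 0 (1 / 2))

instance : IsFiniteMeasure halfMeasure := by unfold halfMeasure; infer_instance

theorem halfMeasure_univ : halfMeasure Set.univ = ENNReal.ofReal (1 / 2) := by
  simp [halfMeasure]

/-- By Cauchy–Schwarz the square of a primitive is bounded pointwise by the L² integral of its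
integrand, and the interval has length below one, so the constant M is kept. -/
theorem IsBessel.primitive {ι : Type*} {φ : ι → ℝ → ℂ} (hφ : IsBessel halfMeasure φ) :
    IsBessel halfMeasure (fun k x => ∫ t in (0 : ℝ)..x, φ k t) := by
  obtain ⟨h1, M, hM⟩ := hφ
  refine ⟨fun k => intervalIntegral.continuous_primitive
    (fun a b => (h1 k).intervalIntegrable a b) 0, M, fun s c => ?_⟩
  have hc : Continuous fun x => ∑ k ∈ s, c k * φ k x := by fun_prop
  have key : ∀ x ∈ Set.Ioc (0 : ℝ) (1 / 2), ‖∑ k ∈ s, c k * ∫ t in (0 : ℝ)..x, φ k t‖ₑ ^ 2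
      ≤ M * ∑ k ∈ s, ‖c k‖ₑ ^ 2 := by
    intro x hx
    have e : ∑ k ∈ s, c k * ∫ t in (0 : ℝ)..x, φ k t
        = ∫ t in (0 : ℝ)..x, ∑ k ∈ s, c k * φ k t := by
      rw [intervalIntegral.integral_finsetSum]
      · simp
      · intro k _
        exact ((h1 k).const_mul _ |>.intervalIntegrable _ _)
    rw [e, intervalIntegral.integral_of_le hx.1.le]
    have h2 : ‖∫ t in Set.Ioc 0 x, ∑ k ∈ s, c k * φ k t‖ₑ
        ≤ ∫⁻ t, ‖∑ k ∈ s, c k * φ k t‖ₑ ∂halfMeasure := by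
      refine (enorm_integral_le_lintegral_enorm _).trans ?_
      exact lintegral_mono_set (Set.Ioc_subset_Ioc_right hx.2)
    refine (pow_le_pow_left₀ zero_le h2 2).trans ?_
    refine (sq_lintegral_le _ hc.measurable.enorm.aemeasurable).trans ?_
    rw [halfMeasure_univ]
    refine (mul_le_of_le_one_left zero_le ?_).trans (hM s c)
    rw [ENNReal.ofReal_le_one]; norm_num
  calc ∫⁻ x, ‖∑ k ∈ s, c k * ∫ t in (0 : ℝ)..x, φ k t‖ₑ ^ 2 ∂halfMeasure
      ≤ ∫⁻ _, M * ∑ k ∈ s, ‖c k‖ₑ ^ 2 ∂halfMeasure :=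
        lintegral_mono_ae ((ae_restrict_iff' measurableSet_Ioc).2 (ae_of_all _ key))
    _ ≤ _ := by
        rw [lintegral_const, halfMeasure_univ]
        refine mul_le_of_le_one_right zero_le ?_
        rw [ENNReal.ofReal_le_one]; norm_num

theorem sum_piFinset_succ {ι E : Type*} [AddCommMonoid E] (n : ℕ) (s : Finset ι)
    (F : (Fin (n + 1) → ι) → E) :
    ∑ k ∈ Fintype.piFinset (fun _ : Fin (n + 1) => s), F k
      = ∑ k₀ ∈ s, ∑ k ∈ Fintype.piFinset (fun _ : Fin n => s), F (Fin.cons k₀ k) := by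
  rw [← Finset.sum_product']
  symm
  refine Finset.sum_bij' (fun p _ => Fin.cons p.1 p.2) (fun k _ => (k 0, Fin.tail k)) ?_ ?_ ?_ ?_ ?_
  · intro p hp
    simp only [Finset.mem_product, Fintype.mem_piFinset] at hp ⊢
    exact Fin.cases hp.1 hp.2
  · intro k hk
    simp only [Finset.mem_product, Fintype.mem_piFinset] at hk ⊢
    exact ⟨hk 0, fun i => hk i.succ⟩
  · intro p _; simp
  · intro k _; simp
  · intro p _; rfl

/-- Tensor products of Bessel families are Bessel families. -/
theorem lintegral_tensor_le {ι : Type*} (μ : Measure ℝ) [SigmaFinite μ] (n : ℕ)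
    (φ : Fin n → ι → ℝ → ℂ) (M : Fin n → ℝ≥0) (hφ : ∀ i k, Continuous (φ i k))
    (hM : ∀ i (s : Finset ι) (c : ι → ℂ),
      ∫⁻ x, ‖∑ k ∈ s, c k * φ i k x‖ₑ ^ 2 ∂μ ≤ M i * ∑ k ∈ s, ‖c k‖ₑ ^ 2)
    (s : Finset ι) (c : (Fin n → ι) → ℂ) :
    ∫⁻ x, ‖∑ k ∈ Fintype.piFinset (fun _ => s), c k * ∏ i, φ i (k i) (x i)‖ₑ ^ 2
        ∂(Measure.pi fun _ => μ)
      ≤ (∏ i, (M i : ℝ≥0∞)) * ∑ k ∈ Fintype.piFinset (fun _ => s), ‖c k‖ₑ ^ 2 := by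
  induction n with
  | zero =>
    simp [Fintype.piFinset_of_isEmpty]
  | succ n ih =>
    have hmp := (measurePreserving_piFinSuccAbove (fun _ : Fin (n + 1) => μ) 0).symm
    rw [← hmp.lintegral_comp_emb (MeasurableEquiv.measurableEmbedding _)]
    have hcons : ∀ p : ℝ × (Fin n → ℝ),
        (MeasurableEquiv.piFinSuccAbove (fun _ : Fin (n + 1) => ℝ) 0).symm p
          = Fin.cons p.1 p.2 := fun p => by
      rw [MeasurableEquiv.piFinSuccAbove_symm_apply]
      simp [Fin.insertNthEquiv]
    simp only [hcons, sum_piFinset_succ, Fin.prod_univ_succ, Fin.cons_zero, Fin.cons_succ]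
    rw [lintegral_prod_symm]
    swap
    · refine Measurable.aemeasurable ?_
      have : Continuous fun p : ℝ × (Fin n → ℝ) =>
          ∑ k₀ ∈ s, ∑ k ∈ Fintype.piFinset (fun _ : Fin n => s),
            c (Fin.cons k₀ k) * (φ 0 k₀ p.1 * ∏ i : Fin n, φ i.succ (k i) (p.2 i)) := by
        fun_prop
      exact this.measurable.enorm.pow_const 2
    -- For frozen y this is a one-variable sum whose coefficients are the inner sums over the
    -- remaining indices. The induction hypothesis then bounds the integral in y of each squared
    -- coefficient.
    have step : ∀ y : Fin n → ℝ,
        ∫⁻ x, ‖∑ k₀ ∈ s, ∑ k ∈ Fintype.piFinset (fun _ : Fin n => s),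
            c (Fin.cons k₀ k) * (φ 0 k₀ x * ∏ i : Fin n, φ i.succ (k i) (y i))‖ₑ ^ 2 ∂μ
          ≤ M 0 * ∑ k₀ ∈ s, ‖∑ k ∈ Fintype.piFinset (fun _ : Fin n => s),
            c (Fin.cons k₀ k) * ∏ i : Fin n, φ i.succ (k i) (y i)‖ₑ ^ 2 := by
      intro y
      refine le_trans (le_of_eq ?_) (hM 0 s _)
      refine lintegral_congr fun x => ?_
      congr 3
      funext k₀
      rw [Finset.sum_mul]
      exact Finset.sum_congr rfl fun k _ => by ring
    refine (lintegral_mono step).trans ?_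
    rw [lintegral_const_mul' _ _ (by simp), lintegral_finsetSum]
    swap
    · intro k₀ _
      have : Continuous fun y : Fin n → ℝ => ∑ k ∈ Fintype.piFinset (fun _ : Fin n => s),
            c (Fin.cons k₀ k) * ∏ i : Fin n, φ i.succ (k i) (y i) := by fun_prop
      exact this.measurable.enorm.pow_const 2
    rw [mul_assoc]
    gcongr
    rw [Finset.mul_sum]
    exact Finset.sum_le_sum fun k₀ _ =>
      ih (fun i => φ i.succ) (fun i => M i.succ) (fun i => hφ i.succ) (fun i => hM i.succ)
        (fun k => c (Fin.cons k₀ k))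

end StokesTCoercivity
end

noncomputable section

namespace StokesTCoercivity

open scoped ENNReal NNReal ContDiff

/-! ### The reflected exponentials on `(0, 1/2)` -/

/-- `exp (2πikx)`. -/
def expo (k : ℤ) (x : ℝ) : ℂ := Complex.exp (2 * Real.pi * Complex.I * k * x)

@[fun_prop]
theorem contDiff_expo (k : ℤ) : ContDiff ℝ ∞ (expo k) := by
  unfold expo
  exact (contDiff_const.mul Complex.ofRealCLM.contDiff).cexp

@[fun_prop]
theorem continuous_expo (k : ℤ) : Continuous (expo k) := (contDiff_expo k).continuous

theorem hasDerivAt_expo (k : ℤ) (x : ℝ) :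
    HasDerivAt (expo k) (2 * Real.pi * Complex.I * k * expo k x) x := by
  unfold expo
  have h := ((Complex.ofRealCLM.hasDerivAt (x := x)).const_mul
    (2 * Real.pi * Complex.I * k : ℂ)).cexp
  simp only [Complex.ofRealCLM_apply, Complex.ofReal_one] at h
  convert h using 1
  ring

theorem expo_add (k l : ℤ) (x : ℝ) : expo (k + l) x = expo k x * expo l x := by
  simp only [expo, ← Complex.exp_add]; push_cast; ring_nf

theorem conj_expo (k : ℤ) (x : ℝ) : (starRingEnd ℂ) (expo k x) = expo (-k) x := by
  simp only [expo, ← Complex.exp_conj, map_mul, Complex.conj_ofReal, Complex.conj_I,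
    Complex.conj_ofNat, map_intCast]
  push_cast; ring_nf

theorem expo_add_int (k n : ℤ) (x : ℝ) : expo k (x + n) = expo k x := by
  have : (2 * Real.pi * Complex.I * k * ((x + n : ℝ) : ℂ))
      = 2 * Real.pi * Complex.I * k * x + ((k * n : ℤ) : ℂ) * (2 * Real.pi * Complex.I) := by
    push_cast; ring
  simp only [expo, this, Complex.exp_add, Complex.exp_int_mul_two_pi_mul_I, mul_one]

theorem integral_expo (k : ℤ) : ∫ x in (-(1 / 2) : ℝ)..1 / 2, expo k x = if k = 0 then 1 else 0 := by
  split_ifs with h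
  · subst h; simp [expo]; norm_num
  · have hd : ∀ x ∈ Set.uIcc (-(1 / 2) : ℝ) (1 / 2),
        HasDerivAt (fun x => (2 * Real.pi * Complex.I * k : ℂ)⁻¹ * expo k x) (expo k x) x := by
      intro x _
      have hk : (2 * Real.pi * Complex.I * k : ℂ) ≠ 0 := by
        simp [Real.pi_ne_zero, h]
      exact ((hasDerivAt_expo k x).const_mul _).congr_deriv (by
        rw [mul_assoc _ (k : ℂ), ← mul_assoc _ (k : ℂ), inv_mul_cancel_left₀ hk])
    rw [intervalIntegral.integral_eq_sub_of_hasDerivAt hd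
      ((continuous_expo k).intervalIntegrable _ _)]
    have := expo_add_int k 1 (-(1 / 2))
    norm_num at this ⊢
    rw [this]; ring

theorem lintegral_expo_sum (s : Finset ℤ) (c : ℤ → ℂ) :
    ∫⁻ x in Set.Ioc (-(1 / 2) : ℝ) (1 / 2), ‖∑ k ∈ s, c k * expo k x‖ₑ ^ 2
      = ∑ k ∈ s, ‖c k‖ₑ ^ 2 := by
  have hc : Continuous fun x => ∑ k ∈ s, c k * expo k x := by fun_prop
  have e1 : ∫ x in (-(1 / 2) : ℝ)..1 / 2, ((‖∑ k ∈ s, c k * expo k x‖ ^ 2 : ℝ) : ℂ)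
      = ((∑ k ∈ s, ‖c k‖ ^ 2 : ℝ) : ℂ) := by
    have : ∀ x, ((‖∑ k ∈ s, c k * expo k x‖ ^ 2 : ℝ) : ℂ)
        = ∑ k ∈ s, ∑ l ∈ s, (c k * (starRingEnd ℂ) (c l)) * expo (k + -l) x := by
      intro x
      rw [Complex.ofReal_pow, ← Complex.mul_conj', map_sum, Finset.sum_mul_sum]
      refine Finset.sum_congr rfl fun k _ => Finset.sum_congr rfl fun l _ => ?_
      rw [map_mul, conj_expo, expo_add]; ring
    simp only [this]
    rw [intervalIntegral.integral_finsetSum]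
    swap
    · intro k _
      exact Continuous.intervalIntegrable (by fun_prop) _ _
    push_cast
    refine Finset.sum_congr rfl fun k hk => ?_
    rw [intervalIntegral.integral_finsetSum]
    swap
    · intro l _
      exact Continuous.intervalIntegrable (by fun_prop) _ _
    simp only [intervalIntegral.integral_const_mul, integral_expo]
    rw [Finset.sum_eq_single k]
    · simp [Complex.mul_conj']
    · intro l _ hl
      have : k + -l ≠ 0 := by omega
      simp [this]
    · simp [hk]
  rw [intervalIntegral.integral_ofReal, intervalIntegral.integral_of_le (by norm_num)] at e1
  have e2 := Complex.ofReal_injective e1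
  have e3 : ∀ x, ‖∑ k ∈ s, c k * expo k x‖ₑ ^ 2
      = ENNReal.ofReal (‖∑ k ∈ s, c k * expo k x‖ ^ 2) := fun x => by
    rw [ENNReal.ofReal_pow (norm_nonneg _), ofReal_norm]
  simp only [e3]
  rw [← ofReal_integral_eq_lintegral_ofReal, e2, ENNReal.ofReal_sum_of_nonneg (fun _ _ => by positivity)]
  · refine Finset.sum_congr rfl fun k _ => ?_
    rw [ENNReal.ofReal_pow (norm_nonneg _), ofReal_norm]
  · have : Continuous fun x => ‖∑ k ∈ s, c k * expo k x‖ ^ 2 := by fun_prop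
    exact (this.integrableOn_Icc).mono_set Set.Ioc_subset_Icc_self
  · exact ae_of_all _ fun x => by positivity

/-- The affine change of variable costs a factor |σ⁻¹| and lands in one period, where Parseval's
identity `lintegral_expo_sum` applies. The open interval is used because two of the reflecting maps
send 1/2 to the excluded end -1/2. -/
theorem IsBessel.expo_comp {σ β : ℝ} (hσ : σ ≠ 0)
    (hτ : ∀ x ∈ Set.Ioo (0 : ℝ) (1 / 2), σ * x + β ∈ Set.Ioc (-(1 / 2) : ℝ) (1 / 2)) :
    IsBessel halfMeasure (fun (k : ℤ) x => expo k (σ * x + β)) := by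
  refine ⟨fun k => by fun_prop, |σ⁻¹|.toNNReal, fun s c => ?_⟩
  set h : ℝ → ℝ≥0∞ := fun y => ‖∑ k ∈ s, c k * expo k y‖ₑ ^ 2 with hh
  have hm : Measurable h := by
    have : Continuous fun y => ∑ k ∈ s, c k * expo k y := by fun_prop
    exact this.measurable.enorm.pow_const 2
  have hmI := hm.indicator (measurableSet_Ioc (a := (-(1 / 2) : ℝ)) (b := 1 / 2))
  calc ∫⁻ x in Set.Ioc 0 (1 / 2), h (σ * x + β)
      = ∫⁻ x in Set.Ioo 0 (1 / 2), h (σ * x + β) := by rw [restrict_Ioo_eq_restrict_Ioc]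
    _ ≤ ∫⁻ x in Set.Ioo 0 (1 / 2),
          (Set.Ioc (-(1 / 2) : ℝ) (1 / 2)).indicator h (σ * x + β) := by
        refine setLIntegral_mono' measurableSet_Ioo fun x hx => ?_
        rw [Set.indicator_of_mem (hτ x hx)]
    _ ≤ ∫⁻ x, (Set.Ioc (-(1 / 2) : ℝ) (1 / 2)).indicator h (σ * x + β) :=
        setLIntegral_le_lintegral _ _
    _ = ENNReal.ofReal |σ⁻¹| * ∫⁻ x in Set.Ioc (-(1 / 2) : ℝ) (1 / 2), h x := by
        rw [← lintegral_indicator measurableSet_Ioc,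
          ← lintegral_add_right_eq_self
            (fun y => (Set.Ioc (-(1 / 2) : ℝ) (1 / 2)).indicator h y) β]
        have := lintegral_map (μ := volume) (hmI.comp (measurable_add_const β))
          (measurable_const_mul σ)
        simp only [Function.comp_def] at this
        rw [← this, Real.map_volume_mul_left hσ, lintegral_smul_measure, smul_eq_mul]
    _ = _ := by rw [hh, lintegral_expo_sum]; rfl

/-- The slopes of the four affine maps of the reflection. -/
def slope : Fin 4 → ℝ := ![1, -1, -(1 / 2), -(1 / 2)]

/-- The offsets of the four affine maps of the reflection. -/
def shift : Fin 4 → ℝ := ![0, 0, 0, -(1 / 4)]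

/-- The affine maps `x`, `-x`, `-x/2`, `-x/2 - 1/4`, which map `(0, 1/2)` into `(-1/2, 1/2)`. -/
def refl (a : Fin 4) (x : ℝ) : ℝ := slope a * x + shift a

/-- The weights of the reflection. -/
def weight : Fin 4 → ℝ → ℝ :=
  ![fun _ => 1, fun x => 1 - 4 * (1 - 4 * x) ^ 2, fun x => 2 * (1 - 2 * x) ^ 2, fun x => 8 * x ^ 2]

/-- The derivatives of the weights. -/
def weightDeriv : Fin 4 → ℝ → ℝ :=
  ![fun _ => 0, fun x => 32 * (1 - 4 * x), fun x => -8 * (1 - 2 * x), fun x => 16 * x]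

theorem slope_ne_zero (a : Fin 4) : slope a ≠ 0 := by fin_cases a <;> simp [slope]

@[fun_prop]
theorem contDiff_weight (a : Fin 4) : ContDiff ℝ ∞ (weight a) := by
  fin_cases a <;> simp only [weight] <;> simp <;> fun_prop

@[fun_prop]
theorem contDiff_weightDeriv (a : Fin 4) : ContDiff ℝ ∞ (weightDeriv a) := by
  fin_cases a <;> simp only [weightDeriv] <;> simp <;> fun_prop

@[fun_prop]
theorem continuous_weight (a : Fin 4) : Continuous (weight a) := (contDiff_weight a).continuous

@[fun_prop]
theorem continuous_weightDeriv (a : Fin 4) : Continuous (weightDeriv a) :=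
  (contDiff_weightDeriv a).continuous

theorem hasDerivAt_weight (a : Fin 4) (x : ℝ) : HasDerivAt (weight a) (weightDeriv a x) x := by
  have h4 : HasDerivAt (fun x : ℝ => 1 - 4 * x) (-4) x := by
    simpa using ((hasDerivAt_id x).const_mul 4).const_sub 1
  have h2 : HasDerivAt (fun x : ℝ => 1 - 2 * x) (-2) x := by
    simpa using ((hasDerivAt_id x).const_mul 2).const_sub 1
  fin_cases a
  · exact hasDerivAt_const x 1
  · exact (((h4.fun_pow 2).const_mul 4).const_sub 1).congr_deriv (by simp [weightDeriv]; ring)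
  · exact ((h2.fun_pow 2).const_mul 2).congr_deriv (by simp [weightDeriv]; ring)
  · exact ((hasDerivAt_id x).fun_pow 2 |>.const_mul 8).congr_deriv (by simp [weightDeriv]; ring)

theorem hasDerivAt_refl (a : Fin 4) (x : ℝ) : HasDerivAt (refl a) (slope a) x := by
  exact (((hasDerivAt_id x).const_mul (slope a)).add_const (shift a)).congr_deriv (mul_one _)

@[fun_prop]
theorem contDiff_refl (a : Fin 4) : ContDiff ℝ ∞ (refl a) := by
  unfold refl; fun_prop

@[fun_prop]
theorem continuous_refl (a : Fin 4) : Continuous (refl a) := (contDiff_refl a).continuous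

theorem refl_mem {a : Fin 4} {x : ℝ} (hx : x ∈ Set.Ioo (0 : ℝ) (1 / 2)) :
    refl a x ∈ Set.Ioc (-(1 / 2) : ℝ) (1 / 2) := by
  obtain ⟨h1, h2⟩ := hx
  fin_cases a <;> simp [refl, slope, shift] <;> constructor <;> linarith

theorem refl_neg {a : Fin 4} (ha : a ≠ 0) {x : ℝ} (hx : x ∈ Set.Ioo (0 : ℝ) (1 / 2)) :
    refl a x < 0 := by
  obtain ⟨h1, h2⟩ := hx
  fin_cases a <;> simp [refl, slope, shift] at ha ⊢ <;> linarith

/-- The reflected exponential, which vanishes at `0` and `1/2`. -/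
def reflExpo (k : ℤ) (x : ℝ) : ℂ := ∑ a, (weight a x : ℂ) * expo k (refl a x)

/-- The derivative of the reflected exponential. -/
def reflExpoDeriv (k : ℤ) (x : ℝ) : ℂ :=
  ∑ a, ((weightDeriv a x : ℂ) * expo k (refl a x)
    + (weight a x * slope a : ℝ) * (2 * Real.pi * Complex.I * k) * expo k (refl a x))

/-- The primitive of `k` times the reflected exponential which vanishes at `0` and `1/2`. -/
def reflPrim (k : ℤ) (x : ℝ) : ℂ :=
  (∑ a, (weight a x / slope a : ℝ) * ((2 * Real.pi * Complex.I)⁻¹ * expo k (refl a x)))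
    + ∫ t in (0 : ℝ)..x, ∑ a, (-(weightDeriv a t / slope a) : ℝ)
        * ((2 * Real.pi * Complex.I)⁻¹ * expo k (refl a t))

theorem contDiff_ofReal_comp {f : ℝ → ℝ} (hf : ContDiff ℝ ∞ f) :
    ContDiff ℝ ∞ (fun x => (f x : ℂ)) := Complex.ofRealCLM.contDiff.comp hf

@[fun_prop]
theorem contDiff_reflExpo (k : ℤ) : ContDiff ℝ ∞ (reflExpo k) := by
  unfold reflExpo
  refine ContDiff.sum fun a _ => (contDiff_ofReal_comp (contDiff_weight a)).mul ?_
  exact (contDiff_expo k).comp (contDiff_refl a)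

theorem hasDerivAt_expo_refl (k : ℤ) (a : Fin 4) (x : ℝ) :
    HasDerivAt (fun x => expo k (refl a x))
      (slope a * (2 * Real.pi * Complex.I * k * expo k (refl a x))) x := by
  exact ((hasDerivAt_expo k (refl a x)).scomp x (hasDerivAt_refl a x)).congr_deriv (by simp)

theorem hasDerivAt_reflExpo (k : ℤ) (x : ℝ) :
    HasDerivAt (reflExpo k) (reflExpoDeriv k x) x := by
  unfold reflExpo reflExpoDeriv
  refine HasDerivAt.fun_sum fun a _ => ?_
  exact (((hasDerivAt_weight a x).ofReal_comp).mul (hasDerivAt_expo_refl k a x)).congr_deriv (by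
    push_cast; ring)

/-- Integration by parts: the derivatives of the weights cancel against the integrand. The factor k
compensates the 1/k of a primitive of `expo k`, so the formula for `reflPrim` has coefficients
independent of k, also at k = 0. -/
theorem hasDerivAt_reflPrim (k : ℤ) (x : ℝ) :
    HasDerivAt (reflPrim k) (k * reflExpo k x) x := by
  have hpi : (2 * Real.pi * Complex.I : ℂ) ≠ 0 := by simp [Real.pi_ne_zero]
  have h1 : HasDerivAt (fun x => ∑ a, ((weight a x / slope a : ℝ) : ℂ)
      * ((2 * Real.pi * Complex.I)⁻¹ * expo k (refl a x)))
      (∑ a, (((weightDeriv a x / slope a : ℝ) : ℂ)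
        * ((2 * Real.pi * Complex.I)⁻¹ * expo k (refl a x))
        + weight a x * (k * expo k (refl a x)))) x := by
    refine HasDerivAt.fun_sum fun a _ => ?_
    refine ((((hasDerivAt_weight a x).div_const (slope a)).ofReal_comp).mul
      ((hasDerivAt_expo_refl k a x).const_mul (2 * Real.pi * Complex.I)⁻¹)).congr_deriv ?_
    have hs : (slope a : ℂ) ≠ 0 := by exact_mod_cast slope_ne_zero a
    push_cast
    field_simp
  have h2 : HasDerivAt (fun x => ∫ t in (0 : ℝ)..x, ∑ a, ((-(weightDeriv a t / slope a) : ℝ) : ℂ)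
        * ((2 * Real.pi * Complex.I)⁻¹ * expo k (refl a t))) _ x :=
    (Continuous.integral_hasStrictDerivAt (by fun_prop) 0 x).hasDerivAt
  refine (h1.add h2).congr_deriv ?_
  rw [← Finset.sum_add_distrib, reflExpo, Finset.mul_sum]
  refine Finset.sum_congr rfl fun a _ => ?_
  push_cast; ring

@[fun_prop]
theorem contDiff_reflPrim (k : ℤ) : ContDiff ℝ ∞ (reflPrim k) := by
  rw [contDiff_infty_iff_deriv]
  refine ⟨fun x => (hasDerivAt_reflPrim k x).differentiableAt, ?_⟩
  rw [show deriv (reflPrim k) = fun x => k * reflExpo k x from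
    funext fun x => (hasDerivAt_reflPrim k x).deriv]
  fun_prop

theorem expo_neg_half (k : ℤ) : expo k (-(1 / 2)) = expo k (1 / 2) := by
  have := expo_add_int k 1 (-(1 / 2))
  norm_num at this ⊢
  exact this.symm

/-- The first three maps fix 0 and their weights there are 1, -3, 2; the fourth weight is 0. -/
theorem reflExpo_zero (k : ℤ) : reflExpo k 0 = 0 := by
  simp [reflExpo, Fin.sum_univ_four, weight, refl, slope, shift]
  ring

/-- At 1/2 the weights are 1, -3, 0, 2, and the three active maps land on ±1/2, which periodicity
identifies. -/
theorem reflExpo_half (k : ℤ) : reflExpo k (1 / 2) = 0 := by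
  have := expo_neg_half k
  simp [reflExpo, Fin.sum_univ_four, weight, refl, slope, shift] at this ⊢
  norm_num at this ⊢
  rw [this]
  ring

/-- The quotients weight / slope at 0 are 1, 3, -4, 0, so no constant of integration is needed. -/
theorem reflPrim_zero (k : ℤ) : reflPrim k 0 = 0 := by
  simp [reflPrim, Fin.sum_univ_four, weight, refl, slope, shift]
  ring

theorem integral_comp_refl (F : ℝ → ℂ) (a : Fin 4) :
    ∫ x in (0 : ℝ)..1 / 2, F (refl a x)
      = -((slope a)⁻¹ : ℝ) * ∫ y in refl a (1 / 2)..shift a, F y := by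
  have := intervalIntegral.integral_comp_mul_add (a := 0) (b := 1 / 2) F (slope_ne_zero a) (shift a)
  rw [intervalIntegral.integral_symm (shift a), neg_mul_neg]
  simpa [refl] using this

/-- This fixes the choice of the weights. The identity accounts for (0, 1/2). In the variable y < 0
the map -x contributes the density 1 - 4(1 + 4y)², and the two maps of slope -1/2 contribute 4(1 +
4y)² on (-1/4, 0) and on (-1/2, -1/4), so the densities add up to one. -/
theorem integral_reflExpo (k : ℤ) :
    ∫ x in (0 : ℝ)..1 / 2, reflExpo k x = ∫ x in (-(1 / 2) : ℝ)..1 / 2, expo k x := by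
  have i : ∀ (F : ℝ → ℂ), Continuous F → ∀ a b : ℝ, IntervalIntegrable F volume a b :=
    fun F hF a b => hF.intervalIntegrable a b
  set P : ℝ → ℂ := fun y => (4 * (1 + 4 * y) ^ 2 : ℝ) * expo k y with hP
  have hPc : Continuous P := by rw [hP]; fun_prop
  have e1 : ∫ x in (0 : ℝ)..1 / 2, (weight 1 x : ℂ) * expo k (refl 1 x)
      = ∫ y in (-(1 / 2) : ℝ)..0, (expo k y - P y) := by
    have h := integral_comp_refl (fun y => expo k y - P y) 1
    have h1 : refl 1 (1 / 2) = -(1 / 2) := by norm_num [refl, slope, shift]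
    have h2 : shift 1 = 0 := by norm_num [shift]
    have h3 : (-((slope 1)⁻¹ : ℝ) : ℂ) = 1 := by norm_num [slope]
    rw [h1, h2, h3, one_mul] at h
    rw [← h]
    refine intervalIntegral.integral_congr fun x _ => ?_
    simp [hP, weight, refl, slope, shift]
    ring
  have e2 : ∫ x in (0 : ℝ)..1 / 2, (weight 2 x : ℂ) * expo k (refl 2 x)
      = ∫ y in (-(1 / 4) : ℝ)..0, P y := by
    have h := integral_comp_refl P 2
    have h1 : refl 2 (1 / 2) = -(1 / 4) := by simp [refl, slope, shift]; norm_num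
    have h2 : shift 2 = 0 := by simp [shift]
    have h3 : (-((slope 2)⁻¹ : ℝ) : ℂ) = 2 := by simp [slope]
    rw [h1, h2, h3] at h
    rw [← mul_right_inj' (two_ne_zero (α := ℂ)), ← h, ← intervalIntegral.integral_const_mul]
    refine intervalIntegral.integral_congr fun x _ => ?_
    simp [hP, weight, refl, slope, shift]
    ring
  have e3 : ∫ x in (0 : ℝ)..1 / 2, (weight 3 x : ℂ) * expo k (refl 3 x)
      = ∫ y in (-(1 / 2) : ℝ)..-(1 / 4), P y := by
    have h := integral_comp_refl P 3
    have h1 : refl 3 (1 / 2) = -(1 / 2) := by simp [refl, slope, shift]; norm_num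
    have h2 : shift 3 = -(1 / 4) := by simp [shift]
    have h3 : (-((slope 3)⁻¹ : ℝ) : ℂ) = 2 := by simp [slope]
    rw [h1, h2, h3] at h
    rw [← mul_right_inj' (two_ne_zero (α := ℂ)), ← h, ← intervalIntegral.integral_const_mul]
    refine intervalIntegral.integral_congr fun x _ => ?_
    simp [hP, weight, refl, slope, shift]
    ring
  have e0 : ∫ x in (0 : ℝ)..1 / 2, (weight 0 x : ℂ) * expo k (refl 0 x)
      = ∫ y in (0 : ℝ)..1 / 2, expo k y := by
    simp [weight, refl, slope, shift]
  unfold reflExpo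
  rw [intervalIntegral.integral_finsetSum fun a _ => i _ (by fun_prop) _ _, Fin.sum_univ_four,
    e0, e1, e2, e3, intervalIntegral.integral_sub (i _ (by fun_prop) _ _) (i _ hPc _ _),
    ← intervalIntegral.integral_add_adjacent_intervals (i P hPc (-(1 / 2)) (-(1 / 4)))
      (i P hPc (-(1 / 4)) 0),
    ← intervalIntegral.integral_add_adjacent_intervals (i (expo k) (by fun_prop) (-(1 / 2)) 0)
      (i _ (by fun_prop) 0 (1 / 2))]
  ring

/-- The increment over the interval is k times the integral of `expo k` over a period: the integral
vanishes if k ≠ 0, the factor if k = 0. -/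
theorem reflPrim_half (k : ℤ) : reflPrim k (1 / 2) = 0 := by
  have h := intervalIntegral.integral_eq_sub_of_hasDerivAt
    (a := 0) (b := 1 / 2) (fun x _ => hasDerivAt_reflPrim k x)
    (Continuous.intervalIntegrable (by fun_prop) _ _)
  rw [reflPrim_zero, sub_zero, intervalIntegral.integral_const_mul, integral_reflExpo,
    integral_expo] at h
  rw [← h]
  split_ifs with hk <;> simp [hk]

theorem exists_bound_half {w : ℝ → ℂ} (hw : Continuous w) :
    ∃ K : ℝ≥0, ∀ᵐ x ∂halfMeasure, ‖w x‖₊ ≤ K := by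
  obtain ⟨K, hK⟩ := isCompact_Icc.exists_bound_of_continuousOn
    (hw.continuousOn (s := Set.Icc (0 : ℝ) (1 / 2)))
  refine ⟨K.toNNReal, (ae_restrict_iff' measurableSet_Ioc).2 (ae_of_all _ fun x hx => ?_)⟩
  rw [← norm_toNNReal]
  exact Real.toNNReal_le_toNNReal (hK x (Set.Ioc_subset_Icc_self hx))

theorem isBessel_expo_refl (a : Fin 4) :
    IsBessel halfMeasure (fun (k : ℤ) x => expo k (refl a x)) :=
  IsBessel.expo_comp (slope_ne_zero a) fun _ hx => refl_mem hx

theorem IsBessel.mul_continuous {ι : Type*} {φ : ι → ℝ → ℂ} (hφ : IsBessel halfMeasure φ)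
    {w : ℝ → ℂ} (hw : Continuous w) : IsBessel halfMeasure (fun k x => w x * φ k x) := by
  obtain ⟨K, hK⟩ := exists_bound_half hw
  exact hφ.mul_fun hw hK

theorem isBessel_reflExpo : IsBessel halfMeasure reflExpo :=
  IsBessel.sum _ fun a _ => (isBessel_expo_refl a).mul_continuous
    (w := fun x => (weight a x : ℂ)) (by fun_prop)

theorem isBessel_reflPrim : IsBessel halfMeasure reflPrim := by
  have h (a : Fin 4) := (isBessel_expo_refl a).mul_scalar
    (fun _ => (2 * Real.pi * Complex.I : ℂ)⁻¹) (fun _ => le_rfl)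
  refine (IsBessel.sum _ fun a _ => (h a).mul_continuous
    (w := fun x => ((weight a x / slope a : ℝ) : ℂ)) (by fun_prop)).add ?_
  exact (IsBessel.sum _ fun a _ => (h a).mul_continuous
    (w := fun x => ((-(weightDeriv a x / slope a) : ℝ) : ℂ)) (by fun_prop)).primitive

/-- `max 1 |k|`. -/
def freq (k : ℤ) : ℝ := max 1 |(k : ℝ)|

theorem freq_pos (k : ℤ) : 0 < freq k := lt_of_lt_of_le one_pos (le_max_left _ _)

/-- Dividing by `freq k` rather than by |k| also controls the terms with `weightDeriv`, which do not
vanish at k = 0. -/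
theorem isBessel_reflExpoDeriv :
    IsBessel halfMeasure (fun k x => ((freq k)⁻¹ : ℂ) * reflExpoDeriv k x) := by
  have h1 : ∀ k : ℤ, ‖((freq k)⁻¹ : ℂ)‖₊ ≤ 1 := fun k => by
    rw [← NNReal.coe_le_coe]
    simp only [coe_nnnorm, norm_inv, Complex.norm_real, Real.norm_eq_abs, abs_of_pos (freq_pos k)]
    exact inv_le_one_of_one_le₀ (le_max_left _ _)
  have h2 : ∀ k : ℤ, ‖((freq k)⁻¹ * k : ℂ)‖₊ ≤ 1 := fun k => by
    rw [← NNReal.coe_le_coe]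
    simp only [coe_nnnorm, norm_mul, norm_inv, Complex.norm_real, Real.norm_eq_abs,
      abs_of_pos (freq_pos k), Complex.norm_intCast]
    rw [NNReal.coe_one, inv_mul_le_one₀ (freq_pos k)]
    exact le_max_right _ _
  have := IsBessel.sum Finset.univ fun (a : Fin 4) _ =>
    (((isBessel_expo_refl a).mul_scalar _ h1).mul_continuous
      (w := fun x => (weightDeriv a x : ℂ)) (by fun_prop)).add
    (((isBessel_expo_refl a).mul_scalar _ h2).mul_continuous
      (w := fun x => (weight a x * slope a : ℝ) * (2 * Real.pi * Complex.I)) (by fun_prop))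
  convert this using 3 with k x
  rw [reflExpoDeriv, Finset.mul_sum]
  refine Finset.sum_congr rfl fun a _ => ?_
  push_cast
  ring

end StokesTCoercivity
end

noncomputable section

namespace StokesTCoercivity

open scoped ENNReal NNReal ContDiff Topology
open Filter

/-! ### Fourier series on the unit box -/

theorem eLpNorm_two_sq {α E : Type*} [MeasurableSpace α] [NormedAddCommGroup E] (μ : Measure α)
    (f : α → E) : eLpNorm f 2 μ ^ 2 = ∫⁻ x, ‖f x‖ₑ ^ 2 ∂μ := by
  have := eLpNorm_nnreal_pow_eq_lintegral (f := f) (μ := μ) (p := 2) (by norm_num)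
  norm_num at this
  exact_mod_cast this

/-- The box `(-1/2, 1/2]ⁿ`. -/
def unitBox (n : ℕ) : Set (Fin n → ℝ) := {x | ∀ i, x i ∈ Set.Ioc (-(1 / 2) : ℝ) (-(1 / 2) + 1)}

theorem measurableSet_unitBox (n : ℕ) : MeasurableSet (unitBox n) :=
  MeasurableSet.univ_pi' fun _ => measurableSet_Ioc

section Torus

local instance : MeasureSpace UnitAddCircle := ⟨AddCircle.haarAddCircle⟩

local instance : IsProbabilityMeasure (volume : Measure UnitAddCircle) :=
  inferInstanceAs (IsProbabilityMeasure AddCircle.haarAddCircle)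

open UnitAddTorus

theorem mFourier_coe (n : ℕ) (k : Fin n → ℤ) (x : Fin n → ℝ) :
    mFourier k (fun i => (x i : UnitAddCircle)) = ∏ i, expo (k i) (x i) := by
  simp only [mFourier, ContinuousMap.coe_mk, fourier_coe_apply, expo]
  simp

/-- The L² Fourier expansion on the torus, read on the fundamental domain with lower corner -1/2.
The torus has total mass one, so the zeroth coefficient is the integral itself. -/
theorem exists_fourier_series (n : ℕ) {q : (Fin n → ℝ) → ℂ}
    (hq : MemLp q 2 (volume.restrict (unitBox n))) :
    ∃ c : (Fin n → ℤ) → ℂ, Summable (fun k => ‖c k‖ ^ 2) ∧ c 0 = ∫ x in unitBox n, q x ∧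
      Tendsto (fun S : Finset (Fin n → ℤ) =>
        ∫⁻ x in unitBox n, ‖∑ k ∈ S, c k * ∏ i, expo (k i) (x i) - q x‖ₑ ^ 2) atTop (𝓝 0) := by
  set b : Fin n → ℝ := fun _ => -(1 / 2)
  set Q : UnitAddTorus (Fin n) → ℂ := fun t => q (measurableEquivPiIoc b t).1 with hQdef
  have hmp : MeasurePreserving (fun t : UnitAddTorus (Fin n) => (measurableEquivPiIoc b t).1)
      volume (volume.restrict (unitBox n)) :=
    (measurePreserving_subtype_coe (measurableSet_unitBox n)).comp (measurePreserving_equivPiIoc b)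
  have hQ : MemLp Q 2 volume := hq.comp_measurePreserving hmp
  have hQx : ∀ x ∈ unitBox n, Q (fun i => (x i : UnitAddCircle)) = q x := by
    intro x hx
    have : (fun i => (x i : UnitAddCircle)) = (measurableEquivPiIoc b).symm ⟨x, hx⟩ := rfl
    simp only [hQdef, this, MeasurableEquiv.apply_symm_apply]
  set f : Lp ℂ 2 (volume : Measure (UnitAddTorus (Fin n))) := hQ.toLp Q
  have hfQ : f =ᵐ[volume] Q := hQ.coeFn_toLp
  refine ⟨fun k => mFourierCoeff f k, (hasSum_sq_mFourierCoeff f).summable, ?_, ?_⟩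
  · simp only [mFourierCoeff, neg_zero, mFourier_zero, ContinuousMap.one_apply, one_smul]
    rw [integral_congr_ae hfQ, integral_preimage Q b]
    exact setIntegral_congr_fun (measurableSet_unitBox n) hQx
  · have h1 := (Lp.tendsto_Lp_iff_tendsto_eLpNorm' _ f).1 (hasSum_mFourier_series_L2 f)
    have h2 := (ENNReal.continuous_pow 2).continuousAt.tendsto.comp h1
    simp only [Function.comp_def, ne_eq, OfNat.ofNat_ne_zero, not_false_eq_true, zero_pow] at h2
    refine h2.congr fun S => ?_
    have h3 : ∑ k ∈ S, mFourierCoeff f k • mFourierLp 2 k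
        = ContinuousMap.toLp (E := ℂ) 2 volume ℂ (∑ k ∈ S, mFourierCoeff f k • mFourier k) := by
      simp [map_sum]
    have h4 : ⇑(∑ k ∈ S, mFourierCoeff f k • mFourierLp 2 k : Lp ℂ 2 volume) - ⇑f
        =ᵐ[volume] fun t => ∑ k ∈ S, mFourierCoeff f k * mFourier k t - Q t := by
      rw [h3]
      filter_upwards [ContinuousMap.coeFn_toLp (p := 2) (𝕜 := ℂ) volume
        (∑ k ∈ S, mFourierCoeff f k • mFourier k), hfQ] with t h5 h6
      rw [Pi.sub_apply, h5, h6]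
      simp
    rw [eLpNorm_congr_ae h4, eLpNorm_two_sq, lintegral_preimage _ b]
    refine setLIntegral_congr_fun (measurableSet_unitBox n) fun x hx => ?_
    simp only [hQx x hx, mFourier_coe]

end Torus

/-! ### The reflection in several variables -/

/-- The cube `(0, 1/2)ⁿ`. -/
def halfCube (n : ℕ) : Set (Fin n → ℝ) := Set.univ.pi fun _ => Set.Ioo (0 : ℝ) (1 / 2)

theorem isOpen_halfCube (n : ℕ) : IsOpen (halfCube n) :=
  isOpen_set_pi Set.finite_univ fun _ _ => isOpen_Ioo

theorem measurableSet_halfCube (n : ℕ) : MeasurableSet (halfCube n) :=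
  (isOpen_halfCube n).measurableSet

theorem restrict_halfCube (n : ℕ) :
    volume.restrict (halfCube n) = Measure.pi fun _ : Fin n => halfMeasure := by
  rw [halfCube, volume_pi, Measure.restrict_pi_pi]
  simp [halfMeasure, restrict_Ioo_eq_restrict_Ioc]

theorem refl_mem_unitBox {n : ℕ} (α : Fin n → Fin 4) {x : Fin n → ℝ} (hx : x ∈ halfCube n) :
    (fun i => refl (α i) (x i)) ∈ unitBox n := fun i => by
  have := refl_mem (a := α i) (hx i trivial)
  norm_num at this ⊢
  exact this

theorem refl_notMem_halfCube {n : ℕ} {α : Fin n → Fin 4} (hα : α ≠ 0) {x : Fin n → ℝ}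
    (hx : x ∈ halfCube n) : (fun i => refl (α i) (x i)) ∉ halfCube n := by
  obtain ⟨i, hi⟩ := Function.ne_iff.1 hα
  intro h
  have h1 := (h i trivial).1
  have h2 := refl_neg hi (hx i trivial)
  exact lt_asymm h1 h2

theorem continuous_pi_refl {n : ℕ} (α : Fin n → Fin 4) :
    Continuous fun (x : Fin n → ℝ) i => refl (α i) (x i) := by fun_prop

/-- The map is diagonal plus a translation, so it scales Lebesgue measure by the inverse Jacobian.
Its image only fills part of the box, whence an inequality. -/
theorem map_refl_le {n : ℕ} (α : Fin n → Fin 4) :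
    Measure.map (fun (x : Fin n → ℝ) i => refl (α i) (x i)) (volume.restrict (halfCube n))
      ≤ ENNReal.ofReal |∏ i, slope (α i)|⁻¹ • volume.restrict (unitBox n) := by
  set D : Fin n → ℝ := fun i => slope (α i)
  set T : (Fin n → ℝ) → (Fin n → ℝ) := fun x i => refl (α i) (x i) with hT
  have hdet : (Matrix.diagonal D).det = ∏ i, slope (α i) := Matrix.det_diagonal
  have hne : ∏ i, slope (α i) ≠ 0 := Finset.prod_ne_zero_iff.2 fun i _ => slope_ne_zero _
  have hTc : Continuous T := continuous_pi_refl α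
  have hmap : Measure.map T volume = ENNReal.ofReal |∏ i, slope (α i)|⁻¹ • volume := by
    have h1 := Real.smul_map_diagonal_volume_pi (D := D) (by rwa [hdet])
    rw [hdet] at h1
    have hTD : T = (fun y => y + fun i => shift (α i)) ∘ Matrix.toLin' (Matrix.diagonal D) := by
      funext x i
      simp [hT, refl, D, Matrix.mulVec_diagonal]
    have hm1 : Measurable (Matrix.toLin' (Matrix.diagonal D)) :=
      (LinearMap.continuous_on_pi _).measurable
    rw [hTD, ← Measure.map_map (measurable_add_const _) hm1]
    have h2 : Measure.map (Matrix.toLin' (Matrix.diagonal D)) volume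
        = ENNReal.ofReal |∏ i, slope (α i)|⁻¹ • (volume : Measure (Fin n → ℝ)) := by
      conv_rhs => rw [← h1]
      rw [smul_smul, ← ENNReal.ofReal_mul (by positivity),
        inv_mul_cancel₀ (abs_ne_zero.2 hne), ENNReal.ofReal_one, one_smul]
    rw [h2, Measure.map_smul, map_add_right_eq_self]
  rw [← Measure.restrict_smul, ← hmap, Measure.restrict_map hTc.measurable (measurableSet_unitBox n)]
  exact Measure.map_mono (Measure.restrict_mono_set _ fun x hx => refl_mem_unitBox α hx)
    hTc.measurable

theorem aemeasurable_comp_refl {n : ℕ} (α : Fin n → Fin 4) {h : (Fin n → ℝ) → ℝ≥0∞}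
    (hh : AEMeasurable h (volume.restrict (unitBox n))) :
    AEMeasurable (fun x : Fin n → ℝ => h (fun i => refl (α i) (x i)))
      (volume.restrict (halfCube n)) :=
  ((hh.smul_measure _).mono_measure (map_refl_le α)).comp_measurable
    (continuous_pi_refl α).measurable

theorem lintegral_comp_refl_le {n : ℕ} (α : Fin n → Fin 4) {h : (Fin n → ℝ) → ℝ≥0∞}
    (hh : AEMeasurable h (volume.restrict (unitBox n))) :
    ∫⁻ x in halfCube n, h (fun i => refl (α i) (x i))
      ≤ ENNReal.ofReal |∏ i, slope (α i)|⁻¹ * ∫⁻ x in unitBox n, h x := by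
  calc ∫⁻ x in halfCube n, h (fun i => refl (α i) (x i))
      = ∫⁻ y, h y ∂(Measure.map (fun (x : Fin n → ℝ) i => refl (α i) (x i))
          (volume.restrict (halfCube n))) := by
        rw [lintegral_map' _ (continuous_pi_refl α).measurable.aemeasurable]
        exact (hh.smul_measure _).mono_measure (map_refl_le α)
    _ ≤ ∫⁻ y, h y ∂(ENNReal.ofReal |∏ i, slope (α i)|⁻¹ • volume.restrict (unitBox n)) :=
        lintegral_mono' (map_refl_le α) le_rfl
    _ = _ := by rw [lintegral_smul_measure, smul_eq_mul]

theorem prod_reflExpo {n : ℕ} (k : Fin n → ℤ) (x : Fin n → ℝ) :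
    ∏ i, reflExpo (k i) (x i) = ∑ α : Fin n → Fin 4,
      ((∏ i, weight (α i) (x i) : ℝ) : ℂ) * ∏ i, expo (k i) (refl (α i) (x i)) := by
  simp only [reflExpo, Finset.prod_univ_sum, Fintype.piFinset_univ, Finset.prod_mul_distrib]
  push_cast
  rfl

theorem abs_weight_le {a : Fin 4} {x : ℝ} (hx : x ∈ Set.Ioo (0 : ℝ) (1 / 2)) :
    |weight a x| ≤ 3 := by
  obtain ⟨h1, h2⟩ := hx
  rw [abs_le]
  fin_cases a
  · norm_num [weight]
  all_goals
    simp only [weight]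
    simp
    constructor <;> nlinarith

/-- Every mean zero function on the cube is a series of products of reflected exponentials, with
square summable coefficients and without constant term. -/
theorem exists_reflExpo_series (n : ℕ) {q : (Fin n → ℝ) → ℂ}
    (hq : MemLp q 2 (volume.restrict (halfCube n))) (hq0 : ∫ x in halfCube n, q x = 0) :
    ∃ c : (Fin n → ℤ) → ℂ, Summable (fun k => ‖c k‖ ^ 2) ∧ c 0 = 0 ∧
      Tendsto (fun S : Finset (Fin n → ℤ) =>
        ∫⁻ x in halfCube n, ‖∑ k ∈ S, c k * ∏ i, reflExpo (k i) (x i) - q x‖ₑ ^ 2)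
        atTop (𝓝 0) := by
  have hsub : halfCube n ⊆ unitBox n := fun x hx i => by
    have := hx i trivial
    constructor <;> [linarith [this.1]; linarith [this.2]]
  -- Extension by zero keeps the mean, and reflecting q' gives back q on the cube: for α ≠ 0 some
  -- coordinate becomes negative, where q' is zero.
  set q' := (halfCube n).indicator q with hq'
  have hm := measurableSet_halfCube n
  have hmem : MemLp q' 2 (volume.restrict (unitBox n)) := by
    rw [hq', memLp_indicator_iff_restrict hm, Measure.restrict_restrict hm,
      Set.inter_eq_left.2 hsub]
    exact hq
  obtain ⟨c, hc, hc0, hlim⟩ := exists_fourier_series n hmem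
  refine ⟨c, hc, ?_, ?_⟩
  · rw [hc0, hq', setIntegral_indicator hm, Set.inter_eq_right.2 hsub, hq0]
  set u : Finset (Fin n → ℤ) → (Fin n → ℝ) → ℂ :=
    fun S x => ∑ k ∈ S, c k * ∏ i, expo (k i) (x i) - q' x with hu
  have hpt : ∀ S, ∀ x ∈ halfCube n, ∑ k ∈ S, c k * ∏ i, reflExpo (k i) (x i) - q x
      = ∑ α : Fin n → Fin 4, ((∏ i, weight (α i) (x i) : ℝ) : ℂ)
        * u S (fun i => refl (α i) (x i)) := by
    intro S x hx
    have h0 : ∑ α : Fin n → Fin 4, ((∏ i, weight (α i) (x i) : ℝ) : ℂ)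
        * q' (fun i => refl (α i) (x i)) = q x := by
      rw [Finset.sum_eq_single (0 : Fin n → Fin 4)]
      · have : (fun i => refl ((0 : Fin n → Fin 4) i) (x i)) = x := by
          funext i; simp [refl, slope, shift]
        rw [this, hq', Set.indicator_of_mem hx]
        simp [weight]
      · intro α _ hα
        rw [hq', Set.indicator_of_notMem (refl_notMem_halfCube hα hx), mul_zero]
      · simp
    simp only [hu, mul_sub, Finset.sum_sub_distrib, h0, Finset.mul_sum]
    rw [Finset.sum_comm]
    congr 1
    refine Finset.sum_congr rfl fun k _ => ?_
    rw [prod_reflExpo, Finset.mul_sum]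
    exact Finset.sum_congr rfl fun α _ => by ring
  -- The cardinality comes from Cauchy–Schwarz over α, the power of 3 from `abs_weight_le`, the last
  -- factor from the Jacobian of the reflection.
  set K : ℝ≥0∞ := (Fintype.card (Fin n → Fin 4) : ℝ≥0∞) * ∑ α : Fin n → Fin 4,
    (ENNReal.ofReal (3 ^ n) ^ 2 * ENNReal.ofReal |∏ i, slope (α i)|⁻¹) with hK
  have hKtop : K ≠ ⊤ := by
    refine ENNReal.mul_ne_top (by simp) (ENNReal.sum_ne_top.2 fun α _ => ?_)
    exact ENNReal.mul_ne_top (by simp) (by simp)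
  have hmeas : ∀ S, AEMeasurable (fun x => ‖u S x‖ₑ ^ 2) (volume.restrict (unitBox n)) := by
    intro S
    have : Continuous fun x : Fin n → ℝ => ∑ k ∈ S, c k * ∏ i, expo (k i) (x i) := by fun_prop
    exact ((this.aestronglyMeasurable.sub hmem.aestronglyMeasurable).enorm).pow_const 2
  have hbd : ∀ S, ∫⁻ x in halfCube n, ‖∑ k ∈ S, c k * ∏ i, reflExpo (k i) (x i) - q x‖ₑ ^ 2
      ≤ K * ∫⁻ x in unitBox n, ‖u S x‖ₑ ^ 2 := by
    intro S
    have h1 : ∀ x ∈ halfCube n, ‖∑ k ∈ S, c k * ∏ i, reflExpo (k i) (x i) - q x‖ₑ ^ 2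
        ≤ (Fintype.card (Fin n → Fin 4) : ℝ≥0∞) * ∑ α : Fin n → Fin 4,
          (ENNReal.ofReal (3 ^ n) ^ 2 * ‖u S (fun i => refl (α i) (x i))‖ₑ ^ 2) := by
      intro x hx
      rw [hpt S x hx]
      refine (enorm_sum_sq_le _ _).trans ?_
      rw [Finset.card_univ]
      gcongr with α _
      rw [enorm_mul, mul_pow]
      gcongr
      rw [← ofReal_norm, Complex.norm_real, Real.norm_eq_abs, Finset.abs_prod]
      refine ENNReal.ofReal_le_ofReal ((Finset.prod_le_prod (fun _ _ => abs_nonneg _)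
        fun i _ => abs_weight_le (hx i trivial)).trans ?_)
      simp
    have hqmp : ∀ α : Fin n → Fin 4, AEMeasurable
        (fun x : Fin n → ℝ => ENNReal.ofReal (3 ^ n) ^ 2 * ‖u S (fun i => refl (α i) (x i))‖ₑ ^ 2)
        (volume.restrict (halfCube n)) :=
      fun α => (aemeasurable_comp_refl α (hmeas S)).const_mul _
    calc _ ≤ ∫⁻ x in halfCube n, (Fintype.card (Fin n → Fin 4) : ℝ≥0∞) * ∑ α : Fin n → Fin 4,
          (ENNReal.ofReal (3 ^ n) ^ 2 * ‖u S (fun i => refl (α i) (x i))‖ₑ ^ 2) :=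
          setLIntegral_mono' hm h1
      _ = (Fintype.card (Fin n → Fin 4) : ℝ≥0∞) * ∑ α : Fin n → Fin 4,
          (ENNReal.ofReal (3 ^ n) ^ 2 *
            ∫⁻ x in halfCube n, ‖u S (fun i => refl (α i) (x i))‖ₑ ^ 2) := by
          rw [lintegral_const_mul' _ _ (by simp), lintegral_finsetSum' _ fun α _ => hqmp α]
          simp only [lintegral_const_mul' _ _ (show ENNReal.ofReal (3 ^ n) ^ 2 ≠ ⊤ by simp)]
      _ ≤ _ := by
          rw [hK, mul_assoc, Finset.sum_mul]
          refine mul_le_mul_right (Finset.sum_le_sum fun α _ => ?_) _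
          rw [mul_assoc]
          exact mul_le_mul_right (lintegral_comp_refl_le α (hmeas S)) _
  refine tendsto_of_tendsto_of_tendsto_of_le_of_le tendsto_const_nhds ?_ (fun S => zero_le) hbd
  simpa using ENNReal.Tendsto.const_mul hlim (Or.inr hKtop)

end StokesTCoercivity
end

noncomputable section

namespace StokesTCoercivity

open scoped ENNReal NNReal ContDiff Topology
open Filter

/-! ### Cutoff functions -/

/-- A smooth function which is `1` on `[2/N, 1/2 - 2/N]` and vanishes outside
`[1/N, 1/2 - 1/N]`. -/
def cutoff (N t : ℝ) : ℝ :=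
  Real.smoothTransition (N * t - 1) * Real.smoothTransition (N * (1 / 2 - t) - 1)

@[fun_prop]
theorem contDiff_cutoff (N : ℝ) : ContDiff ℝ ∞ (cutoff N) := by
  unfold cutoff
  exact (Real.smoothTransition.contDiff.comp (by fun_prop)).mul
    (Real.smoothTransition.contDiff.comp (by fun_prop))

theorem abs_cutoff_le (N t : ℝ) : |cutoff N t| ≤ 1 := by
  rw [cutoff, abs_mul, abs_of_nonneg (Real.smoothTransition.nonneg _),
    abs_of_nonneg (Real.smoothTransition.nonneg _)]
  exact mul_le_one₀ (Real.smoothTransition.le_one _) (Real.smoothTransition.nonneg _)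
    (Real.smoothTransition.le_one _)

theorem cutoff_eq_one {N t : ℝ} (h1 : 2 ≤ N * t) (h2 : 2 ≤ N * (1 / 2 - t)) : cutoff N t = 1 := by
  rw [cutoff, Real.smoothTransition.one_of_one_le (by linarith),
    Real.smoothTransition.one_of_one_le (by linarith), one_mul]

theorem mem_Icc_of_cutoff_ne_zero {N t : ℝ} (hN : 0 < N) (h : cutoff N t ≠ 0) :
    t ∈ Set.Icc (1 / N) (1 / 2 - 1 / N) := by
  rw [cutoff, mul_ne_zero_iff] at h
  have h1 : 0 < N * t - 1 := by
    by_contra! h'; exact h.1 (Real.smoothTransition.zero_of_nonpos h')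
  have h2 : 0 < N * (1 / 2 - t) - 1 := by
    by_contra! h'; exact h.2 (Real.smoothTransition.zero_of_nonpos h')
  have h3 : 1 / N < t := by rw [div_lt_iff₀ hN]; linarith
  have h4 : 1 / N < 1 / 2 - t := by rw [div_lt_iff₀ hN]; linarith
  exact ⟨h3.le, by linarith⟩

theorem deriv_smoothTransition_eq_zero {t : ℝ} (ht : t < 0 ∨ 1 < t) :
    deriv Real.smoothTransition t = 0 := by
  rcases ht with ht | ht
  · have : Real.smoothTransition =ᶠ[𝓝 t] fun _ => 0 := by
      filter_upwards [Iio_mem_nhds ht] with s hs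
      exact Real.smoothTransition.zero_of_nonpos (le_of_lt hs)
    rw [this.deriv_eq, deriv_const]
  · have : Real.smoothTransition =ᶠ[𝓝 t] fun _ => 1 := by
      filter_upwards [Ioi_mem_nhds ht] with s hs
      exact Real.smoothTransition.one_of_one_le (le_of_lt hs)
    rw [this.deriv_eq, deriv_const]

theorem exists_bound_deriv_smoothTransition :
    ∃ C : ℝ, 0 ≤ C ∧ ∀ t, |deriv Real.smoothTransition t| ≤ C := by
  have hc : Continuous (deriv Real.smoothTransition) :=
    (Real.smoothTransition.contDiff (n := 1)).continuous_deriv le_rfl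
  obtain ⟨C, hC⟩ := isCompact_Icc.exists_bound_of_continuousOn
    (hc.continuousOn (s := Set.Icc (0 : ℝ) 1))
  refine ⟨max C 0, le_max_right _ _, fun t => ?_⟩
  by_cases ht : t ∈ Set.Icc (0 : ℝ) 1
  · exact (hC t ht).trans (le_max_left _ _)
  · rw [deriv_smoothTransition_eq_zero, abs_zero]
    · exact le_max_right _ _
    · by_contra! h; exact ht h

/-- The derivative is of size N but lives within 2/N of the two ends, so multiplication by the
distance s to the ends removes N. Each of the two factors of the cutoff contributes 2C. -/
theorem exists_bound_deriv_cutoff :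
    ∃ C : ℝ, 0 ≤ C ∧ ∀ N, 0 ≤ N → ∀ t s, 0 ≤ s → s ≤ t → s ≤ 1 / 2 - t →
      |deriv (cutoff N) t| * s ≤ C := by
  obtain ⟨C, hC0, hC⟩ := exists_bound_deriv_smoothTransition
  refine ⟨4 * C, by positivity, fun N hN t s hs h1 h2 => ?_⟩
  have hd : ∀ x, HasDerivAt Real.smoothTransition (deriv Real.smoothTransition x) x := fun x =>
    ((Real.smoothTransition.contDiff (n := 1)).differentiable (by simp) x).hasDerivAt
  have hd1 : HasDerivAt (fun t => N * t - 1) N t := by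
    simpa using ((hasDerivAt_id t).const_mul N).sub_const 1
  have hd2 : HasDerivAt (fun t : ℝ => N * (1 / 2 - t) - 1) (-N) t := by
    exact ((((hasDerivAt_id t).const_sub (1 / 2)).const_mul N).sub_const 1).congr_deriv (by ring)
  have h := ((hd _).comp t hd1).mul ((hd _).comp t hd2)
  have key : ∀ r, s ≤ r → |deriv Real.smoothTransition (N * r - 1)| * N * s ≤ 2 * C := by
    intro r hr
    by_cases hNr : N * r ≤ 2
    · have : N * s ≤ 2 := (mul_le_mul_of_nonneg_left hr hN).trans hNr
      nlinarith [hC (N * r - 1), abs_nonneg (deriv Real.smoothTransition (N * r - 1)),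
        mul_nonneg hN hs]
    · rw [deriv_smoothTransition_eq_zero (Or.inr (by linarith))]
      simp; positivity
  have e : deriv (cutoff N) t = _ := h.deriv
  rw [e]
  have b1 := Real.smoothTransition.nonneg (N * t - 1)
  have b2 := Real.smoothTransition.le_one (N * t - 1)
  have b3 := Real.smoothTransition.nonneg (N * (1 / 2 - t) - 1)
  have b4 := Real.smoothTransition.le_one (N * (1 / 2 - t) - 1)
  simp only [Function.comp]
  set a := deriv Real.smoothTransition (N * t - 1)
  set a' := deriv Real.smoothTransition (N * (1 / 2 - t) - 1)
  have k1 := key t h1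
  have k2 := key (1 / 2 - t) h2
  have t1 : |a * N * Real.smoothTransition (N * (1 / 2 - t) - 1)| ≤ |a| * N := by
    rw [abs_mul, abs_mul, abs_of_nonneg hN, abs_of_nonneg b3]
    exact mul_le_of_le_one_right (by positivity) b4
  have t2 : |Real.smoothTransition (N * t - 1) * (a' * -N)| ≤ |a'| * N := by
    rw [abs_mul, abs_mul, abs_neg, abs_of_nonneg hN, abs_of_nonneg b1]
    exact mul_le_of_le_one_left (by positivity) b2
  calc _ ≤ (|a| * N + |a'| * N) * s := by
        gcongr
        exact (abs_add_le _ _).trans (add_le_add t1 t2)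
    _ ≤ 4 * C := by linarith

/-! ### Functions on the cube which vanish on its boundary -/

/-- `F` vanishes on the boundary of the cube `(0, 1/2)ⁿ`. -/
def VanishesOnFaces {n : ℕ} (F : (Fin n → ℝ) → ℝ) : Prop :=
  ∀ y, (∃ i, y i = 0 ∨ y i = 1 / 2) → F y = 0

/-- The product cutoff on the cube. -/
def cubeCutoff {n : ℕ} (N : ℝ) (y : Fin n → ℝ) : ℝ := ∏ i, cutoff N (y i)

@[fun_prop]
theorem contDiff_cubeCutoff {n : ℕ} (N : ℝ) : ContDiff ℝ ∞ (cubeCutoff (n := n) N) := by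
  unfold cubeCutoff
  exact contDiff_prod fun i _ => (contDiff_cutoff N).comp (contDiff_apply ℝ ℝ i)

theorem abs_cubeCutoff_le {n : ℕ} (N : ℝ) (y : Fin n → ℝ) : |cubeCutoff N y| ≤ 1 := by
  rw [cubeCutoff, Finset.abs_prod]
  exact Finset.prod_le_one (fun _ _ => abs_nonneg _) fun i _ => abs_cutoff_le _ _

/-- The closed cube on which the cutoff may be nonzero. -/
def innerCube (n : ℕ) (N : ℝ) : Set (Fin n → ℝ) :=
  Set.univ.pi fun _ => Set.Icc (1 / N) (1 / 2 - 1 / N)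

theorem isCompact_innerCube (n : ℕ) (N : ℝ) : IsCompact (innerCube n N) :=
  isCompact_univ_pi fun _ => isCompact_Icc

theorem innerCube_subset {n : ℕ} {N : ℝ} (hN : 0 < N) : innerCube n N ⊆ halfCube n :=
  fun y hy i hi => by
    have h1 : 0 < 1 / N := by positivity
    exact ⟨h1.trans_le (hy i hi).1, (hy i hi).2.trans_lt (by linarith)⟩

theorem support_cubeCutoff {n : ℕ} {N : ℝ} (hN : 0 < N) {y : Fin n → ℝ}
    (hy : cubeCutoff N y ≠ 0) : y ∈ innerCube n N := fun i _ =>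
  mem_Icc_of_cutoff_ne_zero hN (Finset.prod_ne_zero_iff.1 hy i (Finset.mem_univ i))

theorem cubeCutoff_eventually_eq_one {n : ℕ} {y : Fin n → ℝ} (hy : y ∈ halfCube n) :
    ∀ᶠ N : ℕ in atTop, ∀ᶠ z in 𝓝 y, cubeCutoff (N : ℝ) z = 1 := by
  have h : ∀ i, ∀ᶠ N : ℕ in atTop, ∀ᶠ z in 𝓝 y, cutoff (N : ℝ) (z i) = 1 := by
    intro i
    obtain ⟨h1, h2⟩ := hy i trivial
    have t1 : Tendsto (fun N : ℕ => (N : ℝ) * y i) atTop atTop :=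
      tendsto_natCast_atTop_atTop.atTop_mul_const h1
    have t2 : Tendsto (fun N : ℕ => (N : ℝ) * (1 / 2 - y i)) atTop atTop :=
      tendsto_natCast_atTop_atTop.atTop_mul_const (by linarith)
    filter_upwards [t1.eventually_gt_atTop 2, t2.eventually_gt_atTop 2] with N hN1 hN2
    have c1 : Continuous fun z : Fin n → ℝ => (N : ℝ) * z i := by fun_prop
    have c2 : Continuous fun z : Fin n → ℝ => (N : ℝ) * (1 / 2 - z i) := by fun_prop
    filter_upwards [c1.continuousAt.eventually (lt_mem_nhds hN1),
      c2.continuousAt.eventually (lt_mem_nhds hN2)] with z hz1 hz2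
    exact cutoff_eq_one hz1.le hz2.le
  filter_upwards [eventually_all.2 h] with N hN
  filter_upwards [eventually_all.2 hN] with z hz
  simp [cubeCutoff, hz]

/-- Since F is zero on the faces, it is at most a multiple of the distance to each face, and this
absorbs the blow-up of the derivative of the cutoff. The bound is uniform in N, as dominated
convergence requires. -/
theorem exists_bound_cutoff_mul {n : ℕ} {F : (Fin n → ℝ) → ℝ} (hF : ContDiff ℝ ∞ F)
    (h0 : VanishesOnFaces F) :
    ∃ C : ℝ, 0 ≤ C ∧ ∀ N : ℝ, 0 ≤ N → ∀ y ∈ halfCube n,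
      |F y * cubeCutoff N y| ≤ C ∧ ‖fderiv ℝ (fun y => F y * cubeCutoff N y) y‖ ≤ C := by
  set K : Set (Fin n → ℝ) := Set.univ.pi fun _ => Set.Icc (0 : ℝ) (1 / 2)
  have hK : IsCompact K := isCompact_univ_pi fun _ => isCompact_Icc
  have hKc : Convex ℝ K := convex_pi fun _ _ => convex_Icc _ _
  have hsub : halfCube n ⊆ K := Set.pi_mono fun _ _ => Set.Ioo_subset_Icc_self
  obtain ⟨M₀, hM₀⟩ := hK.exists_bound_of_continuousOn hF.continuous.continuousOn
  obtain ⟨M₁, hM₁⟩ := hK.exists_bound_of_continuousOn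
    (hF.continuous_fderiv (by simp)).continuousOn
  obtain ⟨C, hC0, hC⟩ := exists_bound_deriv_cutoff
  set M := max (max M₀ M₁) 0
  have hM : 0 ≤ M := le_max_right _ _
  have hb0 : ∀ y ∈ K, |F y| ≤ M := fun y hy =>
    (hM₀ y hy).trans ((le_max_left _ _).trans (le_max_left _ _))
  have hb1 : ∀ y ∈ K, ‖fderiv ℝ F y‖ ≤ M := fun y hy =>
    (hM₁ y hy).trans ((le_max_right _ _).trans (le_max_left _ _))
  -- Mean value inequality between y and its projection onto a face.
  have hdist : ∀ y ∈ K, ∀ i, ∀ a, (a = 0 ∨ a = 1 / 2) → |F y| ≤ M * |y i - a| := by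
    intro y hy i a ha
    have hz : Function.update y i a ∈ K := by
      intro j _
      by_cases hj : j = i
      · subst hj
        rw [Function.update_self]
        rcases ha with rfl | rfl <;> constructor <;> norm_num
      · rw [Function.update_of_ne hj]; exact hy j trivial
    have h1 := hKc.norm_image_sub_le_of_norm_fderiv_le (f := F) (C := M)
      (fun z _ => (hF.differentiable (by simp)) z) hb1 hz hy
    rw [h0 (Function.update y i a) ⟨i, by rwa [Function.update_self]⟩, sub_zero] at h1
    refine h1.trans (mul_le_mul_of_nonneg_left ?_ hM)
    refine (pi_norm_le_iff_of_nonneg (abs_nonneg _)).2 fun j => ?_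
    by_cases hj : j = i
    · subst hj; simp
    · simp [Function.update_of_ne hj]
  refine ⟨M + n * (M * C), by positivity, fun N hN y hy => ⟨?_, ?_⟩⟩
  · rw [abs_mul]
    refine (mul_le_of_le_one_right (abs_nonneg _) (abs_cubeCutoff_le _ _)).trans ?_
    exact (hb0 y (hsub hy)).trans (by linarith [show 0 ≤ n * (M * C) by positivity])
  · have hX : HasFDerivAt (cubeCutoff N) (∑ i, (∏ j ∈ Finset.univ.erase i, cutoff N (y j)) •
        (deriv (cutoff N) (y i) • ContinuousLinearMap.proj (R := ℝ) (φ := fun _ : Fin n => ℝ) i))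
        y := by
      refine HasFDerivAt.finsetProd fun i _ => ?_
      exact (((contDiff_cutoff N).differentiable (by simp)).differentiableAt.hasDerivAt).comp_hasFDerivAt
        y (hasFDerivAt_apply i y)
    have hFy : HasFDerivAt F (fderiv ℝ F y) y := (hF.differentiable (by simp) y).hasFDerivAt
    rw [(hFy.fun_mul hX).fderiv]
    refine (norm_add_le _ _).trans ?_
    rw [add_comm]
    refine add_le_add ?_ ?_
    · rw [norm_smul, Real.norm_eq_abs]
      exact (mul_le_of_le_one_left (norm_nonneg _) (abs_cubeCutoff_le _ _)).trans (hb1 y (hsub hy))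
    · rw [Finset.smul_sum]
      refine (norm_sum_le _ _).trans ?_
      have : ∀ i ∈ (Finset.univ : Finset (Fin n)),
          ‖F y • (∏ j ∈ Finset.univ.erase i, cutoff N (y j)) • (deriv (cutoff N) (y i) •
            ContinuousLinearMap.proj (R := ℝ) (φ := fun _ : Fin n => ℝ) i)‖ ≤ M * C := by
        intro i _
        have hp : ‖(ContinuousLinearMap.proj i : (Fin n → ℝ) →L[ℝ] ℝ)‖ ≤ 1 :=
          ContinuousLinearMap.opNorm_le_bound _ zero_le_one fun z => by
            simpa using norm_le_pi_norm z i
        have hpr : |∏ j ∈ Finset.univ.erase i, cutoff N (y j)| ≤ 1 := by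
          rw [Finset.abs_prod]
          exact Finset.prod_le_one (fun _ _ => abs_nonneg _) fun i _ => abs_cutoff_le _ _
        have hyi := hy i trivial
        have hs : |F y| ≤ M * min (y i) (1 / 2 - y i) := by
          rw [mul_min_of_nonneg _ _ hM]
          refine le_min ?_ ?_
          · have := hdist y (hsub hy) i 0 (Or.inl rfl)
            rwa [sub_zero, abs_of_pos hyi.1] at this
          · have := hdist y (hsub hy) i (1 / 2) (Or.inr rfl)
            rwa [abs_sub_comm, abs_of_pos (sub_pos.2 hyi.2)] at this
        have hCi := hC N hN (y i) (min (y i) (1 / 2 - y i))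
          (le_min hyi.1.le (by linarith [hyi.2])) (min_le_left _ _) (min_le_right _ _)
        rw [norm_smul, norm_smul, norm_smul]
        simp only [Real.norm_eq_abs]
        calc |F y| * (|∏ j ∈ Finset.univ.erase i, cutoff N (y j)| * (|deriv (cutoff N) (y i)| * _))
            ≤ (M * min (y i) (1 / 2 - y i)) * (1 * (|deriv (cutoff N) (y i)| * 1)) := by
              have : 0 ≤ M * min (y i) (1 / 2 - y i) := (abs_nonneg _).trans hs
              gcongr
          _ = M * (|deriv (cutoff N) (y i)| * min (y i) (1 / 2 - y i)) := by ring
          _ ≤ M * C := by gcongr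
      refine (Finset.sum_le_card_nsmul _ _ _ this).trans ?_
      simp

/-! ### Parallelepipeds -/

variable {d : ℕ}

/-- The affine map `y ↦ b + A y`. -/
def parMap (A : (Fin d → ℝ) ≃L[ℝ] Space d) (b : Space d) : (Fin d → ℝ) ≃ₜ Space d :=
  A.toHomeomorph.trans (Homeomorph.addLeft b)

/-- The open parallelepiped `b + A (0, 1/2)ᵈ`. -/
def par (A : (Fin d → ℝ) ≃L[ℝ] Space d) (b : Space d) : Set (Space d) :=
  parMap A b '' halfCube d

theorem parMap_apply (A : (Fin d → ℝ) ≃L[ℝ] Space d) (b : Space d) (y : Fin d → ℝ) :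
    parMap A b y = b + A y := rfl

theorem parMap_symm_apply (A : (Fin d → ℝ) ≃L[ℝ] Space d) (b x : Space d) :
    (parMap A b).symm x = A.symm (-b + x) := rfl

theorem isOpen_par (A : (Fin d → ℝ) ≃L[ℝ] Space d) (b : Space d) : IsOpen (par A b) :=
  (parMap A b).isOpenMap _ (isOpen_halfCube d)

theorem mem_par_iff {A : (Fin d → ℝ) ≃L[ℝ] Space d} {b x : Space d} :
    x ∈ par A b ↔ (parMap A b).symm x ∈ halfCube d := by
  rw [par, (parMap A b).image_eq_preimage_symm]; rfl

/-- Uniqueness of Haar measure supplies κ; only its being positive and finite matters. -/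
theorem exists_map_parMap (A : (Fin d → ℝ) ≃L[ℝ] Space d) (b : Space d) :
    ∃ κ : ℝ≥0∞, κ ≠ 0 ∧ κ ≠ ⊤ ∧ (volume.restrict (halfCube d)).map (parMap A b)
      = κ • volume.restrict (par A b) := by
  have hA : (Measure.map A (volume : Measure (Fin d → ℝ))).IsAddHaarMeasure :=
    A.isAddHaarMeasure_map volume
  set κ := (Measure.map A (volume : Measure (Fin d → ℝ))).addHaarScalarFactor
    (volume : Measure (Space d)) with hκ
  have h : Measure.map A (volume : Measure (Fin d → ℝ)) = κ • (volume : Measure (Space d)) :=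
    Measure.isAddLeftInvariant_eq_smul _ _
  have hpos : 0 < κ := Measure.addHaarScalarFactor_pos_of_isAddHaarMeasure _ _
  refine ⟨κ, by simpa using hpos.ne', by simp, ?_⟩
  have h1 : Measure.map (parMap A b) volume = (κ : ℝ≥0∞) • (volume : Measure (Space d)) := by
    have : (parMap A b : (Fin d → ℝ) → Space d) = (fun x => b + x) ∘ A := rfl
    rw [this, ← Measure.map_map (measurable_const_add b) A.continuous.measurable, h,
      Measure.map_smul, map_add_left_eq_self]
    rfl
  rw [← Measure.restrict_smul, ← h1, Measure.restrict_map (parMap A b).continuous.measurable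
    (isOpen_par A b).measurableSet, par, (parMap A b).preimage_image]

end StokesTCoercivity
end

noncomputable section

namespace StokesTCoercivity

open scoped ENNReal NNReal ContDiff Topology
open Filter

variable {d : ℕ}

/-! ### Elements of `H¹₀(Ω)` -/

theorem memLp_testFunction (Ω : Opens (Space d)) (φ : 𝓓(Ω, ℝ)) :
    MemLp (fun x => φ x) 2 (volume.restrict (Ω : Set (Space d))) :=
  (φ.continuous.memLp_of_hasCompactSupport φ.hasCompactSupport).restrict _

theorem continuous_fderiv_testFunction (Ω : Opens (Space d)) (φ : 𝓓(Ω, ℝ)) :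
    Continuous (fderiv ℝ φ) :=
  φ.contDiff.continuous_fderiv (by simp)

theorem memLp_fderiv_testFunction (Ω : Opens (Space d)) (φ : 𝓓(Ω, ℝ)) (v : Space d) :
    MemLp (fun x => fderiv ℝ φ x v) 2 (volume.restrict (Ω : Set (Space d))) :=
  (((continuous_fderiv_testFunction Ω φ).clm_apply continuous_const).memLp_of_hasCompactSupport
    (φ.hasCompactSupport.fderiv_apply (𝕜 := ℝ) v)).restrict _

/-- The pair of `v` and `G` as an element of `L²(Ω) × L²(Ω)^d`. -/
def mkPair (Ω : Opens (Space d)) {v : Space d → ℝ} {G : Fin d → Space d → ℝ}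
    (hv : MemLp v 2 (volume.restrict (Ω : Set (Space d))))
    (hG : ∀ j, MemLp (G j) 2 (volume.restrict (Ω : Set (Space d)))) : L2Pair Ω :=
  WithLp.toLp 2 (hv.toLp v, WithLp.toLp 2 fun j => (hG j).toLp (G j))

theorem exists_H10_of_tendsto (Ω : Opens (Space d)) {v : Space d → ℝ} {G : Fin d → Space d → ℝ}
    (φ : ℕ → 𝓓(Ω, ℝ)) (hv : MemLp v 2 (volume.restrict (Ω : Set (Space d))))
    (hG : ∀ j, MemLp (G j) 2 (volume.restrict (Ω : Set (Space d))))
    (h1 : Tendsto (fun n => ∫⁻ x in Ω, ‖φ n x - v x‖ₑ ^ 2) atTop (𝓝 0))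
    (h2 : ∀ j, Tendsto (fun n => ∫⁻ x in Ω,
      ‖fderiv ℝ (φ n) x (EuclideanSpace.single j 1) - G j x‖ₑ ^ 2) atTop (𝓝 0)) :
    ∃ p : H10 Ω, (p : L2Pair Ω).fst =ᵐ[volume.restrict (Ω : Set (Space d))] v ∧
      ∀ j, (p : L2Pair Ω).snd j =ᵐ[volume.restrict (Ω : Set (Space d))] G j := by
  have aux : ∀ {u : Space d → ℝ} {ψ : ℕ → Space d → ℝ}
      (hu : MemLp u 2 (volume.restrict (Ω : Set (Space d))))
      (hψ : ∀ n, MemLp (ψ n) 2 (volume.restrict (Ω : Set (Space d)))),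
      Tendsto (fun n => ∫⁻ x in Ω, ‖ψ n x - u x‖ₑ ^ 2) atTop (𝓝 0) →
      Tendsto (fun n => (hψ n).toLp (ψ n)) atTop (𝓝 (hu.toLp u)) := by
    intro u ψ hu hψ h
    rw [Lp.tendsto_Lp_iff_tendsto_eLpNorm'']
    have h3 := (ENNReal.continuous_rpow_const (y := (1 / 2 : ℝ))).continuousAt.tendsto.comp h
    simp only [Function.comp_def] at h3
    rw [ENNReal.zero_rpow_of_pos (by norm_num)] at h3
    refine h3.congr fun n => ?_
    have := eLpNorm_two_sq (volume.restrict (Ω : Set (Space d))) (ψ n - u)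
    simp only [Pi.sub_apply] at this
    rw [← this, ← ENNReal.rpow_natCast, ← ENNReal.rpow_mul]
    norm_num
  have hmem : ∀ n, mkPair Ω (memLp_testFunction Ω (φ n))
      (fun j => memLp_fderiv_testFunction Ω (φ n) (EuclideanSpace.single j 1)) ∈ H10 Ω := by
    intro n
    refine Submodule.le_topologicalClosure _ (Submodule.subset_span ⟨φ n, ?_, fun j => ?_⟩)
    · exact (memLp_testFunction Ω (φ n)).coeFn_toLp
    · exact (memLp_fderiv_testFunction Ω (φ n) (EuclideanSpace.single j 1)).coeFn_toLp
  have hlim : Tendsto (fun n => mkPair Ω (memLp_testFunction Ω (φ n))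
      (fun j => memLp_fderiv_testFunction Ω (φ n) (EuclideanSpace.single j 1)))
      atTop (𝓝 (mkPair Ω hv hG)) := by
    refine ((WithLp.prod_continuous_toLp 2 _ _).tendsto _).comp ?_
    refine (aux hv (fun n => memLp_testFunction Ω (φ n)) h1).prodMk_nhds ?_
    refine ((PiLp.continuous_toLp 2 _).tendsto _).comp ?_
    exact tendsto_pi_nhds.2 fun j => aux (hG j) _ (h2 j)
  have hcl : mkPair Ω hv hG ∈ H10 Ω :=
    (Submodule.isClosed_topologicalClosure _).mem_of_tendsto hlim (Eventually.of_forall hmem)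
  exact ⟨⟨_, hcl⟩, hv.coeFn_toLp, fun j => (hG j).coeFn_toLp⟩

theorem tendsto_of_bounded (Ω : Opens (Space d)) {P : Set (Space d)} (hP : MeasurableSet P)
    (hPΩ : P ⊆ Ω) (hPv : volume P ≠ ⊤) {ψ : ℕ → Space d → ℝ} {v : Space d → ℝ} {C : ℝ}
    (hψ : ∀ n, Continuous (ψ n)) (hψ0 : ∀ n, ∀ x ∉ P, ψ n x = 0) (hv0 : ∀ x ∉ P, v x = 0)
    (hC : ∀ n, ∀ x ∈ P, |ψ n x| ≤ C) (hlim : ∀ x ∈ P, Tendsto (fun n => ψ n x) atTop (𝓝 (v x))) :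
    MemLp v 2 (volume.restrict (Ω : Set (Space d))) ∧
      Tendsto (fun n => ∫⁻ x in Ω, ‖ψ n x - v x‖ₑ ^ 2) atTop (𝓝 0) := by
  have hlim' : ∀ x, Tendsto (fun n => ψ n x) atTop (𝓝 (v x)) := by
    intro x
    by_cases hx : x ∈ P
    · exact hlim x hx
    · simp [hψ0 _ x hx, hv0 x hx]
  have hmv : Measurable v := measurable_of_tendsto_metrizable (fun n => (hψ n).measurable)
    (tendsto_pi_nhds.2 hlim')
  have hvC : ∀ x ∈ P, |v x| ≤ C := fun x hx =>
    le_of_tendsto ((continuous_abs.tendsto _).comp (hlim x hx))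
      (Eventually.of_forall fun n => hC n x hx)
  have hvP : v = P.indicator v := by
    funext x
    by_cases hx : x ∈ P
    · rw [Set.indicator_of_mem hx]
    · rw [Set.indicator_of_notMem hx, hv0 x hx]
  refine ⟨?_, ?_⟩
  · rw [hvP, memLp_indicator_iff_restrict hP, Measure.restrict_restrict hP,
      Set.inter_eq_left.2 hPΩ]
    have : IsFiniteMeasure (volume.restrict P) := ⟨by simpa using hPv.lt_top⟩
    exact MemLp.of_bound hmv.aestronglyMeasurable C
      ((ae_restrict_iff' hP).2 (ae_of_all _ hvC))
  · have h := tendsto_lintegral_of_dominated_convergence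
      (μ := volume.restrict (Ω : Set (Space d)))
      (F := fun n x => ‖ψ n x - v x‖ₑ ^ 2) (f := fun _ => 0)
      (P.indicator fun _ => ENNReal.ofReal (2 * C) ^ 2)
      (fun n => ((hψ n).measurable.sub hmv).enorm.pow_const 2)
      (fun n => ae_of_all _ fun x => ?_) ?_ (ae_of_all _ fun x => ?_)
    · simpa using h
    · by_cases hx : x ∈ P
      · rw [Set.indicator_of_mem hx]
        refine pow_le_pow_left₀ zero_le ?_ 2
        rw [← ofReal_norm, Real.norm_eq_abs]
        refine ENNReal.ofReal_le_ofReal ((abs_sub _ _).trans ?_)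
        linarith [hC n x hx, hvC x hx]
      · simp [hψ0 n x hx, hv0 x hx]
    · rw [lintegral_indicator hP, Measure.restrict_restrict hP, Set.inter_eq_left.2 hPΩ,
        lintegral_const, Measure.restrict_apply_univ]
      exact ENNReal.mul_ne_top (ENNReal.pow_ne_top ENNReal.ofReal_ne_top) hPv
    · have h3 : Tendsto (fun n => ψ n x - v x) atTop (𝓝 0) := by
        simpa using (hlim' x).sub_const (v x)
      have h4 : Continuous fun t : ℝ => ‖t‖ₑ ^ 2 := by fun_prop
      simpa [Function.comp_def] using (h4.tendsto 0).comp h3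

theorem volume_par_ne_top (A : (Fin d → ℝ) ≃L[ℝ] Space d) (b : Space d) :
    volume (par A b) ≠ ⊤ := by
  have hK : IsCompact (parMap A b '' Set.univ.pi fun _ => Set.Icc (0 : ℝ) (1 / 2)) :=
    (isCompact_univ_pi fun _ => isCompact_Icc).image (parMap A b).continuous
  refine ((measure_mono ?_).trans_lt hK.measure_lt_top).ne
  exact Set.image_mono (Set.pi_mono fun _ _ => Set.Ioo_subset_Icc_self)

theorem hasFDerivAt_comp_parMap_symm (A : (Fin d → ℝ) ≃L[ℝ] Space d) (b : Space d)
    {F : (Fin d → ℝ) → ℝ} (hF : Differentiable ℝ F) (x : Space d) :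
    HasFDerivAt (fun x => F ((parMap A b).symm x))
      ((fderiv ℝ F ((parMap A b).symm x)).comp (A.symm : Space d →L[ℝ] Fin d → ℝ)) x := by
  have h1 : HasFDerivAt (fun x => (parMap A b).symm x)
      (A.symm : Space d →L[ℝ] Fin d → ℝ) x := by
    simp only [parMap_symm_apply]
    exact (A.symm : Space d →L[ℝ] Fin d → ℝ).hasFDerivAt.comp x ((hasFDerivAt_id x).const_add _)
  exact (hF _).hasFDerivAt.comp x h1

/-- A smooth function on the cube vanishing on its boundary, transported to a parallelepiped in
`Ω` and extended by zero, lies in `H¹₀(Ω)`. -/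
theorem exists_H10_of_contDiff (Ω : Opens (Space d)) {A : (Fin d → ℝ) ≃L[ℝ] Space d}
    {b : Space d} (hP : par A b ⊆ Ω) {F : (Fin d → ℝ) → ℝ} (hF : ContDiff ℝ ∞ F)
    (h0 : VanishesOnFaces F) :
    ∃ p : H10 Ω, (p : L2Pair Ω).fst =ᵐ[volume.restrict (Ω : Set (Space d))]
        (par A b).indicator (fun x => F ((parMap A b).symm x)) ∧
      ∀ j, (p : L2Pair Ω).snd j =ᵐ[volume.restrict (Ω : Set (Space d))]
        (par A b).indicator (fun x => fderiv ℝ F ((parMap A b).symm x)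
          (A.symm (EuclideanSpace.single j 1))) := by
  obtain ⟨C, hC0, hC⟩ := exists_bound_cutoff_mul hF h0
  set Ψ := (parMap A b).symm with hΨ
  have hpos : ∀ n : ℕ, (0 : ℝ) < ((n + 1 : ℕ) : ℝ) := fun n => by positivity
  -- The shift by one keeps the cutoff parameter positive, so that the support is a compact subset
  -- of the open cube.
  set Fn : ℕ → (Fin d → ℝ) → ℝ := fun n y => F y * cubeCutoff ((n + 1 : ℕ) : ℝ) y with hFn
  have hFnc : ∀ n, ContDiff ℝ ∞ (Fn n) := fun n => hF.mul (contDiff_cubeCutoff _)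
  have hΨc : ContDiff ℝ ∞ (fun x => Ψ x) := by
    simp only [hΨ, parMap_symm_apply]
    exact A.symm.contDiff.comp (contDiff_const.add contDiff_id)
  have hts : ∀ n, tsupport (fun x => Fn n (Ψ x)) ⊆ parMap A b '' innerCube d ((n + 1 : ℕ) : ℝ) := by
    intro n
    refine closure_minimal ?_ ((isCompact_innerCube d _).image (parMap A b).continuous).isClosed
    intro x hx
    refine ⟨Ψ x, support_cubeCutoff (hpos n) (right_ne_zero_of_mul hx), ?_⟩
    simp [hΨ]
  have htsP : ∀ n, tsupport (fun x => Fn n (Ψ x)) ⊆ par A b := fun n =>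
    (hts n).trans (Set.image_mono (innerCube_subset (hpos n)))
  let φ : ℕ → 𝓓(Ω, ℝ) := fun n =>
    ⟨fun x => Fn n (Ψ x), (hFnc n).comp hΨc,
      ((isCompact_innerCube d _).image (parMap A b).continuous).of_isClosed_subset
        (isClosed_tsupport _) (hts n), (htsP n).trans hP⟩
  have hφ : ∀ n x, φ n x = Fn n (Ψ x) := fun n x => rfl
  have hφ' : ∀ n, (φ n : Space d → ℝ) = fun x => Fn n (Ψ x) := fun n => rfl
  have hder : ∀ n x j, fderiv ℝ (φ n) x (EuclideanSpace.single j 1)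
      = fderiv ℝ (Fn n) (Ψ x) (A.symm (EuclideanSpace.single j 1)) := by
    intro n x j
    rw [hφ', (hasFDerivAt_comp_parMap_symm A b ((hFnc n).differentiable (by simp)) x).fderiv]
    rfl
  -- Near an interior point the cutoff is eventually one, so values and gradients are both
  -- eventually constant in n.
  have hev : ∀ y ∈ halfCube d, ∀ᶠ n in atTop, Fn n =ᶠ[𝓝 y] F := by
    intro y hy
    have := (tendsto_add_atTop_nat 1).eventually (cubeCutoff_eventually_eq_one hy)
    filter_upwards [this] with n hn
    filter_upwards [hn] with z hz
    rw [hFn]; simp only; rw [hz, mul_one]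
  have hPm := (isOpen_par A b).measurableSet
  have l1 := tendsto_of_bounded Ω hPm hP (volume_par_ne_top A b) (ψ := fun n x => φ n x)
    (v := (par A b).indicator fun x => F (Ψ x)) (C := C)
    (fun n => (φ n).continuous)
    (fun n x hx => image_eq_zero_of_notMem_tsupport fun h => hx (htsP n h))
    (fun x hx => Set.indicator_of_notMem hx _)
    (fun n x hx => (hC _ (hpos n).le _ (mem_par_iff.1 hx)).1)
    (fun x hx => by
      rw [Set.indicator_of_mem hx]
      refine tendsto_const_nhds.congr' ?_
      filter_upwards [hev _ (mem_par_iff.1 hx)] with n hn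
      exact hn.eq_of_nhds.symm)
  have l2 : ∀ j, _ := fun j => tendsto_of_bounded Ω hPm hP (volume_par_ne_top A b)
    (ψ := fun n x => fderiv ℝ (φ n) x (EuclideanSpace.single j 1))
    (v := (par A b).indicator fun x => fderiv ℝ F (Ψ x) (A.symm (EuclideanSpace.single j 1)))
    (C := C * ‖A.symm (EuclideanSpace.single j 1)‖)
    (fun n => (continuous_fderiv_testFunction Ω (φ n)).clm_apply continuous_const)
    (fun n x hx => by
      have : x ∉ tsupport (fderiv ℝ (φ n)) := fun h => hx (htsP n (tsupport_fderiv_subset ℝ h))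
      rw [image_eq_zero_of_notMem_tsupport this]; rfl)
    (fun x hx => Set.indicator_of_notMem hx _)
    (fun n x hx => by
      rw [hder]
      refine ((fderiv ℝ (Fn n) (Ψ x)).le_opNorm _).trans ?_
      gcongr
      exact (hC _ (hpos n).le _ (mem_par_iff.1 hx)).2)
    (fun x hx => by
      rw [Set.indicator_of_mem hx]
      refine tendsto_const_nhds.congr' ?_
      filter_upwards [hev _ (mem_par_iff.1 hx)] with n hn
      rw [hder, hn.fderiv_eq])
  exact exists_H10_of_tendsto Ω φ l1.1 (fun j => (l2 j).1) l1.2 (fun j => (l2 j).2)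

end StokesTCoercivity
end

noncomputable section

namespace StokesTCoercivity

open scoped ENNReal NNReal ContDiff Topology
open Filter

variable {d : ℕ}

/-! ### Solving the divergence equation on a parallelepiped -/

theorem lintegral_tensor_finset_le {n : ℕ} (φ : Fin n → ℤ → ℝ → ℂ)
    (h : ∀ i, IsBessel halfMeasure (φ i)) :
    ∃ M : ℝ≥0, ∀ (t : Finset (Fin n → ℤ)) (c : (Fin n → ℤ) → ℂ),
      ∫⁻ y in halfCube n, ‖∑ k ∈ t, c k * ∏ i, φ i (k i) (y i)‖ₑ ^ 2
        ≤ M * ∑ k ∈ t, ‖c k‖ₑ ^ 2 := by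
  classical
  choose hc M hM using h
  refine ⟨∏ i, M i, fun t c => ?_⟩
  -- All coordinates of members of t: t sits in a product of copies of s, and the coefficients are
  -- padded by zero.
  set s : Finset ℤ := Finset.univ.biUnion fun i => t.image fun k => k i
  have hts : t ⊆ Fintype.piFinset fun _ => s := fun k hk => by
    rw [Fintype.mem_piFinset]
    exact fun i => Finset.mem_biUnion.2 ⟨i, Finset.mem_univ _, Finset.mem_image_of_mem _ hk⟩
  have := lintegral_tensor_le halfMeasure n φ M hc hM s (fun k => if k ∈ t then c k else 0)
  have e1 : ∀ y : Fin n → ℝ, ∑ k ∈ Fintype.piFinset (fun _ => s),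
      (if k ∈ t then c k else 0) * ∏ i, φ i (k i) (y i)
        = ∑ k ∈ t, c k * ∏ i, φ i (k i) (y i) := fun y => by
    rw [← Finset.sum_subset hts fun k _ hk => by rw [if_neg hk, zero_mul]]
    exact Finset.sum_congr rfl fun k hk => by rw [if_pos hk]
  have e2 : ∑ k ∈ Fintype.piFinset (fun _ => s), ‖if k ∈ t then c k else 0‖ₑ ^ 2
      = ∑ k ∈ t, ‖c k‖ₑ ^ 2 := by
    rw [← Finset.sum_subset hts fun k _ hk => by simp [hk]]
    exact Finset.sum_congr rfl fun k hk => by rw [if_pos hk]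
  rw [restrict_halfCube]
  simpa only [e1, e2, ENNReal.ofNNReal_finsetProd] using this

/-- The factors of the `m`-th component of the potential field. -/
def slot {n : ℕ} (m i : Fin n) : ℤ → ℝ → ℂ := if i = m then reflPrim else reflExpo

/-- The factors of the `l`-th partial derivative of the `m`-th component, normalized. -/
def slotDeriv {n : ℕ} (m l i : Fin n) : ℤ → ℝ → ℂ :=
  if i = l then (if l = m then reflExpo else fun k x => ((freq k)⁻¹ : ℂ) * reflExpoDeriv k x)
  else slot m i

/-- The normalizing factor of the `l`-th partial derivative. -/
def slotFreq {n : ℕ} (m l : Fin n) (k : Fin n → ℤ) : ℝ := if l = m then k m else freq (k l)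

theorem isBessel_slot {n : ℕ} (m i : Fin n) : IsBessel halfMeasure (slot m i) := by
  unfold slot; split_ifs
  exacts [isBessel_reflPrim, isBessel_reflExpo]

theorem isBessel_slotDeriv {n : ℕ} (m l i : Fin n) : IsBessel halfMeasure (slotDeriv m l i) := by
  unfold slotDeriv; split_ifs
  exacts [isBessel_reflExpo, isBessel_reflExpoDeriv, isBessel_slot m i]

@[fun_prop]
theorem contDiff_slot {n : ℕ} (m i : Fin n) (k : ℤ) : ContDiff ℝ ∞ (slot m i k) := by
  unfold slot; split_ifs
  exacts [contDiff_reflPrim k, contDiff_reflExpo k]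

theorem slot_zero {n : ℕ} (m i : Fin n) (k : ℤ) : slot m i k 0 = 0 := by
  unfold slot; split_ifs
  exacts [reflPrim_zero k, reflExpo_zero k]

theorem slot_half {n : ℕ} (m i : Fin n) (k : ℤ) : slot m i k (1 / 2) = 0 := by
  unfold slot; split_ifs
  exacts [reflPrim_half k, reflExpo_half k]

theorem hasDerivAt_slot {n : ℕ} (m l : Fin n) (k : Fin n → ℤ) (x : ℝ) :
    HasDerivAt (slot m l (k l)) (slotFreq m l k * slotDeriv m l l (k l) x) x := by
  by_cases h : l = m
  · subst h
    simp only [slot, slotFreq, slotDeriv, if_true]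
    simpa using hasDerivAt_reflPrim (k l) x
  · simp only [slot, slotFreq, slotDeriv, if_neg h, if_true]
    refine (hasDerivAt_reflExpo (k l) x).congr_deriv ?_
    rw [← mul_assoc, mul_inv_cancel₀, one_mul]
    exact_mod_cast (freq_pos (k l)).ne'

/-- The real part of a multiple of a product of one-dimensional functions. -/
def potential {n : ℕ} (m : Fin n) (γ : ℂ) (k : Fin n → ℤ) (y : Fin n → ℝ) : ℝ :=
  (γ * ∏ i, slot m i (k i) (y i)).re

theorem contDiff_potential {n : ℕ} (m : Fin n) (γ : ℂ) (k : Fin n → ℤ) :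
    ContDiff ℝ ∞ (potential m γ k) := by
  unfold potential
  refine Complex.reCLM.contDiff.comp (contDiff_const.mul (contDiff_prod fun i _ => ?_))
  exact (contDiff_slot m i (k i)).comp (contDiff_apply ℝ ℝ i)

theorem vanishesOnFaces_potential {n : ℕ} (m : Fin n) (γ : ℂ) (k : Fin n → ℤ) :
    VanishesOnFaces (potential m γ k) := by
  rintro y ⟨i, hi⟩
  have : slot m i (k i) (y i) = 0 := by
    rcases hi with h | h <;> rw [h]
    exacts [slot_zero _ _ _, slot_half _ _ _]
  rw [potential, Finset.prod_eq_zero (Finset.mem_univ i) this, mul_zero, Complex.zero_re]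

theorem fderiv_potential {n : ℕ} (m l : Fin n) (γ : ℂ) (k : Fin n → ℤ) (y : Fin n → ℝ) :
    fderiv ℝ (potential m γ k) y (Pi.single l 1)
      = (γ * slotFreq m l k * ∏ i, slotDeriv m l i (k i) (y i)).re := by
  have h1 : HasFDerivAt (fun y : Fin n → ℝ => ∏ i, slot m i (k i) (y i))
      (∑ i, (∏ j ∈ Finset.univ.erase i, slot m j (k j) (y j)) •
        ((ContinuousLinearMap.proj (R := ℝ) (φ := fun _ : Fin n => ℝ) i).smulRight
          (slotFreq m i k * slotDeriv m i i (k i) (y i)))) y := by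
    refine HasFDerivAt.finsetProd fun i _ => ?_
    exact (hasDerivAt_slot m i k (y i)).hasFDerivAt.comp y (hasFDerivAt_apply i y) |>.congr_fderiv
      (by ext z; simp)
  have h2 := Complex.reCLM.hasFDerivAt.comp y (h1.const_mul γ)
  have h3 : HasFDerivAt (potential m γ k) _ y := h2
  rw [h3.fderiv]
  simp only [ContinuousLinearMap.comp_apply, Complex.reCLM_apply, smul_apply, sum_apply, ContinuousLinearMap.smulRight_apply,
    ContinuousLinearMap.proj_apply]
  rw [Finset.sum_eq_single l]
  · rw [Pi.single_eq_same, one_smul, ← Finset.mul_prod_erase _ _ (Finset.mem_univ l)]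
    congr 1
    have : ∏ i ∈ Finset.univ.erase l, slotDeriv m l i (k i) (y i)
        = ∏ i ∈ Finset.univ.erase l, slot m i (k i) (y i) :=
      Finset.prod_congr rfl fun i hi => by
        rw [slotDeriv, if_neg (Finset.ne_of_mem_erase hi)]
    rw [this, smul_eq_mul, smul_eq_mul]
    ring
  · intro i _ hi
    rw [Pi.single_eq_of_ne hi, zero_smul, smul_zero]
  · simp

/-- `∑ⱼ kⱼ²`. -/
def sqSum {n : ℕ} (k : Fin n → ℤ) : ℝ := ∑ j, (k j : ℝ) ^ 2

theorem sqSum_nonneg {n : ℕ} (k : Fin n → ℤ) : 0 ≤ sqSum k :=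
  Finset.sum_nonneg fun _ _ => sq_nonneg _

/-- This bounds the coefficients of ∂_l of the m-th component. For l = m it is k_m² ≤ |k|².
Otherwise |k_m k_l| ≤ k_m² + k_l² handles one entry of the maximum in `freq`, and |k_m| ≤ k_m² for
integers handles the other. At k = 0 the quotient is 0 by convention. -/
theorem abs_div_sqSum_le {n : ℕ} (m l : Fin n) (k : Fin n → ℤ) :
    |(k m : ℝ) / sqSum k * slotFreq m l k| ≤ 1 := by
  have hm : (k m : ℝ) ^ 2 ≤ sqSum k :=
    Finset.single_le_sum (f := fun j => (k j : ℝ) ^ 2) (fun _ _ => sq_nonneg _) (Finset.mem_univ m)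
  have key : |(k m : ℝ)| * |slotFreq m l k| ≤ sqSum k := by
    unfold slotFreq
    split_ifs with h
    · rw [← abs_mul, ← sq, abs_of_nonneg (sq_nonneg _)]; exact hm
    · rw [abs_of_pos (freq_pos _), freq]
      by_cases h0 : k m = 0
      · simp [h0, sqSum_nonneg]
      have h1 : (1 : ℝ) ≤ |(k m : ℝ)| := by
        rw [← Int.cast_abs]; exact_mod_cast Int.one_le_abs h0
      rw [mul_max_of_nonneg _ _ (abs_nonneg _), max_le_iff]
      constructor
      · rw [mul_one]
        refine le_trans ?_ hm
        rw [← sq_abs]; nlinarith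
      · have hml : (k m : ℝ) ^ 2 + (k l : ℝ) ^ 2 ≤ sqSum k := by
          have := Finset.sum_le_sum_of_subset_of_nonneg (f := fun j => (k j : ℝ) ^ 2)
            (Finset.subset_univ {m, l}) (fun _ _ _ => sq_nonneg _)
          rwa [Finset.sum_pair (Ne.symm h)] at this
        rw [← sq_abs (k m : ℝ), ← sq_abs (k l : ℝ)] at hml
        nlinarith [sq_nonneg (|(k m : ℝ)| - |(k l : ℝ)|), abs_nonneg (k m : ℝ),
          abs_nonneg (k l : ℝ)]
  rw [abs_mul, abs_div, abs_of_nonneg (sqSum_nonneg k), div_mul_eq_mul_div]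
  exact div_le_one_of_le₀ key (sqSum_nonneg k)

theorem abs_div_sqSum_le_one {n : ℕ} (m : Fin n) (k : Fin n → ℤ) :
    |(k m : ℝ) / sqSum k| ≤ 1 := by
  by_cases h0 : k m = 0
  · simp [h0]
  · have h := abs_div_sqSum_le m m k
    have h1 : (1 : ℝ) ≤ |(k m : ℝ)| := by
      rw [← Int.cast_abs]; exact_mod_cast Int.one_le_abs h0
    rw [abs_mul, slotFreq, if_pos rfl] at h
    exact (le_mul_of_one_le_right (abs_nonneg _) h1).trans h

theorem ae_sum_lp {α ι : Type*} [MeasurableSpace α] {μ : Measure α} (s : Finset ι)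
    {f : ι → Lp ℝ 2 μ} {g : ι → α → ℝ} (h : ∀ k ∈ s, f k =ᵐ[μ] g k) :
    (∑ k ∈ s, f k : Lp ℝ 2 μ) =ᵐ[μ] fun x => ∑ k ∈ s, g k x := by
  classical
  induction s using Finset.induction_on with
  | empty => simp only [Finset.sum_empty]; exact Lp.coeFn_zero ℝ 2 μ
  | insert a s ha ih =>
    simp only [Finset.sum_insert ha]
    filter_upwards [Lp.coeFn_add (f a) (∑ k ∈ s, f k), h a (by simp),
      ih fun k hk => h k (by simp [hk])] with x h1 h2 h3
    rw [h1, Pi.add_apply, h2, h3]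

theorem enorm_lp_sq {α : Type*} [MeasurableSpace α] {μ : Measure α} (f : Lp ℝ 2 μ) :
    ‖f‖ₑ ^ 2 = ∫⁻ x, ‖f x‖ₑ ^ 2 ∂μ := by
  rw [← eLpNorm_two_sq, Lp.enorm_def]

theorem exists_lintegral_par (A : (Fin d → ℝ) ≃L[ℝ] Space d) (b : Space d) :
    ∃ κ : ℝ≥0, ∀ h : (Fin d → ℝ) → ℝ≥0∞,
      ∫⁻ x in par A b, h ((parMap A b).symm x) = κ * ∫⁻ y in halfCube d, h y := by
  obtain ⟨κ, h0, h1, hκ⟩ := exists_map_parMap A b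
  refine ⟨κ⁻¹.toNNReal, fun h => ?_⟩
  have hvol : volume.restrict (par A b)
      = κ⁻¹ • (volume.restrict (halfCube d)).map (parMap A b).toMeasurableEquiv := by
    rw [Homeomorph.toMeasurableEquiv_coe, hκ, smul_smul, ENNReal.inv_mul_cancel h0 h1, one_smul]
  rw [hvol, lintegral_smul_measure, lintegral_map_equiv, ENNReal.coe_toNNReal (by simpa using h0)]
  simp

/-- `p` is the transport of the function `F` on the cube to the parallelepiped. -/
def Represents (Ω : Opens (Space d)) (A : (Fin d → ℝ) ≃L[ℝ] Space d) (b : Space d)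
    (p : H10 Ω) (F : (Fin d → ℝ) → ℝ) : Prop :=
  Differentiable ℝ F ∧
  (p : L2Pair Ω).fst =ᵐ[volume.restrict (Ω : Set (Space d))]
    (par A b).indicator (fun x => F ((parMap A b).symm x)) ∧
  ∀ j, (p : L2Pair Ω).snd j =ᵐ[volume.restrict (Ω : Set (Space d))]
    (par A b).indicator (fun x => fderiv ℝ F ((parMap A b).symm x)
      (A.symm (EuclideanSpace.single j 1)))

theorem Represents.sum {Ω : Opens (Space d)} {A : (Fin d → ℝ) ≃L[ℝ] Space d} {b : Space d}
    {ι : Type*} (s : Finset ι) {p : ι → H10 Ω} {F : ι → (Fin d → ℝ) → ℝ}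
    (h : ∀ k ∈ s, Represents Ω A b (p k) (F k)) :
    Represents Ω A b (∑ k ∈ s, p k) (fun y => ∑ k ∈ s, F k y) := by
  refine ⟨Differentiable.fun_sum fun k hk => (h k hk).1, ?_, fun j => ?_⟩
  · have e : ((∑ k ∈ s, p k : H10 Ω) : L2Pair Ω).fst = ∑ k ∈ s, (p k : L2Pair Ω).fst := by
      rw [Submodule.coe_sum]
      exact map_sum (WithLp.fstL 2 ℝ (L2 Ω) (PiLp 2 (fun _ : Fin d => L2 Ω))) _ _
    rw [e]
    refine (ae_sum_lp s fun k hk => (h k hk).2.1).trans (ae_of_all _ fun x => ?_)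
    by_cases hx : x ∈ par A b <;> simp [hx]
  · have e : ((∑ k ∈ s, p k : H10 Ω) : L2Pair Ω).snd j = ∑ k ∈ s, (p k : L2Pair Ω).snd j := by
      rw [Submodule.coe_sum]
      exact map_sum ((PiLp.proj 2 (𝕜 := ℝ) (fun _ : Fin d => L2 Ω) j) ∘L
        (WithLp.sndL 2 ℝ (L2 Ω) (PiLp 2 (fun _ : Fin d => L2 Ω)))) _ _
    rw [e]
    refine (ae_sum_lp s fun k hk => (h k hk).2.2 j).trans (ae_of_all _ fun x => ?_)
    by_cases hx : x ∈ par A b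
    · simp only [Set.indicator_of_mem hx]
      rw [fderiv_fun_sum fun k hk => (h k hk).1 _, sum_apply]
    · simp [hx]

theorem fderiv_apply_eq_sum {n : ℕ} (L : (Fin n → ℝ) →L[ℝ] ℝ) (v : Fin n → ℝ) :
    L v = ∑ l, v l * L (Pi.single l 1) := by
  conv_lhs => rw [pi_eq_sum_univ' v, map_sum]
  simp only [map_smul, smul_eq_mul]

theorem lintegral_indicator_par {Ω : Opens (Space d)} {A : (Fin d → ℝ) ≃L[ℝ] Space d} {b : Space d}
    (hP : par A b ⊆ Ω) (h : Space d → ℝ) :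
    ∫⁻ x in Ω, ‖(par A b).indicator h x‖ₑ ^ 2 = ∫⁻ x in par A b, ‖h x‖ₑ ^ 2 := by
  have : (fun x => ‖(par A b).indicator h x‖ₑ ^ 2)
      = (par A b).indicator (fun x => ‖h x‖ₑ ^ 2) := by
    funext x
    by_cases hx : x ∈ par A b <;> simp [hx]
  have hm := (isOpen_par A b).measurableSet
  rw [this, lintegral_indicator hm, Measure.restrict_restrict hm, Set.inter_eq_left.2 hP]

/-- Change of variables and chain rule: κ is the Jacobian, K the sum of the squared entries of A⁻¹,
and the factor d comes from Cauchy–Schwarz. -/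
theorem exists_norm_le_of_represents (Ω : Opens (Space d)) {A : (Fin d → ℝ) ≃L[ℝ] Space d}
    {b : Space d} (hP : par A b ⊆ Ω) :
    ∃ C : ℝ≥0, ∀ p F, Represents Ω A b p F → ‖p‖ₑ ^ 2 ≤ C * ((∫⁻ y in halfCube d, ‖F y‖ₑ ^ 2)
      + ∑ l, ∫⁻ y in halfCube d, ‖fderiv ℝ F y (Pi.single l 1)‖ₑ ^ 2) := by
  obtain ⟨κ, hκ⟩ := exists_lintegral_par A b
  set a : Fin d → Fin d → ℝ := fun j l => A.symm (EuclideanSpace.single j 1) l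
  set K : ℝ≥0 := ∑ j, ∑ l, ‖a j l‖₊ ^ 2
  refine ⟨κ + κ * (d * K), fun p F hF => ?_⟩
  have e : ‖p‖ₑ ^ 2 = ‖(p : L2Pair Ω).fst‖ₑ ^ 2 + ∑ j, ‖(p : L2Pair Ω).snd j‖ₑ ^ 2 := by
    have h1 : ‖(p : L2Pair Ω)‖₊ ^ 2 = ‖(p : L2Pair Ω).fst‖₊ ^ 2
        + ∑ j, ‖(p : L2Pair Ω).snd j‖₊ ^ 2 := by
      rw [← NNReal.coe_inj]
      push_cast
      rw [WithLp.prod_norm_sq_eq_of_L2, PiLp.norm_sq_eq_of_L2]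
    simp only [enorm_eq_nnnorm]
    exact_mod_cast h1
  obtain ⟨hFd, h1, h2⟩ := hF
  have b1 : ‖(p : L2Pair Ω).fst‖ₑ ^ 2 = κ * ∫⁻ y in halfCube d, ‖F y‖ₑ ^ 2 := by
    rw [enorm_lp_sq, lintegral_congr_ae (h1.mono fun x hx => by rw [hx]),
      lintegral_indicator_par hP, hκ fun y => ‖F y‖ₑ ^ 2]
  have hmeas : ∀ l, Measurable fun y => fderiv ℝ F y (Pi.single l 1) := fun l =>
    measurable_fderiv_apply_const ℝ F _
  have b2 : ∀ j, ‖(p : L2Pair Ω).snd j‖ₑ ^ 2 ≤ κ * (d * ∑ l, (‖a j l‖ₑ ^ 2 *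
      ∫⁻ y in halfCube d, ‖fderiv ℝ F y (Pi.single l 1)‖ₑ ^ 2)) := by
    intro j
    rw [enorm_lp_sq, lintegral_congr_ae ((h2 j).mono fun x hx => by rw [hx]),
      lintegral_indicator_par hP,
      hκ fun y => ‖fderiv ℝ F y (A.symm (EuclideanSpace.single j 1))‖ₑ ^ 2]
    refine mul_le_mul_right ?_ _
    calc ∫⁻ y in halfCube d, ‖fderiv ℝ F y (A.symm (EuclideanSpace.single j 1))‖ₑ ^ 2
        ≤ ∫⁻ y in halfCube d, (d : ℝ≥0∞) *
            ∑ l, ‖a j l‖ₑ ^ 2 * ‖fderiv ℝ F y (Pi.single l 1)‖ₑ ^ 2 := by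
          refine lintegral_mono fun y => ?_
          rw [fderiv_apply_eq_sum]
          refine (enorm_sum_sq_le _ _).trans ?_
          simp [a, mul_pow, enorm_mul]
      _ = _ := by
          rw [lintegral_const_mul' _ _ (by simp), lintegral_finsetSum]
          · simp only [lintegral_const_mul' _ _ (show ‖a j _‖ₑ ^ 2 ≠ ⊤ by simp)]
          · exact fun l _ => ((hmeas l).enorm.pow_const 2).const_mul _
  rw [e, b1]
  set S := ∑ l, ∫⁻ y in halfCube d, ‖fderiv ℝ F y (Pi.single l 1)‖ₑ ^ 2 with hS
  have b3 : ∑ j, ‖(p : L2Pair Ω).snd j‖ₑ ^ 2 ≤ κ * (d * K) * S := by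
    calc ∑ j, ‖(p : L2Pair Ω).snd j‖ₑ ^ 2 ≤ ∑ j, κ * (d * ((∑ l, ‖a j l‖ₑ ^ 2) * S)) := by
          refine Finset.sum_le_sum fun j _ => (b2 j).trans ?_
          rw [Finset.sum_mul]
          gcongr with l _
          rw [hS]
          exact Finset.single_le_sum (f := fun l => ∫⁻ y in halfCube d,
            ‖fderiv ℝ F y (Pi.single l 1)‖ₑ ^ 2) (fun _ _ => zero_le) (Finset.mem_univ l)
      _ = κ * (d * K) * S := by
          simp only [← Finset.mul_sum, ← Finset.sum_mul, K]
          push_cast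
          simp only [enorm_eq_nnnorm]
          ring
  push_cast
  set T := ∫⁻ y in halfCube d, ‖F y‖ₑ ^ 2
  calc (κ : ℝ≥0∞) * T + ∑ j, ‖(p : L2Pair Ω).snd j‖ₑ ^ 2
      ≤ κ * T + κ * (d * K) * S := by gcongr
    _ ≤ (κ + κ * (d * K)) * T + (κ + κ * (d * K)) * S := by
        gcongr
        · exact le_self_add
        · exact le_add_self
    _ = _ := by ring

end StokesTCoercivity
end

/-! ### Summation of the potentials and the Piola transform -/

noncomputable section

namespace StokesTCoercivity

open scoped ENNReal NNReal ContDiff Topology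
open Filter

variable {d : ℕ}

instance (Ω : Opens (Space d)) : CompleteSpace (H10 Ω) := by
  unfold H10; infer_instance

theorem represents_potential (Ω : Opens (Space d)) {A : (Fin d → ℝ) ≃L[ℝ] Space d}
    {b : Space d} (hP : par A b ⊆ Ω) (m : Fin d) (γ : ℂ) (k : Fin d → ℤ) :
    ∃ p, Represents Ω A b p (potential m γ k) := by
  obtain ⟨p, h1, h2⟩ := exists_H10_of_contDiff Ω hP (contDiff_potential m γ k)
    (vanishesOnFaces_potential m γ k)
  exact ⟨p, (contDiff_potential m γ k).differentiable (by simp), h1, h2⟩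

/-- The coefficients of the `m`-th component of the potential field. -/
def potCoeff {n : ℕ} (c : (Fin n → ℤ) → ℂ) (m : Fin n) (k : Fin n → ℤ) : ℂ :=
  c k * ((k m : ℝ) / sqSum k : ℝ)

/-- The Bessel bounds for the values and for each normalized derivative dominate the H¹ norm of any
finite block by the ℓ² norm of its coefficients, which gives the Cauchy criterion in the complete
space H¹₀(Ω). -/
theorem summable_potential (Ω : Opens (Space d)) {A : (Fin d → ℝ) ≃L[ℝ] Space d}
    {b : Space d} (hP : par A b ⊆ Ω) (m : Fin d) {c : (Fin d → ℤ) → ℂ}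
    (hc : Summable fun k => ‖c k‖ ^ 2) {p : (Fin d → ℤ) → H10 Ω}
    (hp : ∀ k, Represents Ω A b (p k) (potential m (potCoeff c m k) k)) : Summable p := by
  obtain ⟨C, hC⟩ := exists_norm_le_of_represents Ω hP
  obtain ⟨M₀, hM₀⟩ := lintegral_tensor_finset_le (fun i => slot m i) (isBessel_slot m)
  have h1 := fun l => lintegral_tensor_finset_le (fun i => slotDeriv m l i)
    (isBessel_slotDeriv m l)
  choose M₁ hM₁ using h1
  have hre : ∀ z : ℂ, ‖z.re‖ₑ ^ 2 ≤ ‖z‖ₑ ^ 2 := fun z => by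
    refine pow_le_pow_left₀ zero_le ?_ 2
    rw [← ofReal_norm, ← ofReal_norm]
    exact ENNReal.ofReal_le_ofReal (Complex.abs_re_le_norm z)
  have hle : ∀ (k : Fin d → ℤ) (r : ℝ), |r| ≤ 1 → ‖c k * (r : ℂ)‖ₑ ≤ ‖c k‖ₑ := by
    intro k r hr
    rw [enorm_mul]
    refine mul_le_of_le_one_right zero_le ?_
    rw [← ofReal_norm, Complex.norm_real, ENNReal.ofReal_le_one]
    exact hr
  have key : ∀ t : Finset (Fin d → ℤ), ‖∑ k ∈ t, p k‖ ^ 2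
      ≤ ((C * (M₀ + ∑ l, M₁ l) : ℝ≥0) : ℝ) * ∑ k ∈ t, ‖c k‖ ^ 2 := by
    intro t
    have h2 := hC _ _ (Represents.sum t fun k _ => hp k)
    have e0 : ∫⁻ y in halfCube d, ‖∑ k ∈ t, potential m (potCoeff c m k) k y‖ₑ ^ 2
        ≤ M₀ * ∑ k ∈ t, ‖c k‖ₑ ^ 2 := by
      calc _ ≤ ∫⁻ y in halfCube d, ‖∑ k ∈ t, potCoeff c m k * ∏ i, slot m i (k i) (y i)‖ₑ ^ 2 := by
            refine lintegral_mono fun y => ?_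
            simp only [potential, ← Complex.re_sum]
            exact hre _
        _ ≤ M₀ * ∑ k ∈ t, ‖potCoeff c m k‖ₑ ^ 2 := hM₀ t _
        _ ≤ _ := by
            gcongr with k _
            exact hle k _ (abs_div_sqSum_le_one m k)
    have e1 : ∀ l, ∫⁻ y in halfCube d,
        ‖fderiv ℝ (fun y => ∑ k ∈ t, potential m (potCoeff c m k) k y) y (Pi.single l 1)‖ₑ ^ 2
        ≤ M₁ l * ∑ k ∈ t, ‖c k‖ₑ ^ 2 := by
      intro l
      calc _ ≤ ∫⁻ y in halfCube d, ‖∑ k ∈ t, (potCoeff c m k * slotFreq m l k) *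
              ∏ i, slotDeriv m l i (k i) (y i)‖ₑ ^ 2 := by
            refine lintegral_mono fun y => ?_
            rw [fderiv_fun_sum fun k _ => (hp k).1 y, sum_apply]
            simp only [fderiv_potential, ← Complex.re_sum]
            exact hre _
        _ ≤ M₁ l * ∑ k ∈ t, ‖potCoeff c m k * slotFreq m l k‖ₑ ^ 2 := hM₁ l t _
        _ ≤ _ := by
            gcongr with k _
            rw [potCoeff, mul_assoc, ← Complex.ofReal_mul]
            exact hle k _ (abs_div_sqSum_le m l k)
    have h3 : ‖∑ k ∈ t, p k‖ₑ ^ 2 ≤ (C * (M₀ + ∑ l, M₁ l) : ℝ≥0) * ∑ k ∈ t, ‖c k‖ₑ ^ 2 := by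
      refine h2.trans ?_
      push_cast
      rw [mul_assoc, add_mul, Finset.sum_mul]
      gcongr with l _
      exact e1 l
    simp only [enorm_eq_nnnorm] at h3
    have h4 : ‖∑ k ∈ t, p k‖₊ ^ 2 ≤ (C * (M₀ + ∑ l, M₁ l) : ℝ≥0) * ∑ k ∈ t, ‖c k‖₊ ^ 2 := by
      exact_mod_cast h3
    simpa using NNReal.coe_le_coe.2 h4
  set K := C * (M₀ + ∑ l, M₁ l)
  rw [summable_iff_vanishing_norm]
  intro ε hε
  -- K may be zero, hence K + 1.
  obtain ⟨s, hs⟩ := summable_iff_vanishing_norm.1 hc (ε ^ 2 / (K + 1)) (by positivity)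
  refine ⟨s, fun t ht => ?_⟩
  have h5 := hs t ht
  rw [Real.norm_of_nonneg (Finset.sum_nonneg fun _ _ => by positivity), lt_div_iff₀ (by positivity)]
    at h5
  refine lt_of_pow_lt_pow_left₀ 2 hε.le ((key t).trans_lt ?_)
  have : 0 ≤ ∑ k ∈ t, ‖c k‖ ^ 2 := Finset.sum_nonneg fun _ _ => by positivity
  nlinarith

/-- Differentiating the primitive in its own slot restores the same product for every m, with factor
k_m² / |k|²; these factors add up to one unless k = 0, where the coefficient is zero. -/
theorem sum_fderiv_potential {n : ℕ} {c : (Fin n → ℤ) → ℂ} (hc0 : c 0 = 0) (k : Fin n → ℤ)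
    (y : Fin n → ℝ) :
    ∑ m, fderiv ℝ (potential m (potCoeff c m k) k) y (Pi.single m 1)
      = (c k * ∏ i, reflExpo (k i) (y i)).re := by
  have hprod : ∀ m, ∏ i, slotDeriv m m i (k i) (y i) = ∏ i, reflExpo (k i) (y i) := fun m =>
    Finset.prod_congr rfl fun i _ => by
      unfold slotDeriv slot
      by_cases h : i = m <;> simp [h]
  simp only [fderiv_potential, hprod, ← Complex.re_sum, ← Finset.sum_mul]
  congr 2
  by_cases hk : k = 0
  · subst hk; simp [potCoeff, hc0]
  · have hne : sqSum k ≠ 0 := by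
      intro h
      apply hk
      funext j
      have := (Finset.sum_eq_zero_iff_of_nonneg fun _ _ => sq_nonneg _).1 h j (Finset.mem_univ j)
      simpa using this
    have : ∑ m, potCoeff c m k * (slotFreq m m k : ℂ)
        = c k * ((∑ m, (k m : ℝ) ^ 2) / sqSum k : ℝ) := by
      rw [Finset.sum_div, Complex.ofReal_sum, Finset.mul_sum]
      refine Finset.sum_congr rfl fun m _ => ?_
      simp only [potCoeff, slotFreq, if_true]
      push_cast
      ring
    rw [this, ← sqSum, div_self hne]
    simp

/-- The `i`-th coordinate of `A e_m`. -/
def matEntry (A : (Fin d → ℝ) ≃L[ℝ] Space d) (i m : Fin d) : ℝ := A (Pi.single m 1) i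

theorem sum_matEntry (A : (Fin d → ℝ) ≃L[ℝ] Space d) (L : (Fin d → ℝ) →L[ℝ] ℝ) (m : Fin d) :
    ∑ i, matEntry A i m * L (A.symm (EuclideanSpace.single i 1)) = L (Pi.single m 1) := by
  have h : A (Pi.single m 1) = ∑ i, matEntry A i m • EuclideanSpace.single i (1 : ℝ) := by
    ext j
    simp [matEntry, Finset.sum_apply, Pi.single_apply]
  have h2 : (Pi.single m 1 : Fin d → ℝ)
      = ∑ i, matEntry A i m • A.symm (EuclideanSpace.single i 1) := by
    rw [← A.symm_apply_apply (Pi.single m 1), h, map_sum]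
    simp only [map_smul]
  conv_rhs => rw [h2, map_sum]
  simp only [map_smul, smul_eq_mul]

/-- The Piola transform of a family of components. -/
def piola {Ω : Opens (Space d)} (A : (Fin d → ℝ) ≃L[ℝ] Space d) (p : Fin d → H10 Ω) :
    Velocity Ω := WithLp.toLp 2 fun i => ∑ m, matEntry A i m • p m

theorem divL_piola {Ω : Opens (Space d)} (A : (Fin d → ℝ) ≃L[ℝ] Space d) (p : Fin d → H10 Ω) :
    divL Ω (piola A p) = ∑ i, ∑ m, matEntry A i m • (p m : L2Pair Ω).snd i := by
  simp only [divL, sum_apply]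
  refine Finset.sum_congr rfl fun i _ => ?_
  have e : partialD Ω i i (piola A p)
      = ((PiLp.proj 2 (𝕜 := ℝ) (fun _ : Fin d => L2 Ω) i) ∘L
    (WithLp.sndL 2 ℝ (L2 Ω) (PiLp 2 (fun _ : Fin d => L2 Ω))) ∘L
    (H10 Ω).subtypeL) (∑ m, matEntry A i m • p m) := rfl
  rw [e, map_sum]
  simp only [map_smul]
  rfl

/-- The matrix of A in the Piola transform cancels the A⁻¹ of the chain rule (`sum_matEntry`), so
the divergence on the cube is carried over unchanged. -/
theorem ae_sum_smul_snd {Ω : Opens (Space d)} {A : (Fin d → ℝ) ≃L[ℝ] Space d} {b : Space d}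
    {p : Fin d → H10 Ω} {F : Fin d → (Fin d → ℝ) → ℝ} (hp : ∀ m, Represents Ω A b (p m) (F m)) :
    (∑ i, ∑ m, matEntry A i m • (p m : L2Pair Ω).snd i : L2 Ω)
      =ᵐ[volume.restrict (Ω : Set (Space d))] (par A b).indicator
        fun x => ∑ m, fderiv ℝ (F m) ((parMap A b).symm x) (Pi.single m 1) := by
  have h1 : ∀ i m, (matEntry A i m • (p m : L2Pair Ω).snd i : L2 Ω)
      =ᵐ[volume.restrict (Ω : Set (Space d))] fun x => matEntry A i m *
        (par A b).indicator (fun x => fderiv ℝ (F m) ((parMap A b).symm x)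
          (A.symm (EuclideanSpace.single i 1))) x := fun i m => by
    filter_upwards [Lp.coeFn_smul (matEntry A i m) ((p m : L2Pair Ω).snd i), (hp m).2.2 i]
      with x hx1 hx2
    rw [hx1, Pi.smul_apply, hx2, smul_eq_mul]
  refine (ae_sum_lp Finset.univ fun i _ => ae_sum_lp Finset.univ fun m _ => h1 i m).trans
    (ae_of_all _ fun x => ?_)
  by_cases hx : x ∈ par A b
  · simp only [Set.indicator_of_mem hx]
    rw [Finset.sum_comm]
    exact Finset.sum_congr rfl fun m _ => sum_matEntry A _ m
  · simp [hx]

theorem memLp_comp_parMap {Ω : Opens (Space d)} {A : (Fin d → ℝ) ≃L[ℝ] Space d} {b : Space d}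
    (hP : par A b ⊆ Ω) (q : L2 Ω) :
    MemLp (fun y => ((q (parMap A b y) : ℝ) : ℂ)) 2 (volume.restrict (halfCube d)) := by
  obtain ⟨κ, h0, h1, hκ⟩ := exists_map_parMap A b
  have hq : MemLp q 2 (volume.restrict (par A b)) :=
    (Lp.memLp q).mono_measure (Measure.restrict_mono_set _ hP)
  have h2 : MemLp q 2 ((volume.restrict (halfCube d)).map (parMap A b)) := by
    rw [hκ]; exact hq.smul_measure h1
  exact (h2.comp_of_map (parMap A b).continuous.measurable.aemeasurable).ofReal

theorem integral_comp_parMap {Ω : Opens (Space d)} {A : (Fin d → ℝ) ≃L[ℝ] Space d} {b : Space d}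
    (hP : par A b ⊆ Ω) {q : L2 Ω}
    (hq : q =ᵐ[volume.restrict (Ω : Set (Space d))] (par A b).indicator q)
    (hq0 : ∫ x in Ω, q x = 0) :
    ∫ y in halfCube d, ((q (parMap A b y) : ℝ) : ℂ) = 0 := by
  obtain ⟨κ, h0, h1, hκ⟩ := exists_map_parMap A b
  have hm := (isOpen_par A b).measurableSet
  rw [integral_congr_ae hq, integral_indicator hm, Measure.restrict_restrict hm,
    Set.inter_eq_left.2 hP] at hq0
  rw [integral_complex_ofReal]
  have := integral_map_equiv (μ := volume.restrict (halfCube d)) (parMap A b).toMeasurableEquiv q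
  rw [Homeomorph.toMeasurableEquiv_coe, hκ, integral_smul_measure, hq0, smul_zero] at this
  rw [← this]; rfl

/-- The divergence equation is solvable on parallelepipeds. -/
theorem exists_divL_eq_of_par (Ω : Opens (Space d)) {A : (Fin d → ℝ) ≃L[ℝ] Space d}
    {b : Space d} (hP : par A b ⊆ Ω) {q : L2 Ω}
    (hq : q =ᵐ[volume.restrict (Ω : Set (Space d))] (par A b).indicator q)
    (hq0 : ∫ x in Ω, q x = 0) : ∃ w : Velocity Ω, divL Ω w = q := by
  obtain ⟨c, hc, hc0, hlim⟩ := exists_reflExpo_series d (memLp_comp_parMap hP q)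
    (integral_comp_parMap hP hq hq0)
  have hrep := fun (m : Fin d) (k : Fin d → ℤ) =>
    represents_potential Ω hP m (potCoeff c m k) k
  choose p hp using hrep
  have hsum := fun m => (summable_potential Ω hP m hc (hp m)).hasSum
  refine ⟨piola A fun m => ∑' k, p m k, ?_⟩
  set D : (Fin d → ℤ) → L2 Ω := fun k =>
    ∑ i, ∑ m, matEntry A i m • (p m k : L2Pair Ω).snd i
  have hD : HasSum D (divL Ω (piola A fun m => ∑' k, p m k)) := by
    rw [divL_piola]
    refine hasSum_sum fun i _ => hasSum_sum fun m _ => ?_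
    refine HasSum.const_smul _ ?_
    exact (hsum m).mapL ((PiLp.proj 2 (𝕜 := ℝ) (fun _ : Fin d => L2 Ω) i) ∘L
      (WithLp.sndL 2 ℝ (L2 Ω) (PiLp 2 (fun _ : Fin d => L2 Ω))) ∘L (H10 Ω).subtypeL)
  have hDae : ∀ S : Finset (Fin d → ℤ), (∑ k ∈ S, D k : L2 Ω)
      =ᵐ[volume.restrict (Ω : Set (Space d))] (par A b).indicator
        fun x => (∑ k ∈ S, c k * ∏ i, reflExpo (k i) ((parMap A b).symm x i)).re := by
    intro S
    refine (ae_sum_lp S fun k _ => ae_sum_smul_snd fun m => hp m k).trans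
      (ae_of_all _ fun x => ?_)
    by_cases hx : x ∈ par A b
    · simp only [Set.indicator_of_mem hx, sum_fderiv_potential hc0, Complex.re_sum]
    · simp [hx]
  obtain ⟨κ, hκ⟩ := exists_lintegral_par A b
  have hbd : ∀ S : Finset (Fin d → ℤ), ‖∑ k ∈ S, D k - q‖ₑ ^ 2 ≤ κ * ∫⁻ y in halfCube d,
      ‖∑ k ∈ S, c k * ∏ i, reflExpo (k i) (y i) - ((q (parMap A b y) : ℝ) : ℂ)‖ₑ ^ 2 := by
    intro S
    rw [enorm_lp_sq, ← hκ]
    have e : (∑ k ∈ S, D k - q : L2 Ω) =ᵐ[volume.restrict (Ω : Set (Space d))]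
        (par A b).indicator fun x =>
          (∑ k ∈ S, c k * ∏ i, reflExpo (k i) ((parMap A b).symm x i)).re - q x := by
      filter_upwards [Lp.coeFn_sub (∑ k ∈ S, D k) q, hDae S, hq] with x h1 h2 h3
      rw [h1, Pi.sub_apply, h2, h3]
      by_cases hx : x ∈ par A b <;> simp [hx]
    rw [lintegral_congr_ae (e.mono fun x hx => by rw [hx]), lintegral_indicator_par hP]
    refine lintegral_mono fun x => ?_
    refine pow_le_pow_left₀ zero_le ?_ 2
    rw [← ofReal_norm, ← ofReal_norm]
    refine ENNReal.ofReal_le_ofReal ?_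
    have := Complex.abs_re_le_norm
      (∑ k ∈ S, c k * ∏ i, reflExpo (k i) ((parMap A b).symm x i) - ((q x : ℝ) : ℂ))
    rw [Complex.sub_re, Complex.ofReal_re] at this
    simpa using this
  -- The partial sums of the divergences tend in L² to the divergence of the sum by continuity, and
  -- to q by the reflected Fourier series. Taking real parts is harmless as q is real.
  have hq' : Tendsto (fun S => ∑ k ∈ S, D k) atTop (𝓝 q) := by
    rw [tendsto_iff_edist_tendsto_0]
    have h2 : Tendsto (fun S => ‖∑ k ∈ S, D k - q‖ₑ ^ 2) atTop (𝓝 0) := by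
      refine tendsto_of_tendsto_of_tendsto_of_le_of_le tendsto_const_nhds ?_ (fun S => zero_le) hbd
      simpa using ENNReal.Tendsto.const_mul hlim (Or.inr ENNReal.coe_ne_top)
    have h3 := (ENNReal.continuous_rpow_const (y := (1 / 2 : ℝ))).continuousAt.tendsto.comp h2
    simp only [Function.comp_def] at h3
    rw [ENNReal.zero_rpow_of_pos (by norm_num)] at h3
    refine h3.congr fun S => ?_
    rw [← ENNReal.rpow_natCast, ← ENNReal.rpow_mul, edist_eq_enorm_sub]
    norm_num
  exact tendsto_nhds_unique hD hq'

end StokesTCoercivity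
end

noncomputable section

namespace StokesTCoercivity

open scoped ENNReal NNReal ContDiff Topology
open Filter

variable {d : ℕ}

/-! ### Covering a polyhedral domain by parallelepipeds -/

/-- The closed chamber of `x` with respect to a family of hyperplanes. -/
def chamber (H : Finset (Space d × ℝ)) (x : Space d) : Set (Space d) :=
  {y | ∀ h ∈ H, 0 ≤ (⟪h.1, x⟫ - h.2) * (⟪h.1, y⟫ - h.2)}

/-- The open chamber of `x` with respect to a family of hyperplanes. -/
def openChamber (H : Finset (Space d × ℝ)) (x : Space d) : Set (Space d) :=
  {y | ∀ h ∈ H, 0 < (⟪h.1, x⟫ - h.2) * (⟪h.1, y⟫ - h.2)}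

/-- The points which are the unique common point of the hyperplanes through them. -/
def arrangementVertices (H : Finset (Space d × ℝ)) : Set (Space d) :=
  {v | ∀ y, (∀ h ∈ H, ⟪h.1, v⟫ = h.2 → ⟪h.1, y⟫ = h.2) → y = v}

/-- A vertex is determined by the subset of hyperplanes through it. -/
theorem finite_arrangementVertices (H : Finset (Space d × ℝ)) :
    (arrangementVertices H).Finite := by
  classical
  refine Set.Finite.of_finite_image (f := fun v => H.filter fun h => ⟪h.1, v⟫ = h.2)
    ((Finset.finite_toSet H.powerset).subset ?_) ?_
  · rintro _ ⟨v, -, rfl⟩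
    exact Finset.mem_coe.2 (Finset.mem_powerset.2 (Finset.filter_subset _ _))
  · intro v _ w hw hvw
    refine hw v fun h hh hhw => ?_
    have : h ∈ H.filter fun h => ⟪h.1, w⟫ = h.2 := Finset.mem_filter.2 ⟨hh, hhw⟩
    simp only at hvw
    rw [← hvw] at this
    exact (Finset.mem_filter.1 this).2

theorem convex_openChamber (H : Finset (Space d × ℝ)) (x : Space d) :
    Convex ℝ (openChamber H x) := by
  intro y hy z hz a b ha hb hab h hh
  have h1 : ⟪h.1, a • y + b • z⟫ - h.2 = a * (⟪h.1, y⟫ - h.2) + b * (⟪h.1, z⟫ - h.2) := by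
    rw [inner_add_right, real_inner_smul_right, real_inner_smul_right]
    linear_combination h.2 * hab
  have h2 := hy h hh
  have h3 := hz h hh
  rw [h1]
  rcases ha.eq_or_lt with rfl | ha
  · have : b = 1 := by linarith
    subst this; simpa using h3
  · nlinarith [mul_pos ha h2, mul_nonneg hb h3.le]

theorem convex_chamber (H : Finset (Space d × ℝ)) (x : Space d) : Convex ℝ (chamber H x) := by
  intro y hy z hz a b ha hb hab h hh
  have h1 : ⟪h.1, a • y + b • z⟫ - h.2 = a * (⟪h.1, y⟫ - h.2) + b * (⟪h.1, z⟫ - h.2) := by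
    rw [inner_add_right, real_inner_smul_right, real_inner_smul_right]
    linear_combination h.2 * hab
  have h2 := hy h hh
  have h3 := hz h hh
  rw [h1]
  nlinarith [mul_nonneg ha h2, mul_nonneg hb h3]

theorem isClosed_chamber (H : Finset (Space d × ℝ)) (x : Space d) : IsClosed (chamber H x) := by
  have : chamber H x = ⋂ h ∈ H, {y | 0 ≤ (⟪h.1, x⟫ - h.2) * (⟪h.1, y⟫ - h.2)} := by
    ext y; simp [chamber]
  rw [this]
  exact isClosed_biInter fun h _ => isClosed_le continuous_const (by fun_prop)

theorem mem_openChamber_self {H : Finset (Space d × ℝ)} {x : Space d}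
    (hx : ∀ h ∈ H, ⟪h.1, x⟫ ≠ h.2) : x ∈ openChamber H x := fun h hh =>
  mul_self_pos.2 (sub_ne_zero.2 (hx h hh))

/-- The open chamber is convex, hence connected, it meets Ω at x, and it misses the hyperplanes and
so the boundary. -/
theorem openChamber_subset {Ω : Set (Space d)} (hΩ : IsOpen Ω) {H : Finset (Space d × ℝ)}
    (hH : ∀ x ∈ frontier Ω, ∃ h ∈ H, ⟪h.1, x⟫ = h.2) {x : Space d} (hxΩ : x ∈ Ω)
    (hx : ∀ h ∈ H, ⟪h.1, x⟫ ≠ h.2) : openChamber H x ⊆ Ω := by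
  refine (convex_openChamber H x).isPreconnected.subset_left_of_subset_union hΩ
    isClosed_closure.isOpen_compl
    (Set.disjoint_left.2 fun y hy hc => hc (subset_closure hy)) ?_ ⟨x, mem_openChamber_self hx, hxΩ⟩
  intro y hy
  by_contra hc
  simp only [Set.mem_union, Set.mem_compl_iff, not_or, not_not] at hc
  obtain ⟨h, hh, he⟩ := hH y (by rw [hΩ.frontier_eq]; exact ⟨hc.2, hc.1⟩)
  have := hy h hh
  rw [he, sub_self, mul_zero] at this
  exact lt_irrefl _ this

theorem chamber_subset_closure {H : Finset (Space d × ℝ)} {x : Space d}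
    (hx : ∀ h ∈ H, ⟪h.1, x⟫ ≠ h.2) : chamber H x ⊆ closure (openChamber H x) := by
  intro y hy
  have h1 : openSegment ℝ x y ⊆ openChamber H x := by
    rintro _ ⟨a, b, ha, hb, hab, rfl⟩ h hh
    have h1 : ⟪h.1, a • x + b • y⟫ - h.2 = a * (⟪h.1, x⟫ - h.2) + b * (⟪h.1, y⟫ - h.2) := by
      rw [inner_add_right, real_inner_smul_right, real_inner_smul_right]
      linear_combination h.2 * hab
    rw [h1]
    have h2 := mem_openChamber_self hx h hh
    nlinarith [mul_pos ha h2, mul_nonneg hb.le (hy h hh)]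
  exact closure_mono h1 (by rw [closure_openSegment]; exact right_mem_segment ℝ x y)

/-- A nonconstant affine function of one sign on an open set has no zero there: a small step along
the normal would reverse the sign. -/
theorem subset_openChamber {H : Finset (Space d × ℝ)} (hH : ∀ h ∈ H, h.1 ≠ 0) {x : Space d}
    (hx : ∀ h ∈ H, ⟪h.1, x⟫ ≠ h.2) {U : Set (Space d)} (hU : IsOpen U) (hUx : U ⊆ chamber H x) :
    U ⊆ openChamber H x := by
  intro y hy h hh
  refine lt_of_le_of_ne (hUx hy h hh) fun h0 => ?_
  have ha := sub_ne_zero.2 (hx h hh)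
  have hy0 : ⟪h.1, y⟫ - h.2 = 0 := (mul_eq_zero.1 h0.symm).resolve_left ha
  have h1 : Tendsto (fun t : ℝ => y + t • ((-(⟪h.1, x⟫ - h.2)) • h.1)) (𝓝[>] 0) (𝓝 y) := by
    have : Continuous fun t : ℝ => y + t • ((-(⟪h.1, x⟫ - h.2)) • h.1) := by fun_prop
    exact (by simpa using this.tendsto 0 :
      Tendsto (fun t : ℝ => y + t • ((-(⟪h.1, x⟫ - h.2)) • h.1)) (𝓝 0) (𝓝 y)).mono_left
        nhdsWithin_le_nhds
  obtain ⟨t, htU, ht⟩ := ((h1.eventually (hU.mem_nhds hy)).and self_mem_nhdsWithin).exists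
  have h2 := hUx htU h hh
  rw [inner_add_right, real_inner_smul_right, real_inner_smul_right,
    real_inner_self_eq_norm_sq] at h2
  have h3 : 0 < t * ((⟪h.1, x⟫ - h.2) ^ 2 * ‖h.1‖ ^ 2) :=
    mul_pos ht (mul_pos (by positivity) (by have := norm_pos_iff.2 (hH h hh); positivity))
  have h4 : (⟪h.1, x⟫ - h.2) * (⟪h.1, y⟫ + t * (-(⟪h.1, x⟫ - h.2) * ‖h.1‖ ^ 2) - h.2) =
      (⟪h.1, x⟫ - h.2) * (⟪h.1, y⟫ - h.2) - t * ((⟪h.1, x⟫ - h.2) ^ 2 * ‖h.1‖ ^ 2) := by ring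
  rw [h4, hy0] at h2
  linarith

/-- If the active hyperplanes shared a second point y, small moves along ±(y - v) would preserve the
active constraints and, by continuity, the inactive ones, so v would be the midpoint of a segment in
the chamber. -/
theorem extremePoints_chamber_subset {H : Finset (Space d × ℝ)} {x : Space d}
    (hx : ∀ h ∈ H, ⟪h.1, x⟫ ≠ h.2) :
    (chamber H x).extremePoints ℝ ⊆ arrangementVertices H := by
  intro v hv y hy
  by_contra hne
  have key : ∀ u : Space d, (∀ h ∈ H, ⟪h.1, v⟫ = h.2 → ⟪h.1, u⟫ = 0) →
      ∀ᶠ t : ℝ in 𝓝[>] 0, v + t • u ∈ chamber H x := by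
    intro u hu
    refine (Filter.eventually_all_finset H).2 fun h hh => ?_
    by_cases hact : ⟪h.1, v⟫ = h.2
    · refine Eventually.of_forall fun t => ?_
      rw [inner_add_right, real_inner_smul_right, hu h hh hact, hact]; simp
    · have h0 : 0 < (⟪h.1, x⟫ - h.2) * (⟪h.1, v⟫ - h.2) :=
        lt_of_le_of_ne (hv.1 h hh)
          (mul_ne_zero (sub_ne_zero.2 (hx h hh)) (sub_ne_zero.2 hact)).symm
      have hc : Continuous fun t : ℝ => (⟪h.1, x⟫ - h.2) * (⟪h.1, v + t • u⟫ - h.2) := by fun_prop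
      have := hc.tendsto 0
      simp only [zero_smul, add_zero] at this
      exact ((this.eventually (lt_mem_nhds h0)).filter_mono nhdsWithin_le_nhds).mono
        fun t ht => le_of_lt ht
  have hu : ∀ h ∈ H, ⟪h.1, v⟫ = h.2 → ⟪h.1, y - v⟫ = 0 := fun h hh ha => by
    rw [inner_sub_right, hy h hh ha, ha, sub_self]
  obtain ⟨t, ⟨ht1, ht2⟩, ht⟩ := (((key _ hu).and (key (-(y - v)) fun h hh ha => by
    rw [inner_neg_right, hu h hh ha, neg_zero])).and self_mem_nhdsWithin).exists
  have hseg : v ∈ openSegment ℝ (v + t • (y - v)) (v + t • -(y - v)) :=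
    ⟨1 / 2, 1 / 2, by norm_num, by norm_num, by norm_num, by module⟩
  have h1 := hv.2 ht1 ht2 hseg
  have h2 : t • (y - v) = 0 := by simpa using h1
  rcases smul_eq_zero.1 h2 with h3 | h3
  · exact absurd h3 (ne_of_gt ht)
  · exact hne (sub_eq_zero.1 h3)

/-- Boundedness of Ω makes the chamber compact, and Krein–Milman applies. There are finitely many
extreme points, so their hull is already closed. -/
theorem mem_convexHull_arrangementVertices {Ω : Set (Space d)} (hΩ : IsOpen Ω)
    (hb : Bornology.IsBounded Ω) {H : Finset (Space d × ℝ)}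
    (hH : ∀ x ∈ frontier Ω, ∃ h ∈ H, ⟪h.1, x⟫ = h.2) {x : Space d} (hxΩ : x ∈ Ω)
    (hx : ∀ h ∈ H, ⟪h.1, x⟫ ≠ h.2) :
    x ∈ convexHull ℝ (arrangementVertices H ∩ chamber H x) := by
  have hc : IsCompact (chamber H x) := Metric.isCompact_of_isClosed_isBounded
    (isClosed_chamber H x) (hb.closure.subset ((chamber_subset_closure hx).trans
      (closure_mono (openChamber_subset hΩ hH hxΩ hx))))
  have h1 := closure_convexHull_extremePoints hc (convex_chamber H x)
  have hfin : (Set.extremePoints ℝ (chamber H x)).Finite :=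
    (finite_arrangementVertices H).subset (extremePoints_chamber_subset hx)
  rw [(hfin.isClosed_convexHull ℝ).closure_eq] at h1
  have h2 : x ∈ chamber H x := fun h hh => (mem_openChamber_self hx h hh).le
  rw [← h1] at h2
  have h3 : Set.extremePoints ℝ (chamber H x) ⊆ arrangementVertices H ∩ chamber H x :=
    fun v hv => ⟨extremePoints_chamber_subset hx hv, hv.1⟩
  exact convexHull_mono h3 h2

theorem convex_par (A : (Fin d → ℝ) ≃L[ℝ] Space d) (b : Space d) : Convex ℝ (par A b) := by
  have h1 : Convex ℝ (halfCube d) := convex_pi fun i _ => convex_Ioo _ _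
  have h2 : par A b = (fun z => b + z) '' ((A : (Fin d → ℝ) →ₗ[ℝ] Space d) '' halfCube d) := by
    rw [Set.image_image]; rfl
  rw [h2]
  exact (h1.linear_image _).translate b

theorem mem_closure_par {A : (Fin d → ℝ) ≃L[ℝ] Space d} {b : Space d} {y : Fin d → ℝ}
    (hy : ∀ i, y i ∈ Set.Icc (0 : ℝ) (1 / 2)) : b + A y ∈ closure (par A b) := by
  rw [par, ← Homeomorph.image_closure]
  refine ⟨y, ?_, rfl⟩
  rw [halfCube, closure_pi_set]
  intro i _
  rw [closure_Ioo (by norm_num)]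
  exact hy i

/-- A cell of the grid of mesh `1 / N` spanned by the edges `v i - z`. -/
def gridCell (N : ℕ) (z : Space d) (v : Fin d → Space d) (j : Fin d → ℕ) : Set (Space d) :=
  {p | ∃ t : Fin d → ℝ, (∀ i, t i ∈ Set.Ioo (0 : ℝ) (1 / 2)) ∧
    p = z + ∑ i, ((j i + 2 * t i) / N) • (v i - z)}

theorem exists_par_eq_gridCell {N : ℕ} (hN : N ≠ 0) {z : Space d} {v : Fin d → Space d}
    (hv : LinearIndependent ℝ fun i => v i - z) (j : Fin d → ℕ) :
    ∃ A b, gridCell N z v j = par A b ∧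
      ∀ y, b + A y = z + ∑ i, ((j i + 2 * y i) / N) • (v i - z) := by
  have hN' : (2 / N : ℝ) ≠ 0 := by positivity
  let B := basisOfLinearIndependentOfCardEqFinrank' (fun i => v i - z) hv (by simp)
  let A : (Fin d → ℝ) ≃L[ℝ] Space d :=
    ((LinearEquiv.smulOfNeZero ℝ (Fin d → ℝ) _ hN').trans B.equivFun.symm).toContinuousLinearEquiv
  have hA : ∀ y, A y = ∑ i, (2 / N * y i) • (v i - z) := by
    intro y
    simp [A, B, Module.Basis.equivFun_symm_apply, Finset.smul_sum, smul_smul]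
  have h : ∀ y : Fin d → ℝ, (z + ∑ i, ((j i : ℝ) / N) • (v i - z)) + A y =
      z + ∑ i, ((j i + 2 * y i) / N) • (v i - z) := by
    intro y
    rw [hA, add_assoc, ← Finset.sum_add_distrib]
    congr 1
    refine Finset.sum_congr rfl fun i _ => ?_
    rw [← add_smul]; congr 1; ring
  refine ⟨A, _, ?_, h⟩
  ext p
  simp only [gridCell, par, Set.mem_ofPred_eq, Set.mem_image, parMap_apply, h, halfCube,
    Set.mem_univ_pi]
  exact ⟨fun ⟨t, h1, h2⟩ => ⟨t, h1, h2.symm⟩, fun ⟨t, h1, h2⟩ => ⟨t, h1, h2.symm⟩⟩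

theorem add_sum_mem_chamber {H : Finset (Space d × ℝ)} {x z : Space d} {v : Fin d → Space d}
    (hz : z ∈ chamber H x) (hv : ∀ i, v i ∈ chamber H x) {c : Fin d → ℝ} (hc : ∀ i, 0 ≤ c i)
    (hc1 : ∑ i, c i ≤ 1) : z + ∑ i, c i • (v i - z) ∈ chamber H x := by
  intro h hh
  have h1 : ⟪h.1, z + ∑ i, c i • (v i - z)⟫ - h.2 =
      (1 - ∑ i, c i) * (⟪h.1, z⟫ - h.2) + ∑ i, c i * (⟪h.1, v i⟫ - h.2) := by
    simp only [inner_add_right, inner_sum, real_inner_smul_right, inner_sub_right, mul_sub,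
      Finset.sum_sub_distrib, ← Finset.sum_mul]
    ring
  rw [h1, mul_add, Finset.mul_sum]
  refine add_nonneg ?_ (Finset.sum_nonneg fun i _ => ?_)
  · have := mul_nonneg (sub_nonneg.2 hc1) (hz h hh); linarith
  · have := mul_nonneg (hc i) (hv i h hh); linarith

/-- By Carathéodory x has positive weights in an affinely independent family of s, and `hspan`
forces this to be a full simplex. Cutting along the edges issuing from one vertex with mesh
1/(d(d+1)), rounding the weights down yields a closed cell that contains x and stays in the simplex.
-/
theorem exists_gridCell {s : Set (Space d)} {x : Space d} (hd : d ≠ 0)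
    (hx : x ∈ convexHull ℝ s) (hspan : ∀ t : Finset (Space d), (t : Set (Space d)) ⊆ s →
      x ∈ affineSpan ℝ (t : Set (Space d)) → affineSpan ℝ (t : Set (Space d)) = ⊤) :
    ∃ z ∈ s, ∃ v : Fin d → Space d, (∀ i, v i ∈ s) ∧ LinearIndependent ℝ (fun i => v i - z) ∧
      ∃ j : Fin d → ℕ, (∀ i, j i ≤ d * (d + 1)) ∧ ∑ i, ((j i : ℝ) + 1) ≤ d * (d + 1) ∧
      ∃ y : Fin d → ℝ, (∀ i, y i ∈ Set.Icc (0 : ℝ) (1 / 2)) ∧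
        x = z + ∑ i, ((j i + 2 * y i) / (d * (d + 1) : ℕ)) • (v i - z) := by
  classical
  obtain ⟨ι, _, p, w, hps, hp, hw, hw1, hsum⟩ := eq_pos_convex_span_of_mem_convexHull hx
  have hxspan : x ∈ affineSpan ℝ (Set.range p) := by
    rw [← hsum]
    have := affineCombination_mem_affineSpan (k := ℝ) (s := Finset.univ) (w := w) hw1 p
    rwa [Finset.affineCombination_eq_linear_combination _ _ _ hw1] at this
  have htop := hspan (Finset.univ.image p) (by simpa using hps) (by simpa using hxspan)
  have hcard : Fintype.card ι = d + 1 := by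
    have := (hp.affineSpan_eq_top_iff_card_eq_finrank_add_one (k := ℝ)).1 (by simpa using htop)
    simpa using this
  have hne : (Finset.univ : Finset ι).Nonempty := by
    rw [Finset.univ_nonempty_iff, ← Fintype.card_pos_iff]; omega
  obtain ⟨i0, -, hi0⟩ := Finset.exists_max_image Finset.univ w hne
  -- The base vertex carries the largest weight, at least 1/(d+1), so the other weights sum to at
  -- most d/(d+1). Multiplied by d(d+1) this is at most d², which leaves room for one extra unit in
  -- each of the d directions.
  have hi0w : 1 ≤ (d + 1) * w i0 := by
    have := Finset.sum_le_sum hi0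
    rw [hw1] at this
    simpa [hcard] using this
  have hcard' : Fintype.card {i // i ≠ i0} = Fintype.card (Fin d) := by
    simp [Fintype.card_subtype_compl, hcard]
  let e : Fin d ≃ {i // i ≠ i0} := (Fintype.equivOfCardEq hcard').symm
  have hsplit : ∀ f : ι → ℝ, ∑ i, f i = f i0 + ∑ i : Fin d, f (e i) := fun f => by
    rw [e.sum_comp fun i : {i // i ≠ i0} => f i, ← Finset.add_sum_erase _ _ (Finset.mem_univ i0)]
    congr 1
    exact (Finset.sum_subtype _ (by simp) _)
  have hsplit' : ∀ f : ι → Space d, ∑ i, f i = f i0 + ∑ i : Fin d, f (e i) := fun f => by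
    rw [e.sum_comp fun i : {i // i ≠ i0} => f i, ← Finset.add_sum_erase _ _ (Finset.mem_univ i0)]
    congr 1
    exact (Finset.sum_subtype _ (by simp) _)
  have hli := ((affineIndependent_iff_linearIndependent_vsub ℝ p i0).1 hp).comp e e.injective
  have hw1' := hsplit w
  rw [hw1] at hw1'
  have hwle : ∀ i : Fin d, w (e i) ≤ 1 := fun i => by
    have := Finset.single_le_sum (f := w) (fun i _ => (hw i).le) (Finset.mem_univ (e i : ι))
    rwa [hw1] at this
  have hd0 : (0 : ℝ) < d := by positivity
  have hN : (0 : ℝ) < (d * (d + 1) : ℕ) := by push_cast; positivity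
  have hfl : ∀ i : Fin d, (⌊((d * (d + 1) : ℕ) : ℝ) * w (e i)⌋₊ : ℝ) ≤ (d * (d + 1) : ℕ) * w (e i) :=
    fun i => Nat.floor_le (mul_nonneg hN.le (hw _).le)
  refine ⟨p i0, hps ⟨_, rfl⟩, fun i => p (e i), fun i => hps ⟨_, rfl⟩, hli,
    fun i => ⌊((d * (d + 1) : ℕ) : ℝ) * w (e i)⌋₊, fun i => ?_, ?_,
    fun i => (((d * (d + 1) : ℕ) : ℝ) * w (e i) - ⌊((d * (d + 1) : ℕ) : ℝ) * w (e i)⌋₊) / 2,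
    fun i => ⟨?_, ?_⟩, ?_⟩
  · refine Nat.floor_le_of_le ?_
    nlinarith [hwle i]
  · rw [Finset.sum_add_distrib]
    have h1 := Finset.sum_le_sum fun i (_ : i ∈ (Finset.univ : Finset (Fin d))) => hfl i
    rw [← Finset.mul_sum] at h1
    simp only [Finset.sum_const, Finset.card_univ, Fintype.card_fin, nsmul_eq_mul, mul_one]
    have h2 : ∑ i : Fin d, w (e i) = 1 - w i0 := by linarith
    rw [h2] at h1
    push_cast at h1 ⊢
    nlinarith
  · linarith [hfl i]
  · linarith [Nat.lt_floor_add_one (((d * (d + 1) : ℕ) : ℝ) * w (e i))]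
  · have h1 : ∀ i : Fin d, ((⌊((d * (d + 1) : ℕ) : ℝ) * w (e i)⌋₊ : ℝ) +
        2 * ((((d * (d + 1) : ℕ) : ℝ) * w (e i) - ⌊((d * (d + 1) : ℕ) : ℝ) * w (e i)⌋₊) / 2)) /
        (d * (d + 1) : ℕ) = w (e i) := fun i => by
      rw [div_eq_iff hN.ne']; ring
    simp only [h1]
    rw [← hsum, hsplit']
    simp only [smul_sub, Finset.sum_sub_distrib, ← Finset.sum_smul]
    have h2 : w i0 = 1 - ∑ i : Fin d, w (e i) := by linarith
    rw [h2, sub_smul, one_smul]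
    abel

theorem volume_hyperplane {n : Space d} (hn : n ≠ 0) (c : ℝ) :
    volume {x : Space d | ⟪n, x⟫ = c} = 0 := by
  by_cases h : ∃ x0 : Space d, ⟪n, x0⟫ = c
  · obtain ⟨x0, h0⟩ := h
    have h1 : {x : Space d | ⟪n, x⟫ = c} =
        (AffineSubspace.mk' x0 (LinearMap.ker (innerₛₗ ℝ n)) : Set (Space d)) := by
      ext x
      simp only [Set.mem_ofPred_eq, SetLike.mem_coe, AffineSubspace.mem_mk', LinearMap.mem_ker,
        innerₛₗ_apply_apply, vsub_eq_sub, inner_sub_right, h0, sub_eq_zero]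
    rw [h1]
    refine Measure.addHaar_affineSubspace _ _ fun htop => hn ?_
    have : x0 + n ∈ AffineSubspace.mk' x0 (LinearMap.ker (innerₛₗ ℝ n)) := by
      rw [htop]; trivial
    simpa [AffineSubspace.mem_mk'] using this
  · have : {x : Space d | ⟪n, x⟫ = c} = ∅ := by
      ext x; simpa using fun hx => h ⟨x, hx⟩
    rw [this, measure_empty]

/-- A bounded polyhedral domain is covered, up to a null set, by finitely many parallelepipeds
contained in it. -/
theorem IsPolyhedralDomain.exists_cover {Ω : Opens (Space d)} (hΩ : IsPolyhedralDomain Ω)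
    (hd : d ≠ 0) : ∃ 𝓕 : Set (Set (Space d)), 𝓕.Finite ∧
      (∀ P ∈ 𝓕, (∃ A b, P = par A b) ∧ P ⊆ Ω) ∧
      ∀ᵐ x, x ∈ Ω → ∃ P ∈ 𝓕, x ∈ P := by
  classical
  obtain ⟨H, hH0, hH⟩ := hΩ.exists_hyperplanes
  set 𝓥 := arrangementVertices H with h𝓥
  have hfin : 𝓥.Finite := finite_arrangementVertices H
  let N := d * (d + 1)
  have hN : N ≠ 0 := by positivity
  let 𝓖 : Set (Set (Space d)) := {P | ∃ z ∈ 𝓥, ∃ v : Fin d → Space d, (∀ i, v i ∈ 𝓥) ∧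
    ∃ j : Fin d → ℕ, (∀ i, j i ≤ N) ∧ P = gridCell N z v j}
  have h𝓖 : 𝓖.Finite := by
    have h1 : (𝓥 ×ˢ ((Set.univ.pi fun _ : Fin d => 𝓥) ×ˢ
        (Set.univ.pi fun _ : Fin d => Set.Iic N))).Finite :=
      hfin.prod ((Set.Finite.pi' fun _ => hfin).subset (by intro v hv i; exact hv i trivial) |>.prod
        ((Set.Finite.pi' fun _ => Set.finite_Iic N).subset (by intro v hv i; exact hv i trivial)))
    refine (h1.image fun q => gridCell N q.1 q.2.1 q.2.2).subset ?_
    rintro P ⟨z, hz, v, hv, j, hj, rfl⟩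
    exact ⟨(z, v, j), ⟨hz, fun i _ => hv i, fun i _ => hj i⟩, rfl⟩
  refine ⟨{P ∈ 𝓖 | (∃ A b, P = par A b) ∧ P ⊆ Ω}, h𝓖.subset fun P hP => hP.1,
    fun P hP => hP.2, ?_⟩
  -- Three null sets are discarded: the hyperplanes, the proper affine subspaces spanned by
  -- vertices, and the frontiers of the cells.
  have n1 : ∀ᵐ x : Space d, ∀ h ∈ H, ⟪h.1, x⟫ ≠ h.2 :=
    (Filter.eventually_all_finset H).2 fun h hh => by
      rw [ae_iff]; simpa using volume_hyperplane (hH0 h hh) h.2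
  have n2 : ∀ᵐ x : Space d, ∀ t ∈ hfin.toFinset.powerset,
      x ∈ affineSpan ℝ (t : Set (Space d)) → affineSpan ℝ (t : Set (Space d)) = ⊤ :=
    (Filter.eventually_all_finset _).2 fun t _ => by
      by_cases ht : affineSpan ℝ (t : Set (Space d)) = ⊤
      · exact Eventually.of_forall fun x _ => ht
      · rw [ae_iff]
        simpa [ht] using Measure.addHaar_affineSubspace volume _ ht
  have n3 : ∀ᵐ x : Space d, ∀ P ∈ h𝓖.toFinset, (∃ A b, P = par A b) → x ∉ frontier P :=
    (Filter.eventually_all_finset _).2 fun P _ => by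
      by_cases hP : ∃ A b, P = par A b
      · obtain ⟨A, b, rfl⟩ := hP
        rw [ae_iff]
        exact measure_mono_null (fun x hx => by simpa using hx)
          ((convex_par A b).addHaar_frontier volume)
      · exact Eventually.of_forall fun x h => absurd h hP
  filter_upwards [n1, n2, n3] with x h1 h2 h3 hxΩ
  have hhull := mem_convexHull_arrangementVertices Ω.isOpen hΩ.isBounded hH hxΩ h1
  obtain ⟨z, hz, v, hv, hli, j, hjN, hj, y, hy, hxy⟩ := exists_gridCell hd hhull fun t ht =>
    h2 t (by
      rw [Finset.mem_powerset]
      intro a ha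
      exact hfin.mem_toFinset.2 (ht ha).1)
  obtain ⟨A, b, hP, hAb⟩ := exists_par_eq_gridCell hN hli j
  have hmem : gridCell N z v j ∈ 𝓖 := ⟨z, hz.1, v, fun i => (hv i).1, j, hjN, rfl⟩
  have hN0 : (0 : ℝ) < N := by positivity
  -- Even the far corner of the cell has edge coordinates of sum at most one, so the cell lies in a
  -- simplex with vertices in the chamber.
  have hsub : gridCell N z v j ⊆ chamber H x := by
    rintro p ⟨t, ht, rfl⟩
    refine add_sum_mem_chamber hz.2 (fun i => (hv i).2) (fun i => ?_) ?_
    · have := (ht i).1; positivity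
    · rw [← Finset.sum_div, div_le_one hN0]
      refine (Finset.sum_le_sum fun i _ => ?_).trans (hj.trans (by simp [N]))
      linarith [(ht i).2]
  have hopen : IsOpen (gridCell N z v j) := hP ▸ isOpen_par A b
  refine ⟨_, ⟨hmem, ⟨A, b, hP⟩, ((subset_openChamber hH0 h1 hopen hsub).trans
    (openChamber_subset Ω.isOpen hH hxΩ h1))⟩, ?_⟩
  have hcl : x ∈ closure (gridCell N z v j) := by
    rw [hP, hxy, ← hAb]; exact mem_closure_par hy
  by_contra hnot
  refine h3 _ (h𝓖.mem_toFinset.2 hmem) ⟨A, b, hP⟩ ?_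
  rw [hopen.frontier_eq]
  exact ⟨hcl, hnot⟩

end StokesTCoercivity
end

noncomputable section

namespace StokesTCoercivity

open scoped ENNReal NNReal ContDiff Topology
open Filter

variable {d : ℕ}

/-! ### Surjectivity of the divergence -/

/-- Every square integrable function of zero mean value which vanishes off `D` is a divergence. -/
def DivSolvable (Ω : Opens (Space d)) (D : Set (Space d)) : Prop :=
  ∀ q : L2 Ω, q =ᵐ[volume.restrict (Ω : Set (Space d))] D.indicator q → ∫ x in Ω, q x = 0 →
    ∃ w : Velocity Ω, divL Ω w = q

/-- The part of q on D is corrected to mean zero by a constant on D ∩ D', a set of positive measure.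
The remainder vanishes off D' and also has mean zero, so the two problems are solved separately and
added. -/
theorem DivSolvable.union {Ω : Opens (Space d)}
    [IsFiniteMeasure (volume.restrict (Ω : Set (Space d)))] {D D' : Set (Space d)}
    (hD : IsOpen D) (hD' : IsOpen D') (hDΩ : D ⊆ Ω) (hne : (D ∩ D').Nonempty)
    (h : DivSolvable Ω D) (h' : DivSolvable Ω D') : DivSolvable Ω (D ∪ D') := by
  intro q hq hq0
  set μ := volume.restrict (Ω : Set (Space d)) with hμ
  have hB : MeasurableSet (D ∩ D') := (hD.inter hD').measurableSet
  have hBpos : μ (D ∩ D') ≠ 0 := by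
    rw [hμ, Measure.restrict_apply hB, Set.inter_eq_left.2 (Set.inter_subset_left.trans hDΩ)]
    exact ((hD.inter hD').measure_pos volume hne).ne'
  have hBreal : μ.real (D ∩ D') ≠ 0 := by
    rw [measureReal_def]; exact ENNReal.toReal_ne_zero.2 ⟨hBpos, measure_ne_top _ _⟩
  have hqm : MemLp (D.indicator q) 2 μ := (Lp.memLp q).indicator hD.measurableSet
  set m := ∫ x, D.indicator q x ∂μ with hm
  set c := m / μ.real (D ∩ D') with hc
  have hcm : MemLp ((D ∩ D').indicator fun _ => c) 2 μ :=
    memLp_indicator_const 2 hB c (Or.inr (measure_ne_top _ _))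
  have hsub := hqm.sub hcm
  set q1 : L2 Ω := hsub.toLp _ with hq1
  have e1 : q1 =ᵐ[μ] D.indicator q - (D ∩ D').indicator fun _ => c := hsub.coeFn_toLp
  have i1 : ∫ x, q1 x ∂μ = 0 := by
    rw [integral_congr_ae e1]
    simp only [Pi.sub_apply]
    rw [integral_sub (hqm.integrable (by norm_num)) (hcm.integrable (by norm_num)),
      integral_indicator_const _ hB, ← hm, hc, smul_eq_mul, mul_div_cancel₀ _ hBreal, sub_self]
  obtain ⟨w1, hw1⟩ := h q1 (by
    filter_upwards [e1] with x hx
    by_cases hxD : x ∈ D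
    · rw [Set.indicator_of_mem hxD]
    · rw [Set.indicator_of_notMem hxD, hx]
      simp [hxD]) i1
  have e2 := Lp.coeFn_sub q q1
  obtain ⟨w2, hw2⟩ := h' (q - q1) (by
    filter_upwards [e1, e2, hq] with x hx1 hx2 hx
    by_cases hxD' : x ∈ D'
    · rw [Set.indicator_of_mem hxD']
    · rw [Set.indicator_of_notMem hxD', hx2, Pi.sub_apply, hx1]
      by_cases hxD : x ∈ D
      · simp [hxD, hxD']
      · rw [hx]; simp [hxD, hxD']) (by
    rw [integral_congr_ae e2]
    simp only [Pi.sub_apply]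
    rw [integral_sub ((Lp.memLp q).integrable (by norm_num))
      ((Lp.memLp q1).integrable (by norm_num)), hq0, i1, sub_zero])
  exact ⟨w1 + w2, by rw [map_add, hw1, hw2, add_sub_cancel]⟩

theorem divSolvable_par {Ω : Opens (Space d)} {A : (Fin d → ℝ) ≃L[ℝ] Space d} {b : Space d}
    (h : par A b ⊆ Ω) : DivSolvable Ω (par A b) := fun _ hq hq0 =>
  exists_divL_eq_of_par Ω h hq hq0

theorem exists_par_mem {Ω : Opens (Space d)} {x : Space d} (hx : x ∈ Ω) :
    ∃ (A : (Fin d → ℝ) ≃L[ℝ] Space d) (b : Space d), x ∈ par A b ∧ par A b ⊆ Ω := by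
  obtain ⟨ε, hε, hball⟩ := Metric.isOpen_iff.1 Ω.isOpen x hx
  let L : (Fin d → ℝ) ≃L[ℝ] Space d := (EuclideanSpace.equiv (Fin d) ℝ).symm
  let y0 : Fin d → ℝ := fun _ => 1 / 4
  have hK : IsCompact (Set.Icc (0 : Fin d → ℝ) fun _ => 1 / 2) := isCompact_Icc
  obtain ⟨C, hC⟩ := hK.exists_bound_of_continuousOn (f := fun y => L (y - y0))
    (by fun_prop)
  have hC0 : 0 ≤ C := (norm_nonneg _).trans (hC 0 ⟨le_rfl, fun _ => by norm_num⟩)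
  have hr : ε / (C + 1) ≠ 0 := by positivity
  let A : (Fin d → ℝ) ≃L[ℝ] Space d := L.trans (ContinuousLinearEquiv.smulLeft (Units.mk0 _ hr))
  have hA : ∀ y, A y = (ε / (C + 1)) • L y := fun y => rfl
  refine ⟨A, x - A y0, ⟨y0, fun i _ => ⟨by norm_num [y0], by norm_num [y0]⟩, ?_⟩, ?_⟩
  · rw [parMap_apply]; abel
  · rintro _ ⟨y, hy, rfl⟩
    refine hball ?_
    rw [parMap_apply, Metric.mem_ball, dist_eq_norm]
    have h1 : x - A y0 + A y - x = (ε / (C + 1)) • L (y - y0) := by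
      rw [hA, hA, map_sub, smul_sub]; abel
    have h2 := hC y ⟨fun i => (hy i trivial).1.le, fun i => (hy i trivial).2.le⟩
    rw [h1, norm_smul, Real.norm_of_nonneg (by positivity), div_mul_eq_mul_div,
      div_lt_iff₀ (by positivity)]
    nlinarith

/-- The divergence maps `𝐇¹₀(Ω)` onto the square integrable functions of zero mean value. -/
theorem IsPolyhedralDomain.exists_divL_eq {Ω : Opens (Space d)} (hΩ : IsPolyhedralDomain Ω)
    (hd : d ≠ 0) {q : L2 Ω} (hq0 : ∫ x in Ω, q x = 0) : ∃ w : Velocity Ω, divL Ω w = q := by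
  have hfm : IsFiniteMeasure (volume.restrict (Ω : Set (Space d))) :=
    isFiniteMeasure_restrict.2 hΩ.isBounded.measure_lt_top.ne
  let 𝓓 : Set (Set (Space d)) := {D | IsOpen D ∧ D ⊆ Ω ∧ DivSolvable Ω D}
  have hpar : ∀ A b, par A b ⊆ Ω → par A b ∈ 𝓓 := fun A b h =>
    ⟨isOpen_par A b, h, divSolvable_par h⟩
  have hunion : ∀ D ∈ 𝓓, ∀ D' ∈ 𝓓, (D ∩ D').Nonempty → D ∪ D' ∈ 𝓓 := fun D hD D' hD' hne =>
    ⟨hD.1.union hD'.1, Set.union_subset hD.2.1 hD'.2.1,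
      hD.2.2.union hD.1 hD'.1 hD.2.1 hne hD'.2.2⟩
  -- Lying in a common solvable set holds for nearby points, by a small parallelepiped, and is
  -- transitive, by unions through the shared point. Connectedness extends it to all pairs.
  have hconn : ∀ x ∈ Ω, ∀ y ∈ Ω, ∃ D ∈ 𝓓, x ∈ D ∧ y ∈ D := by
    intro x hx y hy
    refine hΩ.isConnected.isPreconnected.induction₂' (fun x y => ∃ D ∈ 𝓓, x ∈ D ∧ y ∈ D)
      (fun x hx => ?_) (fun x y z _ _ _ ⟨D, hD, h1, h2⟩ ⟨D', hD', h3, h4⟩ => ?_) hx hy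
    · obtain ⟨A, b, hxP, hP⟩ := exists_par_mem hx
      filter_upwards [mem_nhdsWithin_of_mem_nhds ((isOpen_par A b).mem_nhds hxP)] with y hy
      exact ⟨⟨_, hpar A b hP, hxP, hy⟩, ⟨_, hpar A b hP, hy, hxP⟩⟩
    · exact ⟨_, hunion D hD D' hD' ⟨y, h2, h3⟩, Or.inl h1, Or.inr h4⟩
  obtain ⟨𝓕, hfin, h𝓕, hcov⟩ := hΩ.exists_cover hd
  have hbig : ∃ D ∈ 𝓓, ⋃₀ 𝓕 ⊆ D := by
    have h𝓕' : ∀ P ∈ 𝓕, P ∈ 𝓓 := fun P hP => by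
      obtain ⟨⟨A, b, rfl⟩, h⟩ := h𝓕 P hP
      exact hpar A b h
    clear hcov h𝓕
    induction 𝓕, hfin using Set.Finite.induction_on with
    | empty =>
      obtain ⟨x, hx⟩ := hΩ.isConnected.nonempty
      obtain ⟨D, hD, -⟩ := hconn x hx x hx
      exact ⟨D, hD, by simp⟩
    | @insert P s _ _ ih =>
      obtain ⟨D, hD, hsD⟩ := ih fun P hP => h𝓕' P (Set.mem_insert_of_mem _ hP)
      have hP := h𝓕' P (Set.mem_insert _ _)
      rw [Set.sUnion_insert]
      rcases P.eq_empty_or_nonempty with rfl | ⟨y, hy⟩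
      · exact ⟨D, hD, by simpa using hsD⟩
      rcases D.eq_empty_or_nonempty with rfl | ⟨x, hx⟩
      · exact ⟨P, hP, Set.union_subset subset_rfl (hsD.trans (Set.empty_subset _))⟩
      -- D' is a bridge between the set built so far and the next cell, which need not overlap.
      obtain ⟨D', hD', hxD', hyD'⟩ := hconn x (hD.2.1 hx) y (hP.2.1 hy)
      refine ⟨_, hunion _ (hunion D hD D' hD' ⟨x, hx, hxD'⟩) P hP ⟨y, Or.inr hyD', hy⟩, ?_⟩
      exact Set.union_subset Set.subset_union_right
        (hsD.trans (Set.subset_union_left.trans Set.subset_union_left))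
  obtain ⟨D, hD, hFD⟩ := hbig
  refine hD.2.2 q ?_ hq0
  filter_upwards [ae_restrict_of_ae hcov, ae_restrict_mem Ω.isOpen.measurableSet] with x hx hxΩ
  obtain ⟨P, hP, hxP⟩ := hx hxΩ
  rw [Set.indicator_of_mem (hFD ⟨P, hP, hxP⟩)]

end StokesTCoercivity
end

noncomputable section

namespace StokesTCoercivity

open scoped ENNReal NNReal ContDiff Topology
open Filter

variable {d : ℕ}

/-! ### The Poincaré inequality -/

theorem integrable_fderiv_apply {f : Space d → ℝ} (hf : ContDiff ℝ 1 f)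
    (hc : HasCompactSupport f) (v : Space d) : Integrable fun x => fderiv ℝ f x v :=
  ((hf.continuous_fderiv one_ne_zero).clm_apply continuous_const).integrable_of_hasCompactSupport
    (hc.fderiv_apply (𝕜 := ℝ) v)

theorem integrable_sq_of_hasCompactSupport {f : Space d → ℝ} (hf : Continuous f)
    (hc : HasCompactSupport f) : Integrable fun x => f x ^ 2 :=
  (hf.memLp_of_hasCompactSupport (p := 2) hc).integrable_sq

theorem integral_fderiv_eq_zero {f : Space d → ℝ} (hf : ContDiff ℝ 1 f)
    (hc : HasCompactSupport f) (v : Space d) : ∫ x, fderiv ℝ f x v = 0 := by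
  have hint := integrable_fderiv_apply hf hc v
  have := integral_mul_fderiv_eq_neg_fderiv_mul_of_integrable (μ := volume) (v := v)
    (f := fun _ : Space d => (1 : ℝ)) (g := f) (by simp) (by simpa using hint)
    (by simpa using hf.continuous.integrable_of_hasCompactSupport hc)
    (fun x _ => differentiableAt_const _) (fun x _ => hf.differentiable one_ne_zero x)
  simpa using this

/-- The test functions already form a linear space, so any closed condition on H¹₀(Ω) need only be
checked on single smooth functions. -/
theorem exists_smooth_of_mem_span {Ω : Opens (Space d)} {p : L2Pair Ω}
    (hp : p ∈ Submodule.span ℝ {p : L2Pair Ω | ∃ φ : 𝓓(Ω, ℝ),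
      p.fst =ᵐ[volume.restrict (Ω : Set (Space d))] (fun x => φ x) ∧
      ∀ j : Fin d, p.snd j =ᵐ[volume.restrict (Ω : Set (Space d))]
        (fun x => fderiv ℝ φ x (EuclideanSpace.single j 1))}) :
    ∃ φ : Space d → ℝ, ContDiff ℝ ∞ φ ∧ HasCompactSupport φ ∧ tsupport φ ⊆ Ω ∧
      p.fst =ᵐ[volume.restrict (Ω : Set (Space d))] φ ∧
      ∀ j : Fin d, p.snd j =ᵐ[volume.restrict (Ω : Set (Space d))]
        (fun x => fderiv ℝ φ x (EuclideanSpace.single j 1)) := by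
  induction hp using Submodule.span_induction with
  | mem p hp =>
    obtain ⟨φ, h1, h2⟩ := hp
    exact ⟨φ, by simpa using φ.contDiff, φ.hasCompactSupport, φ.tsupport_subset, h1, h2⟩
  | zero =>
    refine ⟨0, contDiff_const, HasCompactSupport.zero, by simp, Lp.coeFn_zero .., fun j => ?_⟩
    simp only [fderiv_zero, Pi.zero_apply, zero_apply]
    exact Lp.coeFn_zero ..
  | add p q _ _ hp hq =>
    obtain ⟨φ, hφ, hφc, hφs, hp1, hp2⟩ := hp
    obtain ⟨ψ, hψ, hψc, hψs, hq1, hq2⟩ := hq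
    refine ⟨φ + ψ, hφ.add hψ, hφc.add hψc,
      (tsupport_add φ ψ).trans (Set.union_subset hφs hψs), ?_, fun j => ?_⟩
    · exact (Lp.coeFn_add p.fst q.fst).trans (hp1.add hq1)
    · refine (Lp.coeFn_add (p.snd j) (q.snd j)).trans (((hp2 j).add (hq2 j)).trans ?_)
      refine Eventually.of_forall fun x => ?_
      simp [fderiv_add (hφ.differentiable (by simp) x) (hψ.differentiable (by simp) x)]
  | smul c p _ hp =>
    obtain ⟨φ, hφ, hφc, hφs, hp1, hp2⟩ := hp
    refine ⟨c • φ, hφ.const_smul c, hφc.smul_left (f := fun _ => c),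
      (tsupport_smul_subset_right (fun _ => c) φ).trans hφs, ?_, fun j => ?_⟩
    · exact (Lp.coeFn_smul c p.fst).trans (hp1.const_smul c)
    · refine (Lp.coeFn_smul c (p.snd j)).trans (((hp2 j).const_smul c).trans ?_)
      refine Eventually.of_forall fun x => ?_
      simp [fderiv_const_smul (hφ.differentiable (by simp) x) c]

theorem setIntegral_eq_of_tsupport_subset {Ω : Opens (Space d)} {φ g : Space d → ℝ}
    (hφ : tsupport φ ⊆ Ω) (hg : ∀ x ∉ tsupport φ, g x = 0) :
    ∫ x in Ω, g x = ∫ x, g x :=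
  setIntegral_eq_integral_of_forall_compl_eq_zero fun x hx => hg x fun h => hx (hφ h)

/-- The constant function `1` in `L²(Ω)`. -/
def constOne (Ω : Opens (Space d)) [IsFiniteMeasure (volume.restrict (Ω : Set (Space d)))] :
    L2 Ω := (memLp_const (1 : ℝ)).toLp _

theorem inner_constOne {Ω : Opens (Space d)}
    [IsFiniteMeasure (volume.restrict (Ω : Set (Space d)))] (q : L2 Ω) :
    ⟪constOne Ω, q⟫ = ∫ x in Ω, q x := by
  rw [MeasureTheory.L2.inner_def]
  refine integral_congr_ae ?_
  filter_upwards [(memLp_const (1 : ℝ) : MemLp (fun _ => (1 : ℝ)) 2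
    (volume.restrict (Ω : Set (Space d)))).coeFn_toLp] with x hx
  rw [show constOne Ω x = 1 from hx]
  simp

theorem integral_snd_eq_zero {Ω : Opens (Space d)}
    [IsFiniteMeasure (volume.restrict (Ω : Set (Space d)))] {p : L2Pair Ω} (hp : p ∈ H10 Ω)
    (j : Fin d) : ∫ x in Ω, p.snd j x = 0 := by
  rw [← inner_constOne]
  have hcl : IsClosed {p : L2Pair Ω | ⟪constOne Ω, p.snd j⟫ = 0} :=
    isClosed_eq (by fun_prop) continuous_const
  refine closure_minimal (fun p hp => ?_) hcl hp
  obtain ⟨φ, hφ, hφc, hφs, -, h2⟩ := exists_smooth_of_mem_span hp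
  rw [Set.mem_ofPred_eq, inner_constOne, integral_congr_ae (h2 j),
    setIntegral_eq_of_tsupport_subset hφs fun x hx => ?_,
    integral_fderiv_eq_zero (hφ.of_le (by simp)) hφc]
  rw [fderiv_of_notMem_tsupport (𝕜 := ℝ) hx, zero_apply]

theorem fderiv_coord_mul_sq {φ : Space d → ℝ} (hφ : ContDiff ℝ ∞ φ) (j : Fin d) (x : Space d) :
    fderiv ℝ (fun x : Space d => x j * φ x ^ 2) x (EuclideanSpace.single j 1) =
      φ x ^ 2 + 2 * x j * φ x * fderiv ℝ φ x (EuclideanSpace.single j 1) := by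
  have h1 : HasFDerivAt (fun x : Space d => x j) (EuclideanSpace.proj j : Space d →L[ℝ] ℝ) x :=
    (EuclideanSpace.proj j : Space d →L[ℝ] ℝ).hasFDerivAt
  have h2 := (hφ.differentiable (by simp) x).hasFDerivAt
  have h3 := h1.mul (h2.pow 2)
  rw [show (fun x : Space d => x j * φ x ^ 2) = (fun x : Space d => x j) * (fun x => φ x ^ 2)
    from rfl, h3.fderiv]
  simp
  ring

/-- The integral of ∂_j(x_j φ²) is zero, and twice this derivative plus 4x_j²(∂_jφ)² exceeds φ² by
the square (φ + 2x_j ∂_jφ)². -/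
theorem poincare_of_smooth {φ : Space d → ℝ} (hφ : ContDiff ℝ ∞ φ) (hφc : HasCompactSupport φ)
    (j : Fin d) {R : ℝ} (hR : ∀ x ∈ tsupport φ, ‖x‖ ≤ R) :
    ∫ x, φ x ^ 2 ≤ 4 * R ^ 2 * ∫ x, (fderiv ℝ φ x (EuclideanSpace.single j 1)) ^ 2 := by
  set e : Space d := EuclideanSpace.single j 1 with he
  have hcoord : ContDiff ℝ ∞ fun x : Space d => x j := by fun_prop
  have hprod : ContDiff ℝ ∞ fun x : Space d => x j * φ x ^ 2 := hcoord.mul (hφ.pow 2)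
  have hprodc : HasCompactSupport fun x : Space d => x j * φ x ^ 2 := by
    refine hφc.mono fun x hx h0 => hx ?_
    simp [h0]
  have hder := fun x => fderiv_coord_mul_sq hφ j x
  simp only [← he] at hder
  have hzero := integral_fderiv_eq_zero (hprod.of_le (by simp)) hprodc e
  have hcd : Continuous fun x => fderiv ℝ φ x e :=
    (hφ.continuous_fderiv (by simp)).clm_apply continuous_const
  have i1 := integrable_sq_of_hasCompactSupport hφ.continuous hφc
  have i2 := integrable_sq_of_hasCompactSupport hcd (hφc.fderiv_apply (𝕜 := ℝ) e)
  have i3 := integrable_fderiv_apply (hprod.of_le (by simp)) hprodc e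
  have hpt : ∀ x, φ x ^ 2 ≤ 2 * fderiv ℝ (fun x : Space d => x j * φ x ^ 2) x e +
      4 * R ^ 2 * (fderiv ℝ φ x e) ^ 2 := by
    intro x
    rw [hder]
    by_cases hx : x ∈ tsupport φ
    · have h1 : |x j| ≤ R := by
        have := (PiLp.norm_apply_le x j).trans (hR x hx)
        rwa [Real.norm_eq_abs] at this
      have h2 : x j ^ 2 ≤ R ^ 2 := sq_le_sq' (by linarith [(abs_le.1 h1).1]) (abs_le.1 h1).2
      linear_combination sq_nonneg (φ x + 2 * x j * fderiv ℝ φ x e) +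
        4 * mul_le_mul_of_nonneg_right h2 (sq_nonneg (fderiv ℝ φ x e))
    · rw [fderiv_of_notMem_tsupport (𝕜 := ℝ) hx, image_eq_zero_of_notMem_tsupport hx]
      simp
  calc ∫ x, φ x ^ 2 ≤ ∫ x, 2 * fderiv ℝ (fun x : Space d => x j * φ x ^ 2) x e +
        4 * R ^ 2 * (fderiv ℝ φ x e) ^ 2 :=
        integral_mono i1 ((i3.const_mul 2).add (i2.const_mul _)) hpt
    _ = _ := by
        rw [integral_add (i3.const_mul 2) (i2.const_mul _), integral_const_mul,
          integral_const_mul, hzero, mul_zero, zero_add]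

theorem norm_sq_eq_setIntegral {Ω : Opens (Space d)} {f : L2 Ω} {g : Space d → ℝ}
    (h : f =ᵐ[volume.restrict (Ω : Set (Space d))] g) : ‖f‖ ^ 2 = ∫ x in Ω, g x ^ 2 := by
  rw [← real_inner_self_eq_norm_sq, MeasureTheory.L2.inner_def]
  refine integral_congr_ae ?_
  filter_upwards [h] with x hx
  simp [hx]

theorem norm_fst_sq_le {Ω : Opens (Space d)} {R : ℝ} (hR : ∀ x ∈ Ω, ‖x‖ ≤ R) {p : L2Pair Ω}
    (hp : p ∈ H10 Ω) (j : Fin d) : ‖p.fst‖ ^ 2 ≤ 4 * R ^ 2 * ‖p.snd j‖ ^ 2 := by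
  have hcl : IsClosed {p : L2Pair Ω | ‖p.fst‖ ^ 2 ≤ 4 * R ^ 2 * ‖p.snd j‖ ^ 2} :=
    isClosed_le (by fun_prop) (by fun_prop)
  refine closure_minimal (fun p hp => ?_) hcl hp
  obtain ⟨φ, hφ, hφc, hφs, h1, h2⟩ := exists_smooth_of_mem_span hp
  rw [Set.mem_ofPred_eq, norm_sq_eq_setIntegral h1, norm_sq_eq_setIntegral (h2 j),
    setIntegral_eq_of_tsupport_subset hφs fun x hx => ?_,
    setIntegral_eq_of_tsupport_subset hφs fun x hx => ?_]
  · exact poincare_of_smooth hφ hφc j fun x hx => hR x (hφs hx)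
  · rw [fderiv_of_notMem_tsupport (𝕜 := ℝ) hx, zero_apply, zero_pow two_ne_zero]
  · rw [image_eq_zero_of_notMem_tsupport hx, zero_pow two_ne_zero]

end StokesTCoercivity
end

noncomputable section

namespace StokesTCoercivity

open scoped ENNReal NNReal ContDiff Topology
open Filter

variable {d : ℕ}

/-! ### The Stokes decomposition -/

theorem exists_forall_bilin_eq {E : Type*} [NormedAddCommGroup E] [InnerProductSpace ℝ E]
    [CompleteSpace E] {B : E →L[ℝ] E →L[ℝ] ℝ} (hB : IsCoercive B) (f : StrongDual ℝ E) :
    ∃ w, ∀ v, B w v = f v := by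
  refine ⟨hB.continuousLinearEquivOfBilin.symm ((InnerProductSpace.toDual ℝ E).symm f),
    fun v => ?_⟩
  rw [← hB.continuousLinearEquivOfBilin_apply, ContinuousLinearEquiv.apply_symm_apply,
    InnerProductSpace.toDual_symm_apply]

theorem exists_mem_forall_bilin_eq {E : Type*} [NormedAddCommGroup E] [InnerProductSpace ℝ E]
    [CompleteSpace E] {B : E →L[ℝ] E →L[ℝ] ℝ} (hB : IsCoercive B) {K : Submodule ℝ E}
    (hK : IsClosed (K : Set E)) (f : StrongDual ℝ E) : ∃ w ∈ K, ∀ v ∈ K, B w v = f v := by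
  have hcomplete : CompleteSpace K := hK.completeSpace_coe
  have hB' : IsCoercive (B.bilinearComp K.subtypeL K.subtypeL) := by
    obtain ⟨C, hC, h⟩ := hB
    exact ⟨C, hC, fun v => h v⟩
  obtain ⟨w, hw⟩ := exists_forall_bilin_eq hB' (f ∘L K.subtypeL)
  exact ⟨w, w.2, fun v hv => hw ⟨v, hv⟩⟩

/-- The inner product of gradients as a bounded bilinear form. -/
def gradForm (Ω : Opens (Space d)) : Velocity Ω →L[ℝ] Velocity Ω →L[ℝ] ℝ :=
  ∑ i, ∑ j, (innerSL ℝ).bilinearComp (partialD Ω i j) (partialD Ω i j)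

theorem gradForm_apply (Ω : Opens (Space d)) (v w : Velocity Ω) :
    gradForm Ω v w = gradInner Ω v w := by
  simp [gradForm, gradInner]

theorem negLaplacian_apply (Ω : Opens (Space d)) (v w : Velocity Ω) :
    negLaplacian Ω v w = gradForm Ω v w := by
  simp [gradForm, negLaplacian]

theorem gradForm_comm (Ω : Opens (Space d)) (v w : Velocity Ω) :
    gradForm Ω v w = gradForm Ω w v := by
  rw [gradForm_apply, gradForm_apply]
  exact Finset.sum_congr rfl fun i _ => Finset.sum_congr rfl fun j _ => real_inner_comm _ _

theorem gradDist_apply (Ω : Opens (Space d)) (z : L2 Ω) (v : Velocity Ω) :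
    gradDist Ω z v = -⟪z, divL Ω v⟫ := by
  simp [gradDist]

/-- Poincaré in a single direction `j0` bounds the L² part of each component, which gives the
constant 1 + 4R² between the squared H¹ norm and the gradient form. -/
theorem exists_coercive {Ω : Opens (Space d)} (hb : Bornology.IsBounded (Ω : Set (Space d)))
    (hd : d ≠ 0) : ∃ C, 0 < C ∧ ∀ v : Velocity Ω, C * ‖v‖ * ‖v‖ ≤ gradForm Ω v v := by
  obtain ⟨R, hR⟩ := hb.exists_norm_le
  have hj : Nonempty (Fin d) := ⟨⟨0, Nat.pos_of_ne_zero hd⟩⟩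
  obtain ⟨j0⟩ := hj
  refine ⟨(1 + 4 * R ^ 2)⁻¹, by positivity, fun v => ?_⟩
  rw [mul_assoc, ← sq, inv_mul_le_iff₀ (by positivity), gradForm_apply, gradInner,
    PiLp.norm_sq_eq_of_L2, Finset.mul_sum]
  refine Finset.sum_le_sum fun i _ => ?_
  have h1 : ‖v i‖ ^ 2 = ‖(v i : L2Pair Ω).fst‖ ^ 2 + ∑ j, ‖(v i : L2Pair Ω).snd j‖ ^ 2 := by
    rw [Submodule.coe_norm, WithLp.prod_norm_sq_eq_of_L2, PiLp.norm_sq_eq_of_L2]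
  have h2 := norm_fst_sq_le hR (v i).2 j0
  have h3 : ‖(v i : L2Pair Ω).snd j0‖ ^ 2 ≤ ∑ j, ‖(v i : L2Pair Ω).snd j‖ ^ 2 :=
    Finset.single_le_sum (f := fun j => ‖(v i : L2Pair Ω).snd j‖ ^ 2)
      (fun _ _ => sq_nonneg _) (Finset.mem_univ j0)
  have h4 : ∀ j, ⟪partialD Ω i j v, partialD Ω i j v⟫ = ‖(v i : L2Pair Ω).snd j‖ ^ 2 := fun j => by
    rw [real_inner_self_eq_norm_sq]; rfl
  simp only [h4]
  rw [h1]
  nlinarith [mul_le_mul_of_nonneg_left h3 (by positivity : 0 ≤ 4 * R ^ 2)]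

theorem isClosed_V (Ω : Opens (Space d)) : IsClosed (V Ω : Set (Velocity Ω)) :=
  (divL Ω).isClosed_ker

theorem mem_V {Ω : Opens (Space d)} {v : Velocity Ω} : v ∈ V Ω ↔ divL Ω v = 0 := LinearMap.mem_ker

theorem mem_Vperp {Ω : Opens (Space d)} {v : Velocity Ω} :
    v ∈ Vperp Ω ↔ ∀ w ∈ V Ω, gradForm Ω v w = 0 := by
  simp only [gradForm_apply]; rfl

theorem eq_zero_of_gradForm_self {Ω : Opens (Space d)}
    (hb : Bornology.IsBounded (Ω : Set (Space d))) (hd : d ≠ 0) {v : Velocity Ω}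
    (hv : gradForm Ω v v = 0) : v = 0 := by
  obtain ⟨C, hC, h⟩ := exists_coercive hb hd
  have h1 := h v
  rw [hv, mul_assoc] at h1
  have h2 : ‖v‖ * ‖v‖ ≤ 0 := by
    by_contra hc
    exact absurd h1 (not_le.2 (mul_pos hC (not_le.1 hc)))
  exact norm_eq_zero.1 (mul_self_eq_zero.1 (le_antisymm h2 (mul_self_nonneg _)))

theorem exists_mem_V_gradForm_eq {Ω : Opens (Space d)}
    (hb : Bornology.IsBounded (Ω : Set (Space d))) (hd : d ≠ 0) (f : HMinus1 Ω) :
    ∃ w ∈ V Ω, ∀ v ∈ V Ω, gradForm Ω w v = f v :=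
  exists_mem_forall_bilin_eq (exists_coercive hb hd) (isClosed_V Ω) f

theorem isClosed_L2zmv (Ω : Opens (Space d))
    [IsFiniteMeasure (volume.restrict (Ω : Set (Space d)))] :
    IsClosed (L2zmv Ω : Set (L2 Ω)) := by
  have h : (L2zmv Ω : Set (L2 Ω)) = {q | ⟪constOne Ω, q⟫ = 0} := by
    ext q
    rw [Set.mem_ofPred_eq, inner_constOne]
    exact ⟨fun h => h.2, fun h => ⟨(Lp.memLp q).integrable (by norm_num), h⟩⟩
  rw [h]
  exact isClosed_eq (by fun_prop) continuous_const

theorem divL_mem_L2zmv {Ω : Opens (Space d)}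
    [IsFiniteMeasure (volume.restrict (Ω : Set (Space d)))] (v : Velocity Ω) :
    divL Ω v ∈ L2zmv Ω := by
  rw [divL, sum_apply]
  exact Submodule.sum_mem _ fun i _ => ⟨(Lp.memLp (partialD Ω i i v)).integrable (by norm_num),
    integral_snd_eq_zero (v i).2 i⟩

/-- Subtracting from any solution its gradient-orthogonal projection onto 𝐕 does not change the
divergence. -/
theorem IsPolyhedralDomain.exists_mem_Vperp {Ω : Opens (Space d)} (hΩ : IsPolyhedralDomain Ω)
    (hd : d ≠ 0) (q : L2zmv Ω) : ∃ v : Vperp Ω, divL Ω v = q := by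
  obtain ⟨v, hv⟩ := hΩ.exists_divL_eq hd q.2.2
  obtain ⟨u, huV, hu⟩ := exists_mem_V_gradForm_eq hΩ.isBounded hd (gradForm Ω v)
  refine ⟨⟨v - u, mem_Vperp.2 fun w hw => ?_⟩, ?_⟩
  · rw [map_sub, sub_apply, hu w hw, sub_self]
  · rw [map_sub, hv, mem_V.1 huV, sub_zero]

theorem eq_zero_of_mem_V_of_mem_Vperp {Ω : Opens (Space d)}
    (hb : Bornology.IsBounded (Ω : Set (Space d))) (hd : d ≠ 0) {v : Velocity Ω} (hv : v ∈ V Ω)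
    (hv' : v ∈ Vperp Ω) : v = 0 :=
  eq_zero_of_gradForm_self hb hd (mem_Vperp.1 hv' v hv)

theorem IsPolyhedralDomain.existsUnique_mem_Vperp {Ω : Opens (Space d)}
    (hΩ : IsPolyhedralDomain Ω) (hd : d ≠ 0) (q : L2zmv Ω) :
    ∃! v : Vperp Ω, divL Ω v = q := by
  obtain ⟨v, hv⟩ := hΩ.exists_mem_Vperp hd q
  refine ⟨v, hv, fun v' hv' => ?_⟩
  have h : divL Ω v' = q := hv'
  have h0 := eq_zero_of_mem_V_of_mem_Vperp hΩ.isBounded hd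
    (mem_V.2 (by rw [map_sub, h, hv, sub_self])) (sub_mem v'.2 v.2)
  exact Subtype.ext (sub_eq_zero.1 h0)

/-- A functional on `𝐇¹₀(Ω)` vanishing on the divergence-free fields is a gradient. -/
theorem IsPolyhedralDomain.exists_gradDist_eq {Ω : Opens (Space d)} (hΩ : IsPolyhedralDomain Ω)
    (hd : d ≠ 0) {g : HMinus1 Ω} (hg : ∀ v ∈ V Ω, g v = 0) :
    ∃ z : L2zmv Ω, gradDist Ω z = g := by
  have hfm : IsFiniteMeasure (volume.restrict (Ω : Set (Space d))) :=
    isFiniteMeasure_restrict.2 hΩ.isBounded.measure_lt_top.ne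
  have hcomplete : CompleteSpace (L2zmv Ω) := (isClosed_L2zmv Ω).completeSpace_coe
  let D : Velocity Ω →L[ℝ] L2zmv Ω := (divL Ω).codRestrict (L2zmv Ω) divL_mem_L2zmv
  have hD : Function.Surjective D := fun q => by
    obtain ⟨v, hv⟩ := hΩ.exists_divL_eq hd q.2.2
    exact ⟨v, Subtype.ext hv⟩
  -- The open mapping theorem. The right inverse s chosen next is merely linear; g ∘ s is
  -- nevertheless continuous, because g depends only on the divergence and may be evaluated on the
  -- preimage of controlled norm.
  obtain ⟨C, -, hC⟩ := D.exists_preimage_norm_le hD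
  obtain ⟨s, hs⟩ := (D : Velocity Ω →ₗ[ℝ] L2zmv Ω).exists_rightInverse_of_surjective
    (LinearMap.range_eq_top.2 hD)
  have hs' : ∀ q, D (s q) = q := fun q => LinearMap.congr_fun hs q
  have hgs : ∀ v, g (s (D v)) = g v := fun v => by
    have h1 : s (D v) - v ∈ V Ω := by
      have h2 := congrArg Subtype.val (hs' (D v))
      rw [mem_V, map_sub, sub_eq_zero]
      exact h2
    have := hg _ h1
    rwa [map_sub, sub_eq_zero] at this
  let G : StrongDual ℝ (L2zmv Ω) := LinearMap.mkContinuous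
    ((g : Velocity Ω →ₗ[ℝ] ℝ) ∘ₗ s) (‖g‖ * C) fun q => by
      obtain ⟨v, rfl, hv⟩ := hC q
      have h1 : ((g : Velocity Ω →ₗ[ℝ] ℝ) ∘ₗ s) (D v) = g v := hgs v
      rw [h1, mul_assoc]
      exact (g.le_opNorm v).trans (mul_le_mul_of_nonneg_left hv (norm_nonneg g))
  -- The Riesz representative of G, with the sign of ⟨∇z, 𝐯⟩ = -(z, div 𝐯).
  refine ⟨-(InnerProductSpace.toDual ℝ (L2zmv Ω)).symm G, ?_⟩
  ext v
  have h1 : ⟪(InnerProductSpace.toDual ℝ (L2zmv Ω)).symm G, D v⟫ = G (D v) :=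
    InnerProductSpace.toDual_symm_apply
  rw [gradDist_apply, Submodule.coe_neg, inner_neg_left, neg_neg]
  exact h1.trans (hgs v)

theorem IsPolyhedralDomain.existsUnique_stokesSplit {Ω : Opens (Space d)}
    (hΩ : IsPolyhedralDomain Ω) (hd : d ≠ 0) (f : HMinus1 Ω) :
    ∃! p : L2zmv Ω × V Ω, f = gradDist Ω p.1 + negLaplacian Ω p.2 := by
  obtain ⟨w, hwV, hw⟩ := exists_mem_V_gradForm_eq hΩ.isBounded hd f
  obtain ⟨z, hz⟩ := hΩ.exists_gradDist_eq hd (g := f - negLaplacian Ω w) fun v hv => by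
    rw [sub_apply, negLaplacian_apply, hw v hv, sub_self]
  have hzw : f = gradDist Ω z + negLaplacian Ω w := by rw [hz, sub_add_cancel]
  refine ⟨(z, ⟨w, hwV⟩), hzw, ?_⟩
  rintro ⟨z', w'⟩ h'
  -- Uniqueness: testing with the divergence-free difference of the fields kills that difference;
  -- testing then with a field of divergence z' - z kills the other.
  have key : ∀ v, ⟪((z' - z : L2zmv Ω) : L2 Ω), divL Ω v⟫ =
      gradForm Ω (w' - w : Velocity Ω) v := fun v => by
    have h1 := congrArg (fun F : HMinus1 Ω => F v) (hzw.symm.trans h')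
    simp only [add_apply, gradDist_apply, negLaplacian_apply] at h1
    rw [Submodule.coe_sub, inner_sub_left, map_sub, sub_apply]
    linarith
  have hw0 : (w' - w : Velocity Ω) = 0 := by
    refine eq_zero_of_gradForm_self hΩ.isBounded hd ?_
    rw [← key, mem_V.1 (sub_mem w'.2 hwV), inner_zero_right]
  have hz0 : ((z' - z : L2zmv Ω) : L2 Ω) = 0 := by
    obtain ⟨v, hv⟩ := hΩ.exists_divL_eq hd (z' - z).2.2
    have := key v
    rwa [hv, hw0, map_zero, zero_apply, inner_self_eq_zero] at this
  refine Prod.ext ?_ ?_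
  · exact sub_eq_zero.1 (Subtype.ext hz0)
  · exact sub_eq_zero.1 (Subtype.ext hw0)

theorem IsPolyhedralDomain.divL_divLift {Ω : Opens (Space d)} (hΩ : IsPolyhedralDomain Ω)
    (hd : d ≠ 0) (q : L2zmv Ω) : divL Ω (divLift Ω q) = q :=
  Classical.epsilon_spec (p := fun v : Vperp Ω => divL Ω v = q) (hΩ.exists_mem_Vperp hd q)

/-- The field part of f lies in 𝐕, orthogonal to the lifting, and the pressure part only sees the
divergence of the lifting, which is q. -/
theorem IsPolyhedralDomain.apply_divLift {Ω : Opens (Space d)} (hΩ : IsPolyhedralDomain Ω)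
    (hd : d ≠ 0) (f : HMinus1 Ω) (q : L2zmv Ω) : f (divLift Ω q) = -⟪zPart Ω f, q⟫ := by
  have h : f = gradDist Ω (stokesSplit Ω f).1 + negLaplacian Ω (stokesSplit Ω f).2 :=
    Classical.epsilon_spec
      (p := fun p : L2zmv Ω × V Ω => f = gradDist Ω p.1 + negLaplacian Ω p.2)
      (hΩ.existsUnique_stokesSplit hd f).exists
  have h1 := congrArg (fun F : HMinus1 Ω => F (divLift Ω q)) h
  simp only [add_apply, gradDist_apply, negLaplacian_apply, hΩ.divL_divLift hd] at h1
  rw [gradForm_comm, mem_Vperp.1 (divLift Ω q).2 _ (stokesSplit Ω f).2.2, add_zero] at h1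
  exact h1

theorem IsPolyhedralDomain.ellLam_apply {Ω : Opens (Space d)} (hΩ : IsPolyhedralDomain Ω)
    (hd : d ≠ 0) (ν lam : ℝ) (f : HMinus1 Ω) (x : X Ω) :
    ellLam Ω ν lam f x = lam * f x.1 + ν⁻¹ * ⟪zPart Ω f, x.2⟫ := by
  rw [ellLam, ell, T, inner_zero_left, sub_zero, map_sub, map_smul, map_smul, smul_eq_mul,
    smul_eq_mul, hΩ.apply_divLift hd, mul_neg, sub_neg_eq_add]

end StokesTCoercivity
end

theorem mainTheorem9 {d : ℕ} (hd : d = 2 ∨ d = 3)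
    (Ω : TopologicalSpace.Opens (StokesTCoercivity.Space d))
    (hΩ : StokesTCoercivity.IsPolyhedralDomain Ω) :
    -- `ṽ_q` is well defined
    (∀ q : StokesTCoercivity.L2zmv Ω, ∃! v : StokesTCoercivity.Vperp Ω,
      StokesTCoercivity.divL Ω v = q) ∧
    -- `(z_f, 𝐰_f)` is well defined
    (∀ f : StokesTCoercivity.HMinus1 Ω,
      ∃! p : StokesTCoercivity.L2zmv Ω × StokesTCoercivity.V Ω,
        f = StokesTCoercivity.gradDist Ω p.1 + StokesTCoercivity.negLaplacian Ω p.2) ∧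
    -- the formula for `ℓ_λ`
    (∀ ν : ℝ, 0 < ν → ∀ lam : ℝ, ∀ f : StokesTCoercivity.HMinus1 Ω,
      StokesTCoercivity.ellLam Ω ν lam f =
        fun x : StokesTCoercivity.X Ω =>
          lam * f x.1 + ν⁻¹ * ⟪StokesTCoercivity.zPart Ω f, x.2⟫) := by
  have hd0 : d ≠ 0 := by omega
  exact ⟨hΩ.existsUnique_mem_Vperp hd0, hΩ.existsUnique_stokesSplit hd0,
    fun ν _ lam f => funext (hΩ.ellLam_apply hd0 ν lam f)⟩
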